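/- **Definitions.** A *partial field* $\mathbb P=(P,+,\cdot,0,1)$ is a set $P$ with a binary operation $\cdot$, a partial binary operation $+$ and elements $0,1$ such that: $(P\setminus\{0\},\cdot,1)$ is an abelian group and $0\cdot p=p\cdot 0=0$ for all $p$; $p+0=p$ for all $p$; for each $p$ there is a unique element $-p$ with $p+(-p)=0$; if $p+q$ is defined then $q+p$ is defined and equal to it; for $p\neq 0$, $p(q+r)$ is defined if and only if $pq+pr$ is defined, and then they are equal; and the associative law below holds. An *association* of a nonempty finite multiset $S$ over $P$ is a full binary tree whose leaves are labelled bijectively by the elements of $S$ and in which the label of each inner node is the (defined) sum of the labels of its two children; its value is the label of the root. A *pre-association* of a multiset with at least two elements is the same, except that the root is not labelled and the sum of the labels of its children need not be defined. The *associative law*: if $S$ has an association with value $r$, then for each pre-association of $S$ the sum of the labels of the two children of the root is defined and equals $r$. A sum $p_1+\dots+p_n$ is *defined* with value $r$ if, for some finite multiset $Z=\{z_1,-z_1,\dots,z_k,-z_k\}$ over $P$, the multiset $\{p_1,\dots,p_n\}\cup Z$ has an association with value $r$. Every field is a partial field in which all sums are defined. A determinant $\det A=\sum_\sigma \operatorname{sgn}(\sigma)\prod_i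 a_{i\sigma(i)}$ over $\mathbb P$ is *defined* if this sum is defined. A $\mathbb P$*-matrix* is a matrix over $\mathbb P$ such that the determinant of every square submatrix is defined. A finite matroid $M$ with ground set $E$ is *representable over* $\mathbb P$ ($\mathbb P$*-representable*) if for some $r$ there is an $r\times E$ $\mathbb P$-matrix $A$ such that the bases of $M$ are exactly the sets $B\subseteq E$ with $|B|=r$ and $\det A[r,B]\neq 0$, where $A[r,B]$ is the submatrix of $A$ formed by the columns in $B$. The *direct product* $\mathbb P_1\otimes\mathbb P_2$ of partial fields has underlying set $\{(p_1,p_2) : p_1\ne 0\iff p_2\neq 0\}$, zero $(0,0)$, identity $(1,1)$ and componentwise multiplication; $(p_1,p_2)+(q_1,q_2)$ is defined, with value $(p_1+q_1,p_2+q_2)$, if and only if both $p_i+q_i$ are defined and $p_1+q_1=0\iff p_2+q_2=0$. For a nonzero commutative ring $R$ and a set $S$ of units of $R$, $\mathbb P(R,S)$ is the partial field with underlying set $\langle S\cup\{-1\}\rangle\cup\{0\}$, where $\langle\cdot\rangle$ denotes the generated subgroup of the group of units, with the multiplication of $R$ and with $p+q$ defined, and equal to the sum in $R$, if and only if that sum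 lies in this set. Let $\mathbb U_1:=\mathbb P(\mathbb Q(\alpha),\{\alpha,1-\alpha\})$, where $\alpha$ is an indeterminate; a matroid is *near-regular* if it is $\mathbb U_1$-representable. **Theorem (Whittle).** Let $M$ be a finite matroid. The following are equivalent: 1. $M$ is representable over $\mathrm{GF}(3)\otimes\mathrm{GF}(4)\otimes\mathrm{GF}(5)$; 2. $M$ is representable over $\mathrm{GF}(3)\otimes\mathrm{GF}(8)$; 3. $M$ is near-regular, i.e. $\mathbb U_1$-representable; 4. $M$ is representable over every field with at least 3 elements. -/

import Mathlib

/-- `Association add s r`: there is an association (a full binary tree with leaves labelled by the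
elements of the multiset `s`, every inner node being labelled by the defined sum of the labels of
its children) whose root is labelled `r`. Here `x ∈ add u w` reads "`u + w` is defined and equal
to `x`". -/
inductive Association {P : Type*} (add : P → P → Part P) : Multiset P → P → Prop
  | leaf (p : P) : Association add {p} p
  | node {s t : Multiset P} {u w r : P} (hs : Association add s u) (ht : Association add t w)
      (hr : r ∈ add u w) : Association add (s + t) r

/-- A partial field. The multiplicative part is a `CommGroupWithZero`: the nonzero elements form an
abelian group with identity `1`, and `0` is absorbing. Addition `padd` is a partial binary
operation. The distributive law is imposed for nonzero `p`: for `p = 0` the product `p * (q + r)`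
is `0` by convention. -/
class PartialField (P : Type*) extends CommGroupWithZero P where
  /-- partial addition -/
  padd : P → P → Part P
  /-- the additive inverse -/
  pneg : P → P
  padd_zero : ∀ p : P, padd p 0 = Part.some p
  zero_mem_padd_pneg : ∀ p : P, 0 ∈ padd p (pneg p)
  eq_pneg_of_zero_mem : ∀ p q : P, 0 ∈ padd p q → q = pneg p
  padd_comm : ∀ p q : P, padd p q = padd q p
  mul_padd : ∀ p q r : P, p ≠ 0 → (padd q r).map (fun x => p * x) = padd (p * q) (p * r)
  /-- The associative law: if the multiset `s + t` has an association with value `r`, then every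
  pre-association of it, with children of the root labelled `u` and `w`, satisfies `u + w = r`. -/
  assoc_law : ∀ (s t : Multiset P) (r u w : P), Association padd (s + t) r →
    Association padd s u → Association padd t w → r ∈ padd u w

namespace PartialField

section Sums

variable {P : Type*} [PartialField P]

/-- The sum of the multiset `s` is defined and equal to `r`: for some finite multiset of the form
`{z₁, -z₁, …, zₖ, -zₖ}`, adding it to `s` gives a multiset that has an association with
value `r`. -/
def SumIs (s : Multiset P) (r : P) : Prop :=
  ∃ z : Multiset P, Association (padd (P := P)) (s + (z + z.map pneg)) r

/-- The sign of a permutation as an element `1` or `-1` of the partial field. -/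
def signOf (P : Type*) [PartialField P] (e : ℤˣ) : P := if e = 1 then 1 else pneg 1

/-- The determinant of the square matrix `A`, i.e. the sum over all permutations `σ` of
`sign σ * ∏ i, A i (σ i)`, is defined and equal to `d`. -/
def DetIs {k : ℕ} (A : Matrix (Fin k) (Fin k) P) (d : P) : Prop :=
  SumIs ((Finset.univ : Finset (Equiv.Perm (Fin k))).val.map
    (fun σ => signOf P (Equiv.Perm.sign σ) * ∏ i, A i (σ i))) d

/-- `A` is a `P`-matrix: the determinant of every square submatrix is defined. -/
def IsPMatrix {X Y : Type*} (A : Matrix X Y P) : Prop :=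
  ∀ (k : ℕ) (f : Fin k ↪ X) (g : Fin k ↪ Y), ∃ d : P, DetIs (A.submatrix f g) d

end Sums

/-- The matroid `M` is `P`-representable: there is an `r × E` `P`-matrix `A` such that the bases of
`M` are exactly the `r`-subsets `B` of the ground set `E` with `det A[r, B] ≠ 0`; here `B` is
enumerated by an injection `f : Fin r ↪ E`, whose choice affects only the sign of the determinant.
Since a matroid has a basis, such an `A` has rank `r`. -/
def Representable {α : Type*} (P : Type*) [PartialField P] (M : Matroid α) : Prop :=
  ∃ (r : ℕ) (A : Matrix (Fin r) M.E P), IsPMatrix A ∧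
    ∀ B : Set α, M.IsBase B ↔
      ∃ f : Fin r ↪ M.E, Set.range (fun i => (f i : α)) = B ∧
        ∃ d : P, d ≠ 0 ∧ DetIs (A.submatrix id f) d

/-- A map to a commutative monoid that respects defined sums takes the value of an association to the
sum of the images of its leaves. -/
theorem association_hom {P R : Type*} [AddCommMonoid R] {add : P → P → Part P} (φ : P → R)
    (h : ∀ p q r, r ∈ add p q → φ r = φ p + φ q) {s : Multiset P} {r : P}
    (hs : Association add s r) : (s.map φ).sum = φ r := by
  induction hs with
  | leaf p => simp
  | node hs ht hr ihs iht => rw [Multiset.map_add, Multiset.sum_add, ihs, iht, h _ _ _ hr]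

/-- A map that respects defined sums maps associations to associations. -/
theorem Association.map {P Q : Type*} {add : P → P → Part P} {add' : Q → Q → Part Q} (φ : P → Q)
    (h : ∀ p q r, r ∈ add p q → φ r ∈ add' (φ p) (φ q)) {s : Multiset P} {r : P}
    (hs : Association add s r) : Association add' (s.map φ) (φ r) := by
  induction hs with
  | leaf p => simpa using Association.leaf (φ p)
  | node hs ht hr ihs iht => rw [Multiset.map_add]; exact .node ihs iht (h _ _ _ hr)

/-- A field is a partial field in which all sums are defined. -/
instance ofField (F : Type*) [Field F] : PartialField F where
  padd p q := Part.some (p + q)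
  pneg p := -p
  padd_zero p := by simp
  zero_mem_padd_pneg p := by simp
  eq_pneg_of_zero_mem p q h := by
    rw [Part.mem_some_iff] at h
    exact (neg_eq_of_add_eq_zero_right h.symm).symm
  padd_comm p q := by rw [add_comm]
  mul_padd p q r _ := by simp [mul_add]
  assoc_law s t r u w h hs ht := by
    have key := fun {s : Multiset F} {r : F} => association_hom (R := F)
      (add := fun p q : F => Part.some (p + q)) id (by simp) (s := s) (r := r)
    have h1 := key h
    rw [Multiset.map_add, Multiset.sum_add, key hs, key ht] at h1
    exact Part.mem_some_iff.2 h1.symm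

/-- The subset `⟨S ∪ {-1}⟩ ∪ {0}` of the commutative ring `R`, where `⟨S ∪ {-1}⟩` is the subgroup
of the group of units generated by `S` and `-1`. -/
def fromRingSet (R : Type*) [CommRing R] (S : Set Rˣ) : Set R :=
  insert 0 (Units.val '' (Subgroup.closure (S ∪ {-1}) : Set Rˣ))

/-- The underlying type of the partial field `ℙ(R, S)`. -/
def FromRing (R : Type*) [CommRing R] (S : Set Rˣ) := fromRingSet R S

section FromRing

variable {R : Type*} [CommRing R] {S : Set Rˣ}

theorem fromRingSet.zero_mem : (0 : R) ∈ fromRingSet R S := Or.inl rfl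

theorem fromRingSet.one_mem : (1 : R) ∈ fromRingSet R S :=
  Or.inr ⟨1, Subgroup.one_mem _, by simp⟩

theorem fromRingSet.mul_mem {x y : R} (hx : x ∈ fromRingSet R S) (hy : y ∈ fromRingSet R S) :
    x * y ∈ fromRingSet R S := by
  rcases hx with rfl | ⟨u, hu, rfl⟩
  · rw [zero_mul]; exact fromRingSet.zero_mem
  rcases hy with rfl | ⟨v, hv, rfl⟩
  · rw [mul_zero]; exact fromRingSet.zero_mem
  exact Or.inr ⟨u * v, Subgroup.mul_mem _ hu hv, by simp⟩

theorem fromRingSet.inverse_mem {x : R} (hx : x ∈ fromRingSet R S) :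
    Ring.inverse x ∈ fromRingSet R S := by
  rcases hx with rfl | ⟨u, hu, rfl⟩
  · rw [Ring.inverse_zero]; exact fromRingSet.zero_mem
  exact Or.inr ⟨u⁻¹, Subgroup.inv_mem _ hu, by simp⟩

theorem fromRingSet.neg_mem {x : R} (hx : x ∈ fromRingSet R S) : -x ∈ fromRingSet R S := by
  rw [← neg_one_mul]
  exact fromRingSet.mul_mem (Or.inr ⟨-1, Subgroup.subset_closure (by simp), by simp⟩) hx

noncomputable instance FromRing.commGroupWithZero [Nontrivial R] :
    CommGroupWithZero (FromRing R S) where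
  mul x y := ⟨x.1 * y.1, fromRingSet.mul_mem x.2 y.2⟩
  one := ⟨1, fromRingSet.one_mem⟩
  zero := ⟨0, fromRingSet.zero_mem⟩
  inv x := ⟨Ring.inverse x.1, fromRingSet.inverse_mem x.2⟩
  mul_assoc x y z := Subtype.ext (mul_assoc x.1 y.1 z.1)
  mul_comm x y := Subtype.ext (mul_comm x.1 y.1)
  one_mul x := Subtype.ext (one_mul x.1)
  mul_one x := Subtype.ext (mul_one x.1)
  zero_mul x := Subtype.ext (zero_mul x.1)
  mul_zero x := Subtype.ext (mul_zero x.1)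
  exists_pair_ne := ⟨⟨0, fromRingSet.zero_mem⟩, ⟨1, fromRingSet.one_mem⟩,
    fun h => zero_ne_one (congrArg Subtype.val h)⟩
  inv_zero := Subtype.ext (Ring.inverse_zero R)
  mul_inv_cancel x hx := by
    apply Subtype.ext
    obtain ⟨x, rfl | ⟨u, hu, rfl⟩⟩ := x
    · exact absurd rfl hx
    · exact Ring.mul_inverse_cancel _ u.isUnit

/-- Addition in `ℙ(R, S)`, restricted from `R`: the sum `x + y` is defined if and only if the sum
in `R` lies in `⟨S ∪ {-1}⟩ ∪ {0}`. -/
def FromRing.add (x y : FromRing R S) : Part (FromRing R S) :=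
  ⟨x.1 + y.1 ∈ fromRingSet R S, fun h => ⟨x.1 + y.1, h⟩⟩

theorem FromRing.mem_add {x y z : FromRing R S} : z ∈ FromRing.add x y ↔ z.1 = x.1 + y.1 := by
  constructor
  · rintro ⟨h, rfl⟩
    rfl
  · intro h
    have hz : x.1 + y.1 ∈ fromRingSet R S := h ▸ z.2
    exact ⟨hz, Subtype.ext h.symm⟩

/-- The partial field `ℙ(R, S)`, with multiplication and addition restricted from `R`. -/
noncomputable instance fromRing [Nontrivial R] : PartialField (FromRing R S) where
  padd := FromRing.add
  pneg x := ⟨-x.1, fromRingSet.neg_mem x.2⟩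
  padd_zero p := Part.eq_some_iff.2 (FromRing.mem_add.2 (add_zero p.1).symm)
  zero_mem_padd_pneg p := FromRing.mem_add.2 (add_neg_cancel p.1).symm
  eq_pneg_of_zero_mem p q h := by
    have h' : (0 : R) = p.1 + q.1 := FromRing.mem_add.1 h
    exact Subtype.ext (neg_eq_of_add_eq_zero_right h'.symm).symm
  padd_comm p q := by
    ext x
    rw [FromRing.mem_add, FromRing.mem_add, add_comm]
  mul_padd p q r hp := by
    ext x
    rw [Part.mem_map_iff, FromRing.mem_add]
    change _ ↔ x.1 = p.1 * q.1 + p.1 * r.1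
    have hi : (p⁻¹ : FromRing R S).1 * p.1 = 1 := congrArg Subtype.val (inv_mul_cancel₀ hp)
    constructor
    · rintro ⟨y, hy, rfl⟩
      change p.1 * y.1 = _
      rw [FromRing.mem_add.1 hy, mul_add]
    · intro h
      refine ⟨p⁻¹ * x, FromRing.mem_add.2 ?_, mul_inv_cancel_left₀ hp x⟩
      change (p⁻¹ : FromRing R S).1 * x.1 = _
      rw [h, ← mul_add, ← mul_assoc, hi, one_mul]
  assoc_law s t r u w h hs ht := by
    have key := fun {s : Multiset (FromRing R S)} {r : FromRing R S} =>
      association_hom (R := R) (add := FromRing.add) Subtype.val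
        (fun _ _ _ => FromRing.mem_add.1) (s := s) (r := r)
    have h1 := key h
    rw [Multiset.map_add, Multiset.sum_add, key hs, key ht] at h1
    exact FromRing.mem_add.2 h1.symm

end FromRing

/-- The underlying set of the direct product `P ⊗ Q` of two partial fields. -/
def DirectProduct (P Q : Type*) [PartialField P] [PartialField Q] :=
  {x : P × Q // x.1 ≠ 0 ↔ x.2 ≠ 0}

section DirectProduct

variable {P Q : Type*} [PartialField P] [PartialField Q]

theorem pneg_eq_zero_iff (p : P) : pneg p = 0 ↔ p = 0 := by
  constructor
  · intro e
    have h := zero_mem_padd_pneg p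
    rw [e, padd_zero, Part.mem_some_iff] at h
    exact h.symm
  · rintro rfl
    refine (eq_pneg_of_zero_mem (0 : P) 0 ?_).symm
    rw [padd_zero]
    exact Part.mem_some _

instance DirectProduct.commGroupWithZero : CommGroupWithZero (DirectProduct P Q) where
  mul x y := ⟨x.1 * y.1, by
    have hx := x.2
    have hy := y.2
    simp only [Prod.fst_mul, Prod.snd_mul, mul_ne_zero_iff, hx, hy]⟩
  one := ⟨1, by simp⟩
  zero := ⟨0, by simp⟩
  inv x := ⟨(x.1.1⁻¹, x.1.2⁻¹), by
    have hx := x.2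
    simpa using hx⟩
  mul_assoc x y z := Subtype.ext (mul_assoc x.1 y.1 z.1)
  mul_comm x y := Subtype.ext (mul_comm x.1 y.1)
  one_mul x := Subtype.ext (one_mul x.1)
  mul_one x := Subtype.ext (mul_one x.1)
  zero_mul x := Subtype.ext (zero_mul x.1)
  mul_zero x := Subtype.ext (mul_zero x.1)
  exists_pair_ne := ⟨⟨0, by simp⟩, ⟨1, by simp⟩, fun h => zero_ne_one (congrArg Subtype.val h)⟩
  inv_zero := Subtype.ext (Prod.ext (inv_zero (G₀ := P)) (inv_zero (G₀ := Q)))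
  mul_inv_cancel x hx := by
    have hx' : x.1.1 ≠ 0 := by
      intro h
      have h2 : x.1.2 = 0 := by
        by_contra h2
        exact x.2.2 h2 h
      exact hx (Subtype.ext (Prod.ext h h2))
    exact Subtype.ext (Prod.ext (mul_inv_cancel₀ hx') (mul_inv_cancel₀ (x.2.1 hx')))

/-- Componentwise partial addition: `(p₁, p₂) + (q₁, q₂)` is defined if and only if both
`p₁ + q₁` and `p₂ + q₂` are defined and `p₁ + q₁ = 0 ↔ p₂ + q₂ = 0`. -/
def DirectProduct.add (x y : DirectProduct P Q) : Part (DirectProduct P Q) :=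
  ⟨∃ (h₁ : (padd x.1.1 y.1.1).Dom) (h₂ : (padd x.1.2 y.1.2).Dom),
      (padd x.1.1 y.1.1).get h₁ = 0 ↔ (padd x.1.2 y.1.2).get h₂ = 0,
    fun h => ⟨((padd x.1.1 y.1.1).get h.1, (padd x.1.2 y.1.2).get h.2.1), not_congr h.2.2⟩⟩

theorem DirectProduct.mem_add {x y z : DirectProduct P Q} :
    z ∈ DirectProduct.add x y ↔ z.1.1 ∈ padd x.1.1 y.1.1 ∧ z.1.2 ∈ padd x.1.2 y.1.2 := by
  constructor
  · rintro ⟨⟨h₁, h₂, h⟩, rfl⟩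
    exact ⟨Part.get_mem h₁, Part.get_mem h₂⟩
  · rintro ⟨⟨h₁, e₁⟩, ⟨h₂, e₂⟩⟩
    refine ⟨⟨h₁, h₂, ?_⟩, Subtype.ext (Prod.ext e₁ e₂)⟩
    rw [e₁, e₂]
    exact not_iff_not.1 z.2

/-- The direct product `P ⊗ Q` of two partial fields. -/
instance directProduct : PartialField (DirectProduct P Q) where
  padd := DirectProduct.add
  pneg x := ⟨(pneg x.1.1, pneg x.1.2), by
    simpa only [ne_eq, pneg_eq_zero_iff] using x.2⟩
  padd_zero p := by
    refine Part.eq_some_iff.2 (DirectProduct.mem_add.2 ⟨?_, ?_⟩)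
    · exact (padd_zero p.1.1).symm ▸ Part.mem_some _
    · exact (padd_zero p.1.2).symm ▸ Part.mem_some _
  zero_mem_padd_pneg p :=
    DirectProduct.mem_add.2 ⟨zero_mem_padd_pneg p.1.1, zero_mem_padd_pneg p.1.2⟩
  eq_pneg_of_zero_mem p q h := by
    obtain ⟨h₁, h₂⟩ := DirectProduct.mem_add.1 h
    exact Subtype.ext (Prod.ext (eq_pneg_of_zero_mem _ _ h₁) (eq_pneg_of_zero_mem _ _ h₂))
  padd_comm p q := by
    ext x
    rw [DirectProduct.mem_add, DirectProduct.mem_add, padd_comm p.1.1, padd_comm p.1.2]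
  mul_padd p q r hp := by
    have hp₁ : p.1.1 ≠ 0 := by
      intro h
      have h2 : p.1.2 = 0 := by
        by_contra h2
        exact p.2.2 h2 h
      exact hp (Subtype.ext (Prod.ext h h2))
    have hp₂ : p.1.2 ≠ 0 := p.2.1 hp₁
    ext x
    rw [Part.mem_map_iff, DirectProduct.mem_add]
    change _ ↔ x.1.1 ∈ padd (p.1.1 * q.1.1) (p.1.1 * r.1.1) ∧
      x.1.2 ∈ padd (p.1.2 * q.1.2) (p.1.2 * r.1.2)
    rw [← mul_padd _ _ _ hp₁, ← mul_padd _ _ _ hp₂, Part.mem_map_iff, Part.mem_map_iff]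
    constructor
    · rintro ⟨y, hy, rfl⟩
      obtain ⟨h₁, h₂⟩ := DirectProduct.mem_add.1 hy
      exact ⟨⟨_, h₁, rfl⟩, ⟨_, h₂, rfl⟩⟩
    · rintro ⟨⟨y₁, h₁, e₁⟩, ⟨y₂, h₂, e₂⟩⟩
      have hy : y₁ ≠ 0 ↔ y₂ ≠ 0 := by
        have hx := x.2
        rw [← e₁, ← e₂, mul_ne_zero_iff, mul_ne_zero_iff] at hx
        simpa [hp₁, hp₂] using hx
      exact ⟨⟨(y₁, y₂), hy⟩, DirectProduct.mem_add.2 ⟨h₁, h₂⟩, Subtype.ext (Prod.ext e₁ e₂)⟩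
  assoc_law s t r u w h hs ht := by
    have key₁ := fun {s : Multiset (DirectProduct P Q)} {r : DirectProduct P Q} =>
      Association.map (add := DirectProduct.add) (add' := padd (P := P))
        (fun x : DirectProduct P Q => x.1.1) (fun _ _ _ h => (DirectProduct.mem_add.1 h).1)
        (s := s) (r := r)
    have key₂ := fun {s : Multiset (DirectProduct P Q)} {r : DirectProduct P Q} =>
      Association.map (add := DirectProduct.add) (add' := padd (P := Q))
        (fun x : DirectProduct P Q => x.1.2) (fun _ _ _ h => (DirectProduct.mem_add.1 h).2)
        (s := s) (r := r)
    refine DirectProduct.mem_add.2 ⟨?_, ?_⟩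
    · exact assoc_law _ _ _ _ _ (Multiset.map_add _ s t ▸ key₁ h) (key₁ hs) (key₁ ht)
    · exact assoc_law _ _ _ _ _ (Multiset.map_add _ s t ▸ key₂ h) (key₂ hs) (key₂ ht)

end DirectProduct

/-- The near-regular partial field `𝕌₁ = ℙ(ℚ(α), {α, 1 - α})`. -/
abbrev NearRegularField : Type :=
  FromRing (RatFunc ℚ) {u : (RatFunc ℚ)ˣ | (u : RatFunc ℚ) = RatFunc.X ∨
    (u : RatFunc ℚ) = 1 - RatFunc.X}

/-- A matroid is near-regular if it is representable over `𝕌₁`. -/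
def NearRegular {α : Type*} (M : Matroid α) : Prop := Representable NearRegularField M

instance fact_prime_five : Fact (Nat.Prime 5) := ⟨by norm_num⟩

end PartialField

/-!
For a partial field `P` embedded in a ring `R` with nonzero elements `G ≤ Rˣ`, a matrix over `P` is
a `P`-matrix exactly when its minors in `R` lie in `G ∪ {0}`: such matrices are closed under
pivoting, and pivoting evaluates determinants inside `P`. Thus the direct products of the theorem
may be replaced by the rings `GF(3) × GF(4) × GF(5)` and `GF(3) × GF(8)`, and `𝕌₁` by `ℤ[α, 1/α,
1/(1 - α)]`.

The core is a lift theorem in the style of Pendavingh and Van Zwam. Let `φ : O → R` map `G ≤ Oˣ`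
onto `Rˣ` and the fundamental elements of `G` (those `f` with `1 - f ∈ G ∪ {0}`) bijectively onto
those of `Rˣ`, where `R` maps to `GF(3)` and `2` is not a unit in `R`. Then every matrix over `R`
whose minors are zero or units lifts to a matrix whose minors are zero or in `G`. By induction on
the size all proper submatrices lift, and lifts of a connected matrix are unique up to scaling. If
the bipartite graph of the nonzero entries stays connected after deleting columns `u` and `v`, the
lifts of the matrices without `u` and without `v` therefore glue, and pivoting reduces a minor
through both columns to the minors on two rows joined by a walk avoiding `u` and `v`. Such a pair of
lines exists if some vertex has degree at least three, and in a cycle longer than four after one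
pivot; the remaining cases are immediate.

Both rings have exactly six exceptional units, namely the associates of one element `a`, so `α ↦ a`
satisfies the hypotheses of the lift theorem; hence (1) and (2) imply (3). Conversely, `α` can be
evaluated at any element other than `0` and `1` of a field, and representations over two fields that
contain the same identity matrix combine into one over the product.
-/

namespace PartialField

open Matrix

section Minors

variable {R X Y : Type*} [CommRing R] {G : Subgroup Rˣ}

/-- `x` is zero or a unit that belongs to the group `G`: the entries and minors of the matrices
below are elements of this kind. -/
def ZeroOrMem (G : Subgroup Rˣ) (x : R) : Prop := x = 0 ∨ ∃ g ∈ G, (g : R) = x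

theorem ZeroOrMem.zero : ZeroOrMem G (0 : R) := Or.inl rfl

theorem ZeroOrMem.of_mem {g : Rˣ} (hg : g ∈ G) : ZeroOrMem G (g : R) := Or.inr ⟨g, hg, rfl⟩

theorem ZeroOrMem.one : ZeroOrMem G (1 : R) := .of_mem G.one_mem

theorem ZeroOrMem.mul {x y : R} (hx : ZeroOrMem G x) (hy : ZeroOrMem G y) :
    ZeroOrMem G (x * y) := by
  rcases hx with rfl | ⟨g, hg, rfl⟩
  · rw [zero_mul]; exact .zero
  rcases hy with rfl | ⟨k, hk, rfl⟩
  · rw [mul_zero]; exact .zero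
  exact Or.inr ⟨g * k, G.mul_mem hg hk, rfl⟩

theorem ZeroOrMem.neg (hG : -1 ∈ G) {x : R} (hx : ZeroOrMem G x) : ZeroOrMem G (-x) := by
  simpa using (ZeroOrMem.of_mem hG).mul hx

theorem ZeroOrMem.neg_iff (hG : -1 ∈ G) {x : R} : ZeroOrMem G (-x) ↔ ZeroOrMem G x :=
  ⟨fun h => by simpa using h.neg hG, fun h => h.neg hG⟩

theorem ZeroOrMem.sub_comm_iff (hG : -1 ∈ G) {x y : R} :
    ZeroOrMem G (x - y) ↔ ZeroOrMem G (y - x) := by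
  rw [← ZeroOrMem.neg_iff hG, neg_sub]

theorem ZeroOrMem.neg_one_pow_mul (hG : -1 ∈ G) (n : ℕ) {x : R} (hx : ZeroOrMem G x) :
    ZeroOrMem G ((-1) ^ n * x) := by
  rcases neg_one_pow_eq_or R n with h | h <;> rw [h]
  · rwa [one_mul]
  · rw [neg_one_mul]; exact hx.neg hG

theorem ZeroOrMem.sign_mul_iff (hG : -1 ∈ G) (e : ℤˣ) {x : R} :
    ZeroOrMem G (((e : ℤ) : R) * x) ↔ ZeroOrMem G x := by
  rcases Int.units_eq_one_or e with rfl | rfl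
  · simp
  · simpa using ZeroOrMem.neg_iff hG

theorem ZeroOrMem.mul_iff {g : Rˣ} (hg : g ∈ G) {x : R} :
    ZeroOrMem G (g * x) ↔ ZeroOrMem G x :=
  ⟨fun h => by simpa using (ZeroOrMem.of_mem (G.inv_mem hg)).mul h,
    fun h => (ZeroOrMem.of_mem hg).mul h⟩

theorem ZeroOrMem.exists_of_ne {x : R} (hx : ZeroOrMem G x) (h : x ≠ 0) :
    ∃ g ∈ G, (g : R) = x := hx.resolve_left h

theorem ZeroOrMem.isUnit {x : R} (hx : ZeroOrMem G x) (h : x ≠ 0) : IsUnit x := by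
  obtain ⟨g, -, rfl⟩ := hx.exists_of_ne h
  exact g.isUnit

theorem zeroOrMem_top_iff {x : R} : ZeroOrMem (⊤ : Subgroup Rˣ) x ↔ x = 0 ∨ IsUnit x := by
  simp [ZeroOrMem, IsUnit]

/-- Every minor of `A` with columns in `T` is zero or in `G`. Rows and columns may be repeated, as
this only adds zero minors. -/
def MinorsOn (G : Subgroup Rˣ) (A : Matrix X Y R) (T : Set Y) : Prop :=
  ∀ (k : ℕ) (f : Fin k → X) (g : Fin k → Y), (∀ i, g i ∈ T) → ZeroOrMem G (A.submatrix f g).det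

/-- Every minor of `A` is zero or in `G`. -/
def MinorsIn (G : Subgroup Rˣ) (A : Matrix X Y R) : Prop :=
  ∀ (k : ℕ) (f : Fin k → X) (g : Fin k → Y), ZeroOrMem G (A.submatrix f g).det

theorem MinorsIn.minorsOn {A : Matrix X Y R} (h : MinorsIn G A) (T : Set Y) : MinorsOn G A T :=
  fun k f g _ => h k f g

theorem MinorsOn.mono {A : Matrix X Y R} {S T : Set Y} (h : MinorsOn G A T) (hST : S ⊆ T) :
    MinorsOn G A S := fun k f g hg => h k f g fun i => hST (hg i)

theorem minorsOn_iff {A : Matrix X Y R} {T : Set Y} :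
    MinorsOn G A T ↔ MinorsIn G (A.submatrix id (Subtype.val : T → Y)) :=
  ⟨fun h k f g => h k f (fun i => (g i).1) fun i => (g i).2,
    fun h k f g hg => h k f fun i => ⟨g i, hg i⟩⟩

theorem MinorsOn.congr {A B : Matrix X Y R} {T : Set Y} (h : MinorsOn G A T)
    (hAB : ∀ x, ∀ y ∈ T, A x y = B x y) : MinorsOn G B T := by
  intro k f g hg
  convert h k f g hg using 2
  ext i j
  exact (hAB _ _ (hg j)).symm

theorem MinorsIn.submatrix {A : Matrix X Y R} (h : MinorsIn G A) {X' Y' : Type*}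
    (f : X' → X) (g : Y' → Y) : MinorsIn G (A.submatrix f g) :=
  fun k f' g' => h k (f ∘ f') (g ∘ g')

theorem MinorsIn.transpose {A : Matrix X Y R} (h : MinorsIn G A) : MinorsIn G Aᵀ := by
  intro k f g
  rw [← det_transpose]
  exact h k g f

theorem MinorsIn.det {A : Matrix X Y R} (h : MinorsIn G A) {m : Type*} [Fintype m]
    [DecidableEq m] (f : m → X) (g : m → Y) : ZeroOrMem G (A.submatrix f g).det := by
  let e := (Fintype.equivFin m).symm
  rw [← det_submatrix_equiv_self e]
  exact h _ (f ∘ e) (g ∘ e)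

theorem MinorsOn.apply {A : Matrix X Y R} {T : Set Y} (h : MinorsOn G A T) (x : X) {y : Y}
    (hy : y ∈ T) : ZeroOrMem G (A x y) := by
  simpa using h 1 (fun _ => x) (fun _ => y) fun _ => hy

theorem MinorsIn.apply {A : Matrix X Y R} (h : MinorsIn G A) (x : X) (y : Y) :
    ZeroOrMem G (A x y) := (h.minorsOn Set.univ).apply x trivial

theorem MinorsOn.two {A : Matrix X Y R} {T : Set Y} (h : MinorsOn G A T) (p q : X) {u v : Y}
    (hu : u ∈ T) (hv : v ∈ T) : ZeroOrMem G (A p u * A q v - A p v * A q u) := by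
  have := h 2 ![p, q] ![u, v] (by intro i; fin_cases i <;> simpa)
  rwa [det_fin_two] at this

theorem MinorsOn.three {A : Matrix X Y R} {T : Set Y} (h : MinorsOn G A T) (p q r : X) {u v w : Y}
    (hu : u ∈ T) (hv : v ∈ T) (hw : w ∈ T) :
    ZeroOrMem G (A p u * A q v * A r w - A p u * A q w * A r v - A p v * A q u * A r w
      + A p v * A q w * A r u + A p w * A q u * A r v - A p w * A q v * A r u) := by
  have := h 3 ![p, q, r] ![u, v, w] (by intro i; fin_cases i <;> simpa)
  rwa [det_fin_three] at this

theorem MinorsOn.scale {A : Matrix X Y R} {T : Set Y} (h : MinorsOn G A T) (s : X → Rˣ)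
    (t : Y → Rˣ) (hs : ∀ x, s x ∈ G) (ht : ∀ y, t y ∈ G) :
    MinorsOn G (Matrix.of fun x y => (s x : R) * A x y * t y) T := by
  intro k f g hg
  have hdiag : (Matrix.of fun x y => (s x : R) * A x y * t y).submatrix f g =
      diagonal (fun i => (s (f i) : R)) * A.submatrix f g * diagonal (fun i => (t (g i) : R)) := by
    ext i j
    simp
  rw [hdiag, det_mul, det_mul, det_diagonal, det_diagonal, ← Units.coe_prod, ← Units.coe_prod]
  exact ((ZeroOrMem.of_mem (G.prod_mem fun i _ => hs _)).mul (h k f g hg)).mul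
    (.of_mem (G.prod_mem fun i _ => ht _))

theorem MinorsIn.map {S : Type*} [CommRing S] {A : Matrix X Y R} (h : MinorsIn G A)
    (φ : R →+* S) {H : Subgroup Sˣ} (hH : ∀ g ∈ G, Units.map φ.toMonoidHom g ∈ H) :
    MinorsIn H (A.map φ) := by
  intro k f g
  rw [submatrix_map, ← RingHom.mapMatrix_apply, ← RingHom.map_det]
  rcases h k f g with h | ⟨u, hu, h⟩
  · rw [h, map_zero]; exact .zero
  · rw [← h]
    exact Or.inr ⟨_, hH u hu, rfl⟩

theorem det_submatrix_eq_zero_of_not_injective_left (A : Matrix X Y R) {m : Type*} [Fintype m]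
    [DecidableEq m] {f : m → X} (g : m → Y) (hf : ¬ Function.Injective f) :
    (A.submatrix f g).det = 0 := by
  simp only [Function.Injective, not_forall] at hf
  obtain ⟨i, j, h, hij⟩ := hf
  exact det_zero_of_row_eq hij (by ext c; simp [h])

theorem det_submatrix_eq_zero_of_not_injective_right (A : Matrix X Y R) {m : Type*} [Fintype m]
    [DecidableEq m] (f : m → X) {g : m → Y} (hg : ¬ Function.Injective g) :
    (A.submatrix f g).det = 0 := by
  rw [← det_transpose, transpose_submatrix]
  exact det_submatrix_eq_zero_of_not_injective_left _ _ hg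

theorem zeroOrMem_det_of_column (hG : -1 ∈ G) {n : ℕ} (N : Matrix (Fin (n + 1)) (Fin (n + 1)) R)
    (i j : Fin (n + 1)) (h0 : ∀ i', i' ≠ i → N i' j = 0) (h1 : ZeroOrMem G (N i j))
    (h2 : ZeroOrMem G (N.submatrix i.succAbove j.succAbove).det) : ZeroOrMem G N.det := by
  rw [det_succ_column N j, Finset.sum_eq_single i]
  · exact (h1.neg_one_pow_mul hG _).mul h2
  · intro i' _ hi'
    rw [h0 i' hi', mul_zero, zero_mul]
  · simp

theorem MinorsIn.fromCols_one [DecidableEq X] (hG : -1 ∈ G) {A : Matrix X Y R}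
    (h : MinorsIn G A) : MinorsIn G (fromCols A (1 : Matrix X X R)) := by
  intro k
  induction k with
  | zero => intro f g; rw [det_isEmpty]; exact .one
  | succ k ih =>
    intro f g
    by_cases hf : Function.Injective f
    swap
    · rw [det_submatrix_eq_zero_of_not_injective_left _ _ hf]
      exact .zero
    by_cases hg : ∃ j x, g j = Sum.inr x
    · obtain ⟨j, x, hx⟩ := hg
      by_cases hi : ∃ i, f i = x
      · obtain ⟨i, rfl⟩ := hi
        refine zeroOrMem_det_of_column hG _ i j (fun i' hi' => ?_) ?_ (ih _ _)
        · simp [hx, one_apply, hf.eq_iff, hi']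
        · rw [submatrix_apply, hx, fromCols_apply_inr, one_apply_eq]; exact .one
      · rw [det_eq_zero_of_column_eq_zero j]
        · exact .zero
        · intro i
          simp [hx, one_apply, not_exists.1 hi i]
    · have hinl : ∀ j, ∃ y, g j = Sum.inl y := fun j => by
        rcases hgj : g j with y | x
        exacts [⟨y, rfl⟩, absurd ⟨j, x, hgj⟩ hg]
      choose g' hg' using hinl
      convert h (k + 1) f g' using 2
      ext i j
      simp [hg']

theorem det_submatrix_eq_det_extend [Fintype X] [DecidableEq X] {m : Type*} [Fintype m]
    [DecidableEq m] (N : Matrix X Y R) {f₀ : X → Y} (h0 : N.submatrix id f₀ = 1)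
    {f : m → X} (hf : Function.Injective f) (g : m → Y) :
    (N.submatrix f g).det = (N.submatrix id (Function.extend f g f₀)).det := by
  classical
  have hunit : ∀ i {j}, j ∉ Set.range f →
      N.submatrix id (Function.extend f g f₀) i j = (1 : Matrix X X R) i j := fun i j hj => by
    rw [← h0, submatrix_apply, submatrix_apply, Function.extend_apply' _ _ _ hj]
  rw [twoBlockTriangular_det' _ (· ∈ Set.range f) fun i hi j hj =>
    (hunit i hj).trans (one_apply_ne fun h => hj (h ▸ hi))]
  have hone :
      (N.submatrix id (Function.extend f g f₀)).toSquareBlockProp (· ∉ Set.range f) = 1 := by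
    ext i j
    exact (hunit i j.2).trans (by simp [one_apply, Subtype.ext_iff])
  rw [hone, det_one, mul_one]
  calc (N.submatrix f g).det = (((N.submatrix id (Function.extend f g f₀)).toSquareBlockProp
        (· ∈ Set.range f)).submatrix (Equiv.ofInjective f hf) (Equiv.ofInjective f hf)).det := by
        congr 1
        ext i j
        simp [toSquareBlockProp, hf.extend_apply]
    _ = _ := by
        rw [det_submatrix_equiv_self]
        congr!

end Minors

section Pivot

variable {R X Y : Type*} [CommRing R] {G : Subgroup Rˣ}

open Classical in
/-- The result of pivoting in `A` on the entry `x`, `y`: the row element `x` and the column element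
`y` are exchanged, while the index sets are kept. -/
noncomputable def pivot (A : Matrix X Y R) (x : X) (y : Y) : Matrix X Y R := fun i j =>
  if i = x then (if j = y then Ring.inverse (A x y) else Ring.inverse (A x y) * A x j)
  else if j = y then -(A i y * Ring.inverse (A x y))
  else A i j - A i y * Ring.inverse (A x y) * A x j

theorem pivot_self (A : Matrix X Y R) (x : X) (y : Y) :
    pivot A x y x y = Ring.inverse (A x y) := by simp [pivot]

theorem pivot_row (A : Matrix X Y R) (x : X) {y j : Y} (h : j ≠ y) :
    pivot A x y x j = Ring.inverse (A x y) * A x j := by simp [pivot, h]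

theorem pivot_col (A : Matrix X Y R) {x i : X} (y : Y) (h : i ≠ x) :
    pivot A x y i y = -(A i y * Ring.inverse (A x y)) := by simp [pivot, h]

theorem pivot_of_ne (A : Matrix X Y R) {x i : X} {y j : Y} (hi : i ≠ x) (hj : j ≠ y) :
    pivot A x y i j = A i j - A i y * Ring.inverse (A x y) * A x j := by simp [pivot, hi, hj]

theorem pivot_pivot (A : Matrix X Y R) (x : X) (y : Y) (h : IsUnit (A x y)) :
    pivot (pivot A x y) x y = A := by
  obtain ⟨a, ha⟩ := h
  have hself : pivot A x y x y = (a⁻¹ : Rˣ) := by rw [pivot_self, ← ha, Ring.inverse_unit]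
  ext i j
  by_cases hi : i = x <;> by_cases hj : j = y
  · subst hi hj
    rw [pivot_self, hself, Ring.inverse_unit, inv_inv, ha]
  · subst hi
    rw [pivot_row _ _ hj, hself, pivot_row _ _ hj, ← ha, Ring.inverse_unit, Ring.inverse_unit,
      inv_inv, Units.mul_inv_cancel_left]
  · subst hj
    rw [pivot_col _ _ hi, hself, pivot_col _ _ hi, ← ha, Ring.inverse_unit, Ring.inverse_unit,
      inv_inv, neg_mul, neg_neg, Units.inv_mul_cancel_right]
  · rw [pivot_of_ne _ hi hj, hself, pivot_of_ne _ hi hj, pivot_row _ _ hj, pivot_col _ _ hi, ← ha,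
      Ring.inverse_unit, Ring.inverse_unit, inv_inv]
    linear_combination (A i y * A x j * (a⁻¹ : Rˣ)) * a.inv_mul

theorem pivot_map {S : Type*} [CommRing S] (φ : R →+* S) (A : Matrix X Y R) (x : X) (y : Y)
    (h : IsUnit (A x y)) : (pivot A x y).map φ = pivot (A.map φ) x y := by
  obtain ⟨a, ha⟩ := h
  have hinv : φ (Ring.inverse (A x y)) = Ring.inverse (φ (A x y)) := by
    rw [← ha, Ring.inverse_unit]
    exact (Ring.inverse_unit (Units.map φ.toMonoidHom a)).symm
  ext i j
  by_cases hi : i = x <;> by_cases hj : j = y <;> simp [pivot, hi, hj, hinv]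

theorem pivot_submatrix_val (A : Matrix X Y R) (x : X) {T : Set Y} (y : T) :
    (pivot A x y).submatrix id (Subtype.val : T → Y) = pivot (A.submatrix id Subtype.val) x y := by
  ext i j
  by_cases hi : i = x <;> by_cases hj : j = y <;>
    simp [pivot, hi, hj, mt (Subtype.ext (a1 := j) (a2 := y))]

theorem updateCol_one_mul_apply [Fintype X] [DecidableEq X] (v : X → R) (x : X)
    (N : Matrix X Y R) (i : X) (j : Y) :
    (updateCol 1 x v * N) i j = if i = x then v x * N x j else N i j + v i * N x j := by
  have hcol : ∀ z, updateCol (1 : Matrix X X R) x v i z * N z j =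
      (if z = i then (if i = x then 0 else N i j) else 0) + if z = x then v i * N x j else 0 := by
    intro z
    rw [updateCol_apply, one_apply]
    grind
  rw [mul_apply, Finset.sum_congr rfl fun z _ => hcol z]
  simp only [Finset.sum_add_distrib, Finset.sum_ite_eq', Finset.mem_univ, if_true]
  split_ifs with hi
  · rw [hi, zero_add]
  · rfl

theorem fromCols_pivot_one [Fintype X] [DecidableEq X] [DecidableEq Y] (A : Matrix X Y R) (x : X)
    (y : Y) (h : IsUnit (A x y)) :
    fromCols (pivot A x y) 1 = (updateCol 1 x (fun i => pivot A x y i y) *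
      fromCols A (1 : Matrix X X R)).submatrix id (Equiv.swap (Sum.inl y) (Sum.inr x)) := by
  have hinv := Ring.inverse_mul_cancel _ h
  ext i (j | z)
  · by_cases hi : i = x <;> by_cases hj : j = y <;>
      simp [updateCol_one_mul_apply, Equiv.swap_apply_def, pivot, hi, hj, sub_eq_add_neg]
  · by_cases hi : i = x <;> by_cases hz : z = x <;>
      simp [updateCol_one_mul_apply, Equiv.swap_apply_def, pivot, hi, hz, one_apply, hinv,
        mul_assoc, eq_comm (a := x)]

theorem MinorsIn.pivot [Finite X] (hG : -1 ∈ G) {A : Matrix X Y R} (h : MinorsIn G A) (x : X)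
    (y : Y) (hxy : IsUnit (A x y)) : MinorsIn G (pivot A x y) := by
  classical
  have := Fintype.ofFinite X
  intro k f g
  by_cases hf : Function.Injective f
  swap
  · rw [det_submatrix_eq_zero_of_not_injective_left _ _ hf]
    exact .zero
  have hdet : ZeroOrMem G (updateCol 1 x fun i => PartialField.pivot A x y i y).det := by
    rw [← cramer_apply, cramer_one, Module.End.one_apply, pivot_self]
    rcases h.apply x y with h0 | ⟨a, ha, hA⟩
    · rw [h0, Ring.inverse_zero]; exact .zero
    · rw [← hA, Ring.inverse_unit]; exact .of_mem (G.inv_mem ha)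
  have hmax := det_submatrix_eq_det_extend (fromCols (PartialField.pivot A x y) 1)
    (f₀ := Sum.inr) (by ext i j; simp) hf (Sum.inl ∘ g)
  rw [show (PartialField.pivot A x y).submatrix f g = (fromCols (PartialField.pivot A x y)
    (1 : Matrix X X R)).submatrix f (Sum.inl ∘ g) from rfl, hmax, fromCols_pivot_one A x y hxy,
    submatrix_submatrix, ← submatrix_mul_equiv _ _ _ (Equiv.refl X), Function.id_comp, det_mul]
  exact hdet.mul ((h.fromCols_one hG).det _ _)

theorem MinorsOn.pivot [Finite X] (hG : -1 ∈ G) {A : Matrix X Y R} {T : Set Y}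
    (h : MinorsOn G A T) (x : X) {y : Y} (hy : y ∈ T) (hxy : IsUnit (A x y)) :
    MinorsOn G (pivot A x y) T := by
  rw [minorsOn_iff] at h ⊢
  rw [pivot_submatrix_val A x ⟨y, hy⟩]
  exact h.pivot hG x ⟨y, hy⟩ hxy

theorem det_eq_mul_det_pivot {n : ℕ} (N : Matrix (Fin (n + 1)) (Fin (n + 1)) R)
    (i j : Fin (n + 1)) (hij : IsUnit (N i j)) :
    N.det = (-1) ^ (i + j : ℕ) * N i j *
      ((pivot N i j).submatrix i.succAbove j.succAbove).det := by
  let N' : Matrix (Fin (n + 1)) (Fin (n + 1)) R := fun r c =>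
    if r = i then N i c else N r c - N r j * Ring.inverse (N i j) * N i c
  have hdet : N.det = N'.det := by
    refine det_eq_of_forall_row_eq_smul_add_const
      (fun r => if r = i then 0 else N r j * Ring.inverse (N i j)) i (by simp) fun r c => ?_
    by_cases hr : r = i <;> simp [N', hr]
  rw [hdet, det_succ_column N' j, Finset.sum_eq_single i]
  · have hpivot : N' i j = N i j := by simp [N']
    rw [hpivot]
    congr 2
    ext r c
    rw [submatrix_apply, submatrix_apply, pivot_of_ne _ (i.succAbove_ne r) (j.succAbove_ne c)]
    exact if_neg (i.succAbove_ne r)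
  · intro r _ hr
    have hzero : N' r j = 0 := by
      simp only [N', if_neg hr, mul_assoc, Ring.inverse_mul_cancel _ hij, mul_one, sub_self]
    rw [hzero, mul_zero, zero_mul]
  · simp

end Pivot

section NullSums

variable {P : Type*} [PartialField P]

theorem mul_mem_padd {p q r : P} (c : P) (hc : c ≠ 0) (h : r ∈ padd p q) :
    c * r ∈ padd (c * p) (c * q) := by
  rw [← mul_padd _ _ _ hc]
  exact Part.mem_map _ h

theorem pneg_eq_mul (p : P) : pneg p = p * pneg 1 := by
  by_cases hp : p = 0
  · rw [hp, zero_mul, pneg_eq_zero_iff]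
  · refine (eq_pneg_of_zero_mem p _ ?_).symm
    simpa using mul_mem_padd p hp (zero_mem_padd_pneg (1 : P))

theorem pneg_pneg (p : P) : pneg (pneg p) = p := by
  refine (eq_pneg_of_zero_mem (pneg p) p ?_).symm
  rw [padd_comm]
  exact zero_mem_padd_pneg p

theorem mul_pneg (p q : P) : p * pneg q = pneg (p * q) := by
  rw [pneg_eq_mul q, pneg_eq_mul (p * q), mul_assoc]

theorem mem_padd_zero (p : P) : p ∈ padd p 0 := by
  rw [padd_zero]; exact Part.mem_some _

theorem SumIs.singleton (p : P) : SumIs {p} p := ⟨0, by simpa using Association.leaf p⟩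

theorem SumIs.add {s t : Multiset P} {a b c : P} (hs : SumIs s a) (ht : SumIs t b)
    (h : c ∈ padd a b) : SumIs (s + t) c := by
  obtain ⟨z, hz⟩ := hs
  obtain ⟨w, hw⟩ := ht
  refine ⟨z + w, ?_⟩
  rw [Multiset.map_add]
  convert Association.node hz hw h using 1
  abel

theorem SumIs.cancel {s z : Multiset P} {r : P} (h : SumIs (s + (z + z.map pneg)) r) :
    SumIs s r := by
  obtain ⟨w, hw⟩ := h
  refine ⟨z + w, ?_⟩
  rw [Multiset.map_add]
  convert hw using 1
  abel

theorem SumIs.pair (p : P) : SumIs ({p} + {pneg p}) 0 :=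
  (SumIs.singleton p).add (.singleton _) (zero_mem_padd_pneg p)

theorem SumIs.empty : SumIs (0 : Multiset P) 0 :=
  SumIs.cancel (z := {1}) (by simpa using SumIs.pair (1 : P))

theorem SumIs.zeros (s : Multiset P) : SumIs (s.map fun _ => (0 : P)) 0 := by
  induction s using Multiset.induction_on with
  | empty => exact SumIs.empty
  | cons p s ih =>
    rw [Multiset.map_cons, ← Multiset.singleton_add]
    exact (SumIs.singleton 0).add ih (mem_padd_zero 0)

theorem SumIs.mul {s : Multiset P} {r : P} (c : P) (hc : c ≠ 0) (h : SumIs s r) :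
    SumIs (s.map (c * ·)) (c * r) := by
  obtain ⟨z, hz⟩ := h
  refine ⟨z.map (c * ·), ?_⟩
  have := Association.map (add' := padd (P := P)) (c * ·)
    (fun p q r h => mul_mem_padd c hc h) hz
  simpa [Multiset.map_add, Multiset.map_map, Function.comp_def, mul_pneg] using this

theorem SumIs.zero_mul {s : Multiset P} (c : P) (h : SumIs s 0) : SumIs (s.map (c * ·)) 0 := by
  by_cases hc : c = 0
  · simpa [hc] using SumIs.zeros s
  · simpa using h.mul c hc

theorem SumIs.zero_pneg {s : Multiset P} (h : SumIs s 0) : SumIs (s.map pneg) 0 := by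
  convert h.zero_mul (pneg 1) using 3 with p
  rw [pneg_eq_mul p, mul_comm]

theorem SumIs.of_add_pneg {s : Multiset P} {r : P} (h : SumIs (s + {pneg r}) 0) : SumIs s r := by
  refine SumIs.cancel (z := {r}) ?_
  convert (SumIs.singleton r).add h (mem_padd_zero r) using 1
  rw [Multiset.map_singleton]
  abel

end NullSums

section UniversalRing

variable {P : Type*} [PartialField P]

/-- The sum of a multiset over a partial field, taken formally in the free abelian group, where it
is always defined. -/
def formalSum (s : Multiset P) : FreeAbelianGroup P := (s.map FreeAbelianGroup.of).sum

theorem formalSum_add (s t : Multiset P) : formalSum (s + t) = formalSum s + formalSum t := by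
  simp [formalSum]

theorem formalSum_singleton (p : P) : formalSum {p} = FreeAbelianGroup.of p := by
  simp [formalSum]

theorem formalSum_map_mul (c : P) (s : Multiset P) :
    formalSum (s.map (c * ·)) = FreeAbelianGroup.of c * formalSum s := by
  simp [formalSum, ← Multiset.sum_map_mul_left, Multiset.map_map, FreeAbelianGroup.of_mul_of]

theorem coeff_formalSum [DecidableEq P] (p : P) (s : Multiset P) :
    FreeAbelianGroup.coeff p (formalSum s) = s.count p := by
  induction s using Multiset.induction_on with
  | empty => simp [formalSum]
  | cons q s ih =>
    rw [← Multiset.singleton_add, formalSum_add, map_add, ih, formalSum_singleton,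
      Multiset.count_add, Multiset.count_singleton]
    simp [FreeAbelianGroup.coeff, Finsupp.single_apply, eq_comm]

theorem formalSum_injective : Function.Injective (formalSum (P := P)) := by
  classical
  intro s t h
  refine Multiset.ext' fun p => ?_
  rw [← Nat.cast_inj (R := ℤ), ← coeff_formalSum, ← coeff_formalSum, h]

/-- The group of formal differences whose sum is defined and equal to zero. -/
def nullSubgroup (P : Type*) [PartialField P] : AddSubgroup (FreeAbelianGroup P) where
  carrier := {x | ∃ s t : Multiset P, x = formalSum s - formalSum t ∧ SumIs (s + t.map pneg) 0}
  zero_mem' := ⟨0, 0, by simp, by simpa using SumIs.empty⟩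
  add_mem' := by
    rintro _ _ ⟨s, t, rfl, h⟩ ⟨s', t', rfl, h'⟩
    refine ⟨s + s', t + t', by rw [formalSum_add, formalSum_add]; abel, ?_⟩
    convert h.add h' (mem_padd_zero 0) using 1
    rw [Multiset.map_add]
    abel
  neg_mem' := by
    rintro _ ⟨s, t, rfl, h⟩
    refine ⟨t, s, by abel, ?_⟩
    convert h.zero_pneg using 1
    rw [Multiset.map_add, Multiset.map_map, add_comm]
    simp [pneg_pneg]

theorem of_mul_mem_nullSubgroup (p : P) {x : FreeAbelianGroup P} (hx : x ∈ nullSubgroup P) :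
    FreeAbelianGroup.of p * x ∈ nullSubgroup P := by
  obtain ⟨s, t, rfl, h⟩ := hx
  refine ⟨s.map (p * ·), t.map (p * ·), ?_, ?_⟩
  · rw [formalSum_map_mul, formalSum_map_mul, mul_sub]
  · simpa [Multiset.map_add, Multiset.map_map, Function.comp_def, mul_pneg] using h.zero_mul p

/-- The null sums form an ideal of the monoid ring of `P`. -/
def nullIdeal (P : Type*) [PartialField P] : Ideal (FreeAbelianGroup P) where
  __ := nullSubgroup P
  smul_mem' := by
    intro c x (hx : x ∈ nullSubgroup P)
    change c * x ∈ nullSubgroup P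
    induction c using FreeAbelianGroup.induction_on with
    | zero => rw [zero_mul]; exact zero_mem _
    | of p => exact of_mul_mem_nullSubgroup p hx
    | neg p ih => rw [neg_mul]; exact neg_mem ih
    | add a b ha hb => rw [add_mul]; exact add_mem ha hb

theorem formalSum_mem_nullIdeal_iff {s : Multiset P} : formalSum s ∈ nullIdeal P ↔ SumIs s 0 := by
  constructor
  · rintro ⟨s', t, e, h⟩
    have hst : s + t = s' := formalSum_injective (by rw [formalSum_add, e]; abel)
    rw [← hst, add_assoc] at h
    exact h.cancel
  · exact fun h => ⟨s, 0, by simp [formalSum], by simpa using h⟩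

/-- The universal ring of `P`, generated by the elements of `P` subject to the defined sums of `P`.
A sum over `P` is defined if and only if its value in this ring comes from `P`. -/
abbrev UniversalRing (P : Type*) [PartialField P] : Type _ := FreeAbelianGroup P ⧸ nullIdeal P

/-- The canonical map from `P` to its universal ring. -/
def toUniversal (P : Type*) [PartialField P] : P →* UniversalRing P :=
  (Ideal.Quotient.mk (nullIdeal P)).toMonoidHom.comp FreeAbelianGroup.ofMulHom

theorem sum_toUniversal_eq_zero_iff {s : Multiset P} :
    (s.map (toUniversal P)).sum = 0 ↔ SumIs s 0 := by
  rw [← formalSum_mem_nullIdeal_iff, ← Ideal.Quotient.eq_zero_iff_mem, formalSum,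
    map_multiset_sum, Multiset.map_map]
  rfl

theorem toUniversal_zero : toUniversal P 0 = 0 := by
  simpa using sum_toUniversal_eq_zero_iff.2 (SumIs.singleton (0 : P))

theorem toUniversal_pneg (p : P) : toUniversal P (pneg p) = -toUniversal P p := by
  rw [eq_neg_iff_add_eq_zero, add_comm]
  simpa using sum_toUniversal_eq_zero_iff.2 (SumIs.pair p)

theorem sum_toUniversal_eq_iff {s : Multiset P} {r : P} :
    (s.map (toUniversal P)).sum = toUniversal P r ↔ SumIs s r := by
  have hsub : (s.map (toUniversal P)).sum = toUniversal P r ↔ SumIs (s + {pneg r}) 0 := by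
    rw [← sum_toUniversal_eq_zero_iff, Multiset.map_add, Multiset.sum_add, Multiset.map_singleton,
      Multiset.sum_singleton, toUniversal_pneg, ← sub_eq_add_neg, sub_eq_zero]
  exact hsub.trans ⟨SumIs.of_add_pneg, fun h => h.add (.singleton _) (zero_mem_padd_pneg r)⟩

theorem toUniversal_of_mem_padd {p q r : P} (h : r ∈ padd p q) :
    toUniversal P r = toUniversal P p + toUniversal P q := by
  simpa using (sum_toUniversal_eq_iff.2 ((SumIs.singleton p).add (.singleton q) h)).symm

theorem toUniversal_signOf (e : ℤˣ) : toUniversal P (signOf P e) = ((e : ℤ) : UniversalRing P) := by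
  rcases Int.units_eq_one_or e with rfl | rfl
  · simp [signOf]
  · simp [signOf, toUniversal_pneg]

theorem det_toUniversal_eq_iff {k : ℕ} {A : Matrix (Fin k) (Fin k) P} {d : P} :
    (A.map (toUniversal P)).det = toUniversal P d ↔ DetIs A d := by
  rw [DetIs, ← sum_toUniversal_eq_iff, Multiset.map_map, ← det_transpose, det_apply',
    Finset.sum_eq_multiset_sum]
  simp [toUniversal_signOf]

end UniversalRing

section RingEmbedding

variable {P R : Type*} [PartialField P] [CommRing R] {G : Subgroup Rˣ} {e : P →*₀ R}

/-- `e` identifies the partial field `P` with the subset `G ∪ {0}` of the ring `R`, with addition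
restricted from `R`. -/
structure IsRingEmbedding (G : Subgroup Rˣ) (e : P →*₀ R) : Prop where
  mem_padd : ∀ p q r : P, r ∈ padd p q ↔ e r = e p + e q
  zeroOrMem_iff : ∀ x : R, ZeroOrMem G x ↔ ∃ p, e p = x

theorem isUnit_map_of_ne_zero {R₀ F : Type*} [MonoidWithZero R₀] [FunLike F P R₀]
    [MonoidHomClass F P R₀] (f : F) {p : P} (hp : p ≠ 0) : IsUnit (f p) :=
  (isUnit_iff_ne_zero.2 hp).map f

theorem inverse_map_of_ne_zero {R₀ F : Type*} [MonoidWithZero R₀] [FunLike F P R₀]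
    [MonoidHomClass F P R₀] (f : F) {p : P} (hp : p ≠ 0) : Ring.inverse (f p) = f p⁻¹ :=
  Ring.inverse_unit (Units.map (f : P →* R₀) (Units.mk0 p hp))

namespace IsRingEmbedding

theorem injective (he : IsRingEmbedding G e) : Function.Injective e := by
  intro p q h
  have hp : p ∈ padd q 0 := (he.mem_padd _ _ _).2 (by simpa using h)
  rw [padd_zero] at hp
  exact Part.mem_some_iff.1 hp

theorem eq_zero_iff (he : IsRingEmbedding G e) {p : P} : e p = 0 ↔ p = 0 := by
  rw [← map_zero e, he.injective.eq_iff]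

theorem map_pneg (he : IsRingEmbedding G e) (p : P) : e (pneg p) = -e p := by
  have := (he.mem_padd _ _ _).1 (zero_mem_padd_pneg p)
  rw [map_zero] at this
  linear_combination -this

theorem nontrivial (he : IsRingEmbedding G e) : Nontrivial R :=
  ⟨e 0, e 1, fun h => zero_ne_one (he.injective h)⟩

theorem neg_one_mem (he : IsRingEmbedding G e) : -1 ∈ G := by
  have := he.nontrivial
  have hneg : ZeroOrMem G (-1 : R) := (he.zeroOrMem_iff _).2 ⟨pneg 1, by simp [he.map_pneg]⟩
  obtain ⟨g, hg, h⟩ := hneg.exists_of_ne (neg_ne_zero.2 one_ne_zero)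
  rwa [show g = -1 from Units.ext (by simpa using h)] at hg

theorem map_sumIs (he : IsRingEmbedding G e) {s : Multiset P} {r : P} (h : SumIs s r) :
    (s.map e).sum = e r := by
  obtain ⟨z, hz⟩ := h
  rw [← association_hom e (fun p q r => (he.mem_padd p q r).1) hz]
  simp [Multiset.map_map, he.map_pneg]

theorem map_signOf (he : IsRingEmbedding G e) (u : ℤˣ) : e (signOf P u) = ((u : ℤ) : R) := by
  rcases Int.units_eq_one_or u with rfl | rfl
  · simp [signOf]
  · simp [signOf, he.map_pneg]

theorem map_detIs (he : IsRingEmbedding G e) {k : ℕ} {A : Matrix (Fin k) (Fin k) P} {d : P}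
    (h : DetIs A d) : (A.map e).det = e d := by
  rw [← he.map_sumIs h, ← det_transpose, det_apply', Multiset.map_map, Finset.sum_eq_multiset_sum]
  simp [he.map_signOf]

theorem exists_toUniversal_eq_sub (he : IsRingEmbedding G e) {p q : P}
    (h : ZeroOrMem G (e p - e q)) :
    ∃ d, e d = e p - e q ∧ toUniversal P d = toUniversal P p - toUniversal P q := by
  obtain ⟨d, hd⟩ := (he.zeroOrMem_iff _).1 h
  have hmem : d ∈ padd p (pneg q) := by rw [he.mem_padd, hd, he.map_pneg, sub_eq_add_neg]
  exact ⟨d, hd, by rw [toUniversal_of_mem_padd hmem, toUniversal_pneg, sub_eq_add_neg]⟩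

theorem exists_pivot_map (he : IsRingEmbedding G e) {X Y : Type*} [Finite X] {A : Matrix X Y P}
    (hA : MinorsIn G (A.map e)) {x : X} {y : Y} (hxy : A x y ≠ 0) {i : X} {j : Y} (hi : i ≠ x)
    (hj : j ≠ y) : ∃ p, e p = pivot (A.map e) x y i j ∧
      toUniversal P p = pivot (A.map (toUniversal P)) x y i j := by
  have hpivot : ZeroOrMem G (e (A i j) - e (A i y * (A x y)⁻¹ * A x j)) := by
    have := (hA.pivot he.neg_one_mem x y (isUnit_map_of_ne_zero e hxy)).apply i j
    rw [pivot_of_ne _ hi hj] at this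
    rwa [map_mul, map_mul, ← inverse_map_of_ne_zero e hxy]
  obtain ⟨p, hp, hp'⟩ := he.exists_toUniversal_eq_sub hpivot
  refine ⟨p, ?_, ?_⟩
  · rw [hp, pivot_of_ne _ hi hj, map_mul, map_mul, ← inverse_map_of_ne_zero e hxy]
    rfl
  · rw [hp', pivot_of_ne _ hi hj, map_mul, map_mul, ← inverse_map_of_ne_zero (toUniversal P) hxy]
    rfl

theorem exists_detIs (he : IsRingEmbedding G e) {k : ℕ} (A : Matrix (Fin k) (Fin k) P)
    (hA : MinorsIn G (A.map e)) : ∃ d, DetIs A d := by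
  induction k with
  | zero => exact ⟨1, det_toUniversal_eq_iff.1 (by simp)⟩
  | succ k ih =>
    by_cases h0 : ∀ i, A i 0 = 0
    · refine ⟨0, det_toUniversal_eq_iff.1 ?_⟩
      rw [toUniversal_zero]
      exact det_eq_zero_of_column_eq_zero 0 fun i => by simp [h0, toUniversal_zero]
    · obtain ⟨i, hi⟩ := not_forall.1 h0
      choose B hBe hB using fun r c : Fin k =>
        he.exists_pivot_map hA hi (i.succAbove_ne r) (Fin.succAbove_ne 0 c)
      have hminors := (hA.pivot he.neg_one_mem i 0 (isUnit_map_of_ne_zero e hi)).submatrix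
        i.succAbove (Fin.succAbove 0)
      obtain ⟨d, hd⟩ := ih (Matrix.of B)
        (by convert hminors using 1; ext r c; exact hBe r c)
      have hB : (Matrix.of B).map (toUniversal P) =
          (pivot (A.map (toUniversal P)) i 0).submatrix i.succAbove (Fin.succAbove 0) := by
        ext r c
        exact hB r c
      refine ⟨signOf P ((-1) ^ (i : ℕ)) * A i 0 * d, det_toUniversal_eq_iff.1 ?_⟩
      rw [det_eq_mul_det_pivot _ i 0 (isUnit_map_of_ne_zero (toUniversal P) hi), ← hB,
        det_toUniversal_eq_iff.2 hd, map_mul, map_mul, toUniversal_signOf]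
      simp

theorem isPMatrix_iff (he : IsRingEmbedding G e) {X Y : Type*} {A : Matrix X Y P} :
    IsPMatrix A ↔ MinorsIn G (A.map e) := by
  constructor
  · intro hA k f g
    by_cases hf : Function.Injective f
    · by_cases hg : Function.Injective g
      · obtain ⟨d, hd⟩ := hA k ⟨f, hf⟩ ⟨g, hg⟩
        exact (he.zeroOrMem_iff _).2 ⟨d, (he.map_detIs hd).symm⟩
      · rw [det_submatrix_eq_zero_of_not_injective_right _ _ hg]; exact .zero
    · rw [det_submatrix_eq_zero_of_not_injective_left _ _ hf]; exact .zero
  · exact fun hA k f g => he.exists_detIs _ (hA.submatrix f g)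

theorem exists_detIs_ne_zero_iff (he : IsRingEmbedding G e) {k : ℕ}
    {A : Matrix (Fin k) (Fin k) P} (hA : ∃ d, DetIs A d) :
    (∃ d, d ≠ 0 ∧ DetIs A d) ↔ (A.map e).det ≠ 0 := by
  constructor
  · rintro ⟨d, hd, h⟩
    rwa [he.map_detIs h, Ne, he.eq_zero_iff]
  · obtain ⟨d, hd⟩ := hA
    exact fun h => ⟨d, fun h0 => h (by rw [he.map_detIs hd, h0, map_zero]), hd⟩

end IsRingEmbedding

/-- The bases of the matroid `M` are the sets of columns of the nonzero maximal minors of `A`. -/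
def Represents {α : Type*} (M : Matroid α) {r : ℕ} (A : Matrix (Fin r) M.E R) : Prop :=
  ∀ B : Set α, M.IsBase B ↔
    ∃ f : Fin r ↪ M.E, Set.range (fun i => (f i : α)) = B ∧ (A.submatrix id f).det ≠ 0

theorem represents_map_iff {S : Type*} [CommRing S] (φ : R →+* S) {α : Type*} {M : Matroid α}
    {r : ℕ} {A : Matrix (Fin r) M.E R}
    (hφ : ∀ f : Fin r ↪ M.E, φ (A.submatrix id f).det = 0 ↔ (A.submatrix id f).det = 0) :
    Represents M (A.map φ) ↔ Represents M A :=
  forall_congr' fun _ => iff_congr Iff.rfl <| exists_congr fun f => and_congr_right fun _ => by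
    rw [submatrix_map, ← RingHom.mapMatrix_apply, ← RingHom.map_det, ne_eq, hφ]

/-- The matroid `M` is represented by a matrix over `R` all of whose minors are zero or in `G`. -/
def RingRepresentable (G : Subgroup Rˣ) {α : Type*} (M : Matroid α) : Prop :=
  ∃ (r : ℕ) (A : Matrix (Fin r) M.E R), MinorsIn G A ∧ Represents M A

theorem IsRingEmbedding.representable_iff (he : IsRingEmbedding G e) {α : Type*} (M : Matroid α) :
    Representable P M ↔ RingRepresentable G M := by
  have hdet : ∀ {r : ℕ} {A : Matrix (Fin r) M.E P}, IsPMatrix A → ∀ f : Fin r ↪ M.E,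
      ((∃ d : P, d ≠ 0 ∧ DetIs (A.submatrix id f) d) ↔ ((A.map e).submatrix id f).det ≠ 0) :=
    fun hA f => he.exists_detIs_ne_zero_iff (hA _ (Function.Embedding.refl _) f)
  constructor
  · rintro ⟨r, A, hA, hM⟩
    refine ⟨r, A.map e, he.isPMatrix_iff.1 hA, fun B => ?_⟩
    simp only [hM, hdet hA]
  · rintro ⟨r, A, hA, hM⟩
    choose A' hA' using fun i j => (he.zeroOrMem_iff _).1 (hA.apply i j)
    obtain rfl : (Matrix.of A').map e = A := by ext i j; exact hA' i j
    have hP := he.isPMatrix_iff.2 hA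
    refine ⟨r, Matrix.of A', hP, fun B => ?_⟩
    simpa only [hdet hP] using hM B

end RingEmbedding

section Fundamental

variable {O R : Type*} [CommRing O] [CommRing R] {G : Subgroup Oˣ} {φ : O →+* R}

/-- The unit `f` is a fundamental element of the partial field `G ∪ {0}`. -/
def IsFundamental (G : Subgroup Oˣ) (f : Oˣ) : Prop := f ∈ G ∧ ZeroOrMem G (1 - (f : O))

theorem IsFundamental.one : IsFundamental G (1 : Oˣ) := ⟨G.one_mem, Or.inl (by simp)⟩

theorem IsFundamental.inv (hG : -1 ∈ G) {f : Oˣ} (hf : IsFundamental G f) :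
    IsFundamental G f⁻¹ := by
  refine ⟨G.inv_mem hf.1, ?_⟩
  rw [← ZeroOrMem.mul_iff hf.1, ← ZeroOrMem.neg_iff hG]
  convert hf.2 using 1
  rw [mul_sub, Units.mul_inv]
  ring

theorem isFundamental_cross_iff {a b c d : Oˣ} (ha : a ∈ G) (hb : b ∈ G) (hc : c ∈ G)
    (hd : d ∈ G) : IsFundamental G (b * c * a⁻¹ * d⁻¹) ↔ ZeroOrMem G (a * d - b * c : O) := by
  have hmem : b * c * a⁻¹ * d⁻¹ ∈ G :=
    G.mul_mem (G.mul_mem (G.mul_mem hb hc) (G.inv_mem ha)) (G.inv_mem hd)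
  rw [IsFundamental, and_iff_right hmem, ← ZeroOrMem.mul_iff (G.mul_mem ha hd)]
  have : ((a * d : Oˣ) : O) * (1 - ((b * c * a⁻¹ * d⁻¹ : Oˣ) : O)) = a * d - b * c := by
    push_cast
    linear_combination (-(b * c * d * (d⁻¹ : Oˣ)) : O) * a.mul_inv - (b * c : O) * d.mul_inv
  rw [this]

theorem isFundamental_mul_inv_iff (hG : -1 ∈ G) {a d : Oˣ} (ha : a ∈ G) (hd : d ∈ G) :
    IsFundamental G (a * d⁻¹) ↔ ZeroOrMem G (a - d : O) := by
  rw [ZeroOrMem.sub_comm_iff hG]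
  simpa using isFundamental_cross_iff hd ha G.one_mem G.one_mem

/-- The homomorphism of unit groups induced by a ring homomorphism. -/
abbrev imageUnit (φ : O →+* R) : Oˣ →* Rˣ := Units.map φ.toMonoidHom

theorem IsFundamental.image (φ : O →+* R) {f : Oˣ} (hf : IsFundamental G f) :
    IsFundamental ⊤ (imageUnit φ f) := by
  refine ⟨trivial, ?_⟩
  have himage : ((1 : R) - (imageUnit φ f : Rˣ)) = φ (1 - f) := by simp
  rw [himage]
  rcases hf.2 with h | ⟨g, -, h⟩
  · rw [h, map_zero]; exact .zero
  · exact Or.inr ⟨imageUnit φ g, trivial, congrArg φ h⟩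

theorem IsFundamental.eq_one_of_imageUnit_eq_one [Nontrivial R] {f : Oˣ}
    (hf : IsFundamental G f) (h : imageUnit φ f = 1) : f = 1 := by
  by_contra h1
  obtain ⟨g, -, hg⟩ := hf.2.exists_of_ne (sub_ne_zero.2 fun e => h1 (Units.ext e.symm))
  refine (imageUnit φ g).ne_zero ?_
  have hf1 : φ f = 1 := congrArg Units.val h
  change φ g = 0
  rw [hg, map_sub, map_one, hf1, sub_self]

theorem eq_one_or_neg_one_of_isUnit (ψ : R →+* ZMod 3) {x : R} (hx : IsUnit x) :
    ψ x = 1 ∨ ψ x = -1 :=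
  (by decide : ∀ s : ZMod 3, s ≠ 0 → s = 1 ∨ s = -1) _ (hx.map ψ).ne_zero

theorem eq_zero_of_map_eq_zero (ψ : R →+* ZMod 3) {x : R} (hx : ZeroOrMem (⊤ : Subgroup Rˣ) x)
    (h : ψ x = 0) : x = 0 := by
  by_contra h0
  exact ((hx.isUnit h0).map ψ).ne_zero h

theorem IsFundamental.eq_one_of_map_eq_one (ψ : R →+* ZMod 3) {f : Rˣ} (hf : IsFundamental ⊤ f)
    (h : ψ f = 1) : f = 1 := by
  have := eq_zero_of_map_eq_zero ψ hf.2 (by rw [map_sub, map_one, h, sub_self])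
  exact Units.ext (sub_eq_zero.1 this).symm

theorem imageUnit_eq_of_isFundamental_mul_inv (ψ : R →+* ZMod 3) {a d : Oˣ}
    (had : IsFundamental ⊤ (imageUnit φ (a * d⁻¹))) (h : ψ (φ a) = ψ (φ d)) :
    imageUnit φ a = imageUnit φ d := by
  rw [← mul_inv_eq_one, ← map_inv, ← map_mul]
  refine had.eq_one_of_map_eq_one ψ ?_
  have hd : ψ (φ d) * ψ (φ (d⁻¹ : Oˣ)) = 1 := by
    rw [← map_mul, ← map_mul, Units.mul_inv, map_one, map_one]
  simpa [h] using hd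

/-- The hypotheses of the lift theorem: `φ` maps the partial field `G ∪ {0}` onto the partial field
of zero and all units of `R`, its fundamental elements bijectively; moreover `R` maps to `GF(3)` and
`-1` is not a fundamental element of `R`. -/
structure IsLifting (G : Subgroup Oˣ) (φ : O →+* R) : Prop where
  neg_one_mem : -1 ∈ G
  surj : ∀ r : Rˣ, ∃ g ∈ G, imageUnit φ g = r
  lift : ∀ r : Rˣ, IsFundamental ⊤ r → ∃ f, IsFundamental G f ∧ imageUnit φ f = r
  fundamental_inj : ∀ ⦃f⦄, IsFundamental G f → ∀ ⦃f'⦄, IsFundamental G f' →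
    imageUnit φ f = imageUnit φ f' → f = f'
  ternary : Nonempty (R →+* ZMod 3)
  not_isUnit_two : ¬ IsUnit (2 : R)

namespace IsLifting

theorem map_eq_zero_iff (L : IsLifting G φ) {x : O} (hx : ZeroOrMem G x) : φ x = 0 ↔ x = 0 := by
  obtain ⟨ψ⟩ := L.ternary
  have := ψ.domain_nontrivial
  exact ⟨fun h => by_contra fun h0 => ((hx.isUnit h0).map φ).ne_zero h,
    fun h => by rw [h, map_zero]⟩

theorem not_isFundamental_neg_one (L : IsLifting G φ) : ¬ IsFundamental ⊤ (-1 : Rˣ) := by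
  obtain ⟨ψ⟩ := L.ternary
  intro h
  have h2 := h.2
  rw [Units.val_neg, Units.val_one, sub_neg_eq_add, one_add_one_eq_two, zeroOrMem_top_iff] at h2
  rcases h2 with h2 | h2
  · have : ψ 2 = 2 := map_ofNat ψ 2
    rw [h2, map_zero] at this
    exact absurd this (by decide)
  · exact L.not_isUnit_two h2

theorem eq_one_of_map_eq_one (L : IsLifting G φ) (ψ : R →+* ZMod 3) {f : Oˣ}
    (hf : IsFundamental G f) (h : ψ (φ f) = 1) : f = 1 :=
  L.fundamental_inj hf .one (((hf.image φ).eq_one_of_map_eq_one ψ h).trans (map_one _).symm)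

theorem isFundamental_mul (L : IsLifting G φ) {f g : Oˣ} (hf : IsFundamental G f)
    (hg : IsFundamental G g) (hfg : IsFundamental ⊤ (imageUnit φ (f * g))) :
    IsFundamental G (f * g) := by
  obtain ⟨ψ⟩ := L.ternary
  rcases eq_one_or_neg_one_of_isUnit ψ (imageUnit φ f).isUnit with hf1 | hf1
  · rw [L.eq_one_of_map_eq_one ψ hf hf1, one_mul]; exact hg
  rcases eq_one_or_neg_one_of_isUnit ψ (imageUnit φ g).isUnit with hg1 | hg1
  · rw [L.eq_one_of_map_eq_one ψ hg hg1, mul_one]; exact hf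
  have hfg1 : imageUnit φ (f * g) = 1 := by
    refine hfg.eq_one_of_map_eq_one ψ ?_
    rw [map_mul, Units.val_mul, map_mul, hf1, hg1, neg_one_mul, neg_neg]
  have hinv : g = f⁻¹ := by
    refine L.fundamental_inj hg (hf.inv L.neg_one_mem) ?_
    rw [map_mul] at hfg1
    rw [map_inv, inv_eq_of_mul_eq_one_right hfg1]
  rw [hinv, mul_inv_cancel]
  exact .one

theorem eq_one_sub (L : IsLifting G φ) (ψ : R →+* ZMod 3) {f g : Oˣ} (hf : IsFundamental G f)
    (h : ψ (φ f) = -1) (hg : IsFundamental G g) (hgf : φ g = φ (1 - f)) : (g : O) = 1 - f := by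
  have hne : (1 : O) - f ≠ 0 := by
    intro h0
    have : ψ (φ (1 - f)) = 0 := by rw [h0, map_zero, map_zero]
    rw [map_sub, map_sub, map_one, map_one, h] at this
    exact absurd this (by decide)
  obtain ⟨g', hg'G, hg'⟩ := hf.2.exists_of_ne hne
  have hg'f : IsFundamental G g' := ⟨hg'G, by rw [hg', sub_sub_cancel]; exact .of_mem hf.1⟩
  rw [L.fundamental_inj hg hg'f (Units.ext (hgf.trans (congrArg φ hg'.symm))), hg']

section PathThree

variable {a d t : Oˣ} {ψ : R →+* ZMod 3}

theorem sub_eq_one_of_map_eq (L : IsLifting G φ) (ha : IsFundamental G a)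
    (hd : IsFundamental G (-d)) (hψa : ψ (φ a) = -1) (hψd : ψ (φ d) = 1)
    (h : ZeroOrMem ⊤ (φ (1 - a + d))) : (a - d : O) = 1 := by
  have h0 := eq_zero_of_map_eq_zero ψ h (by
    simp only [map_add, map_sub, map_one, hψa, hψd]; decide)
  have hda := L.eq_one_sub ψ ha hψa hd (by
    simp only [Units.val_neg, map_neg, map_add, map_sub] at h0 ⊢
    linear_combination -h0)
  push_cast at hda
  linear_combination hda

theorem mul_sub_one_eq_one_of_map_eq (L : IsLifting G φ) (ht : IsFundamental G (-t))
    (htd : IsFundamental G (t * d)) (hψt : ψ (φ t) = 1) (hψd : ψ (φ d) = -1)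
    (h : ZeroOrMem ⊤ (φ (-t - 1 + t * d))) : (t : O) * (d - 1) = 1 := by
  have h0 := eq_zero_of_map_eq_zero ψ h (by
    simp only [map_add, map_sub, map_mul, map_neg, map_one, hψt, hψd]; decide)
  have htd1 := L.eq_one_sub ψ ht (by simp [hψt]) htd (by
    simp only [Units.val_neg, Units.val_mul, map_neg, map_add, map_sub, map_mul] at h0 ⊢
    linear_combination h0)
  push_cast at htd1
  linear_combination htd1

theorem eq_of_isFundamental_mul (L : IsLifting G φ) (ha : IsFundamental G a)
    (htd : IsFundamental G (t * d)) (ht : IsFundamental G (-t))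
    (had : φ a = φ d) (hψt : ψ (φ t) = 1) (hψa : ψ (φ a) = -1)
    (h : ZeroOrMem ⊤ (φ (a - 1 + t * d))) : a = d := by
  have h0 := eq_zero_of_map_eq_zero ψ h (by
    simp only [map_add, map_sub, map_mul, map_one, ← had, hψt, hψa]; decide)
  have htd1 := L.eq_one_sub ψ ha hψa htd (by
    simp only [Units.val_mul, map_mul, map_add, map_sub] at h0 ⊢
    linear_combination h0)
  have hainv : φ a * φ (a⁻¹ : Oˣ) = 1 := by rw [← map_mul, Units.mul_inv, map_one]
  have hψainv : ψ (φ (a⁻¹ : Oˣ)) = -1 := by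
    have := congrArg ψ hainv
    rw [map_mul, hψa, map_one] at this
    linear_combination -this
  have ht1 := L.eq_one_sub ψ (ha.inv L.neg_one_mem) hψainv ht (by
    simp only [Units.val_neg, map_neg, map_add, map_sub, map_mul, map_one, ← had] at h0 ⊢
    linear_combination (-φ (a⁻¹ : Oˣ)) * h0 + (φ t + 1) * hainv)
  push_cast at htd1 ht1
  have hmul : (t : O) * (a - d) = 0 := by
    linear_combination (-a : O) * ht1 - htd1 + a.mul_inv
  exact Units.ext (sub_eq_zero.1 ((Units.mul_right_eq_zero t).1 hmul))

theorem eq_neg_one_of_map_eq_neg_one (L : IsLifting G φ) (ht : IsFundamental G (-t))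
    (hψt : ψ (φ t) = -1) : t = -1 :=
  neg_eq_iff_eq_neg.1 (L.eq_one_of_map_eq_one ψ ht (by simp [hψt]))

theorem mul_eq_one_of_map_mul_eq_one (L : IsLifting G φ) (htd : IsFundamental G (t * d))
    (h : ψ (φ t) * ψ (φ d) = 1) : t * d = 1 :=
  L.eq_one_of_map_eq_one ψ htd (by simpa using h)

theorem signs_of_path_three (L : IsLifting G φ) (ψ : R →+* ZMod 3) (ha : IsFundamental G a)
    (htd : IsFundamental G (t * d)) (ht : IsFundamental G (-t))
    (had : IsFundamental ⊤ (imageUnit φ (a * d⁻¹))) :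
    ψ (φ a) = -1 ∧ ψ (φ d) = 1 ∨ ψ (φ t) = 1 ∧ ψ (φ d) = -1 := by
  have contra : ∀ f : Oˣ, IsFundamental ⊤ (imageUnit φ f) → imageUnit φ f ≠ -1 :=
    fun f hf h => L.not_isFundamental_neg_one (h ▸ hf)
  have neg_image : ∀ f : Oˣ, imageUnit φ (-f) = -imageUnit φ f := fun f => by ext; simp
  have sign : ∀ f : Oˣ, ψ (φ f) = 1 ∨ ψ (φ f) = -1 := fun f =>
    eq_one_or_neg_one_of_isUnit ψ (imageUnit φ f).isUnit
  rcases sign a with hψa | hψa <;> rcases sign d with hψd | hψd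
  · have ha1 := L.eq_one_of_map_eq_one ψ ha hψa
    have hd1 := imageUnit_eq_of_isFundamental_mul_inv ψ had (hψa.trans hψd.symm)
    rw [ha1, map_one] at hd1
    rcases sign t with hψt | hψt
    · have htd1 := L.mul_eq_one_of_map_mul_eq_one htd (by rw [hψt, hψd, one_mul])
      refine absurd ?_ (contra _ (ht.image φ))
      rw [neg_image, eq_inv_of_mul_eq_one_left htd1, map_inv, ← hd1, inv_one]
    · refine absurd ?_ (contra _ (htd.image φ))
      rw [L.eq_neg_one_of_map_eq_neg_one ht hψt, neg_one_mul, neg_image, ← hd1]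
  · refine Or.inr ⟨(sign t).resolve_right fun hψt => contra _ had ?_, hψd⟩
    have htd1 := L.mul_eq_one_of_map_mul_eq_one htd (by rw [hψt, hψd, neg_one_mul, neg_neg])
    rw [L.eq_one_of_map_eq_one ψ ha hψa, ← eq_inv_of_mul_eq_one_left htd1,
      L.eq_neg_one_of_map_eq_neg_one ht hψt, one_mul, neg_image, map_one]
  · exact Or.inl ⟨hψa, hψd⟩
  · refine Or.inr ⟨(sign t).resolve_right fun hψt => contra _ (ha.image φ) ?_, hψd⟩
    have htd1 := L.mul_eq_one_of_map_mul_eq_one htd (by rw [hψt, hψd, neg_one_mul, neg_neg])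
    rw [imageUnit_eq_of_isFundamental_mul_inv ψ had (hψa.trans hψd.symm),
      eq_inv_of_mul_eq_one_right htd1, L.eq_neg_one_of_map_eq_neg_one ht hψt, inv_neg, inv_one,
      neg_image, map_one]

/-- This makes the lifts compatible in a matrix of the form `[a, 1, 1, 0; 1, 0, 1, t; d, 1, 0, 1]`,
of which the hypotheses are minors. A fundamental element of sign `1` in `GF(3)` is equal to `1`,
and one of sign `-1` is determined by the vanishing of a minor. -/
theorem zeroOrMem_sub_of_path_three (L : IsLifting G φ) (ha : IsFundamental G a)
    (htd : IsFundamental G (t * d)) (ht : IsFundamental G (-t))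
    (had : IsFundamental ⊤ (imageUnit φ (a * d⁻¹))) (h₁ : ZeroOrMem ⊤ (φ (1 - a + d)))
    (h₂ : ZeroOrMem ⊤ (φ (-(a * t) - 1 + t * d))) (h₃ : ZeroOrMem ⊤ (φ (a - 1 + t * d))) :
    ZeroOrMem G (a - d : O) := by
  obtain ⟨ψ⟩ := L.ternary
  rcases L.signs_of_path_three ψ ha htd ht had with ⟨hψa, hψd⟩ | ⟨hψt, hψd⟩
  · suffices hd : IsFundamental G (-d) by
      rw [L.sub_eq_one_of_map_eq ha hd hψa hψd h₁]
      exact .one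
    rcases eq_one_or_neg_one_of_isUnit ψ (imageUnit φ t).isUnit with hψt | hψt
    · have htd1 := L.mul_eq_one_of_map_mul_eq_one htd (by rw [hψd, mul_one]; exact hψt)
      rw [eq_inv_of_mul_eq_one_right htd1, ← inv_neg]
      exact ht.inv L.neg_one_mem
    · rwa [L.eq_neg_one_of_map_eq_neg_one ht hψt, neg_one_mul] at htd
  rcases eq_one_or_neg_one_of_isUnit ψ (imageUnit φ a).isUnit with hψa | hψa
  · obtain rfl := L.eq_one_of_map_eq_one ψ ha hψa
    have htd1 := L.mul_sub_one_eq_one_of_map_eq ht htd hψt hψd (by simpa using h₂)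
    rw [← ZeroOrMem.mul_iff ht.1]
    convert ZeroOrMem.one (G := G) using 1
    push_cast
    linear_combination htd1
  · have had1 := imageUnit_eq_of_isFundamental_mul_inv ψ had (hψa.trans hψd.symm)
    rw [L.eq_of_isFundamental_mul ha htd ht (congrArg Units.val had1) hψt hψa h₃, sub_self]
    exact .zero

end PathThree

end IsLifting

end Fundamental

section Walks

variable {X Y R : Type*} [CommRing R] {A : Matrix X Y R} {T : Set Y}

theorem pivot_apply_of_mul_eq_zero {x i : X} {y j : Y} (hi : i ≠ x) (hj : j ≠ y)
    (h : A i y * A x j = 0) : pivot A x y i j = A i j := by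
  rw [pivot_of_ne _ hi hj, mul_right_comm, h, zero_mul, sub_zero]

theorem pivot_cross_of_mul_eq_zero {p q x : X} {u v y : Y} (hp : p ≠ x)
    (hq : q ≠ x) (hy : y ∉ ({u, v} : Set Y)) (hpz : ∀ w ∈ ({u, v} : Set Y), A p y * A x w = 0)
    (hqz : ∀ w ∈ ({u, v} : Set Y), A q y * A x w = 0) :
    pivot A x y p u * pivot A x y q v - pivot A x y p v * pivot A x y q u =
      A p u * A q v - A p v * A q u := by
  have hne : ∀ w ∈ ({u, v} : Set Y), w ≠ y := fun w hw e => hy (e ▸ hw)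
  have hu : u ∈ ({u, v} : Set Y) := Or.inl rfl
  have hv : v ∈ ({u, v} : Set Y) := Or.inr rfl
  rw [pivot_apply_of_mul_eq_zero hp (hne u hu) (hpz u hu),
    pivot_apply_of_mul_eq_zero hp (hne v hv) (hpz v hv),
    pivot_apply_of_mul_eq_zero hq (hne u hu) (hqz u hu),
    pivot_apply_of_mul_eq_zero hq (hne v hv) (hqz v hv)]

/-- `x 0, y 0, x 1, y 1, …, x k` is a walk in the bipartite graph of the nonzero entries of `A`,
with all column vertices in `T`. The values of `x` beyond `k` and of `y` from `k` on are
irrelevant. -/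
def IsWalk (A : Matrix X Y R) (T : Set Y) (k : ℕ) (x : ℕ → X) (y : ℕ → Y) : Prop :=
  ∀ i < k, y i ∈ T ∧ A (x i) (y i) ≠ 0 ∧ A (x (i + 1)) (y i) ≠ 0

/-- The rows `p` and `q` are joined by a walk with `k` column vertices. -/
def Joined (A : Matrix X Y R) (T : Set Y) (k : ℕ) (p q : X) : Prop :=
  ∃ x y, IsWalk A T k x y ∧ x 0 = p ∧ x k = q

/-- A walk without repetitions or chords. -/
def IsInducedWalk (A : Matrix X Y R) (T : Set Y) (k : ℕ) (x : ℕ → X) (y : ℕ → Y) : Prop :=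
  IsWalk A T k x y ∧ ∀ i ≤ k, ∀ j < k, A (x i) (y j) ≠ 0 → i = j ∨ i = j + 1

theorem IsWalk.joined {k : ℕ} {x : ℕ → X} {y : ℕ → Y} (h : IsWalk A T k x y) {i j : ℕ}
    (hij : i ≤ j) (hj : j ≤ k) : Joined A T (j - i) (x i) (x j) :=
  ⟨fun n => x (i + n), fun n => y (i + n), fun n hn => h (i + n) (by omega), rfl,
    by simp only [Nat.add_sub_cancel' hij]⟩

theorem Joined.refl (p : X) (y : Y) : Joined A T 0 p p :=
  ⟨fun _ => p, fun _ => y, fun i hi => absurd hi (Nat.not_lt_zero i), rfl, rfl⟩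

theorem Joined.cons {k : ℕ} {p q r : X} {y : Y} (hy : y ∈ T) (hp : A p y ≠ 0) (hq : A q y ≠ 0)
    (h : Joined A T k q r) : Joined A T (k + 1) p r := by
  obtain ⟨x, z, hw, rfl, rfl⟩ := h
  refine ⟨fun n => Nat.casesOn n p x, fun n => Nat.casesOn n y z, ?_, rfl, rfl⟩
  rintro (_ | i) hi
  · exact ⟨hy, hp, hq⟩
  · exact hw i (by omega)

theorem Joined.trans {k l : ℕ} {p q r : X} (h : Joined A T k p q) (h' : Joined A T l q r) :
    Joined A T (k + l) p r := by
  induction k generalizing p with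
  | zero =>
    obtain ⟨x, z, -, rfl, rfl⟩ := h
    rwa [zero_add]
  | succ k ih =>
    obtain ⟨x, z, hw, rfl, rfl⟩ := h
    obtain ⟨hT, hx, hx'⟩ := hw 0 (by omega)
    rw [Nat.succ_add]
    exact (ih (hw.joined (i := 1) (by omega) le_rfl)).cons hT hx hx'

theorem Joined.mono {S : Set Y} {k : ℕ} {p q : X} (h : Joined A T k p q) (hST : T ⊆ S) :
    Joined A S k p q := by
  obtain ⟨x, z, hw, h⟩ := h
  exact ⟨x, z, fun i hi => ⟨hST (hw i hi).1, (hw i hi).2⟩, h⟩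

theorem IsWalk.isInducedWalk {k : ℕ} {x : ℕ → X} {y : ℕ → Y} (h : IsWalk A T k x y)
    (hmin : ∀ l < k, ¬ Joined A T l (x 0) (x k)) : IsInducedWalk A T k x y := by
  refine ⟨h, fun i hi j hj hA => ?_⟩
  obtain ⟨hT, hl, hr⟩ := h j hj
  have hle : j ≤ i := by
    by_contra! hlt
    exact hmin (i - 0 + (k - (j + 1) + 1)) (by omega) <|
      (h.joined (Nat.zero_le i) hi).trans ((h.joined (Nat.succ_le_of_lt hj) le_rfl).cons hT hA hr)
  have hge : i ≤ j + 1 := by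
    by_contra! hlt
    exact hmin (j - 0 + (k - i + 1)) (by omega) <|
      (h.joined (Nat.zero_le j) hj.le).trans ((h.joined hi le_rfl).cons hT hl hA)
  omega

theorem Joined.exists_isInducedWalk {k : ℕ} {p q : X} (h : Joined A T k p q) :
    ∃ l ≤ k, ∃ x y, IsInducedWalk A T l x y ∧ x 0 = p ∧ x l = q := by
  classical
  have hex : ∃ l, Joined A T l p q := ⟨k, h⟩
  obtain ⟨x, y, hw, h0, hl⟩ := Nat.find_spec hex
  refine ⟨Nat.find hex, Nat.find_min' hex h, x, y, hw.isInducedWalk fun l hlt => ?_, h0, hl⟩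
  rw [h0, hl]
  exact Nat.find_min hex hlt

namespace IsInducedWalk

variable {k : ℕ} {x : ℕ → X} {y : ℕ → Y}

theorem eq_zero (h : IsInducedWalk A T k x y) {i j : ℕ} (hi : i ≤ k) (hj : j < k) (hij : i ≠ j)
    (hij' : i ≠ j + 1) : A (x i) (y j) = 0 :=
  of_not_not fun h0 => (h.2 i hi j hj h0).elim hij hij'

theorem row_ne_one (h : IsInducedWalk A T (k + 2) x y) {i : ℕ} (hi : i ≤ k + 2) (h1 : i ≠ 1) :
    x i ≠ x 1 := by
  intro e
  rcases Nat.eq_zero_or_pos i with rfl | hpos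
  · apply (h.1 1 (by omega)).2.1
    rw [← e]
    exact h.eq_zero (by omega) (by omega) (by omega) (by omega)
  · apply (h.1 0 (by omega)).2.2
    rw [zero_add, ← e]
    exact h.eq_zero hi (by omega) (by omega) (by omega)

theorem col_ne_one (h : IsInducedWalk A T (k + 2) x y) {j : ℕ} (hj : j < k + 2) (h1 : j ≠ 1) :
    y j ≠ y 1 := by
  intro e
  rcases Nat.eq_zero_or_pos j with rfl | hpos
  · apply (h.1 0 (by omega)).2.1
    rw [e]
    exact h.eq_zero (by omega) (by omega) (by omega) (by omega)
  · apply (h.1 1 (by omega)).2.1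
    rw [← e]
    exact h.eq_zero (by omega) hj (by omega) (by omega)

theorem joined_pivot (h : IsInducedWalk A T (k + 2) x y)
    (hT : ∀ x, ∀ y ∈ T, A x y ≠ 0 → IsUnit (A x y)) :
    Joined (pivot A (x 1) (y 1)) T (k + 1) (x 0) (x (k + 2)) := by
  obtain ⟨hy0, h00, h10⟩ := h.1 0 (by omega)
  obtain ⟨hy1, h11, h21⟩ := h.1 1 (by omega)
  have : Nontrivial R := ⟨_, _, h11⟩
  have h01 : A (x 0) (y 1) = 0 := h.eq_zero (by omega) (by omega) (by omega) (by omega)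
  have h20 : A (x 2) (y 0) = 0 := h.eq_zero (by omega) (by omega) (by omega) (by omega)
  have hy := h.col_ne_one (j := 0) (by omega) (by omega)
  have hfill : pivot A (x 1) (y 1) (x 2) (y 0) ≠ 0 := by
    rw [pivot_of_ne _ (h.row_ne_one (by omega) (by omega)) hy, h20, zero_sub, neg_ne_zero]
    exact (((hT _ _ hy1 h21).mul (hT _ _ hy1 h11).ringInverse).mul (hT _ _ hy0 h10)).ne_zero
  have htail : IsWalk (pivot A (x 1) (y 1)) T k (fun n => x (n + 2)) (fun n => y (n + 2)) := by
    intro n hn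
    have h1n : A (x 1) (y (n + 2)) = 0 := h.eq_zero (by omega) (by omega) (by omega) (by omega)
    have hyn := h.col_ne_one (j := n + 2) (by omega) (by omega)
    rw [pivot_apply_of_mul_eq_zero (h.row_ne_one (by omega) (by omega)) hyn (by simp [h1n]),
      pivot_apply_of_mul_eq_zero (h.row_ne_one (by omega) (by omega)) hyn (by simp [h1n])]
    exact h.1 (n + 2) (by omega)
  refine Joined.cons hy0 ?_ hfill ⟨_, _, htail, rfl, rfl⟩
  rwa [pivot_apply_of_mul_eq_zero (h.row_ne_one (by omega) (by omega)) hy (by simp [h01])]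

end IsInducedWalk

end Walks

section TwoColumns

variable {O R X Y : Type*} [CommRing O] [CommRing R] {G : Subgroup Oˣ} {φ : O →+* R}

theorem ZeroOrMem.sub_of_eq_zero_or (hG : -1 ∈ G) {a b : O} (ha : ZeroOrMem G a)
    (hb : ZeroOrMem G b) (h : a = 0 ∨ b = 0) : ZeroOrMem G (a - b) := by
  rcases h with rfl | rfl
  · rw [zero_sub]; exact hb.neg hG
  · rwa [sub_zero]

namespace IsLifting

theorem mul_eq_mul_of_cross (L : IsLifting G φ) {a b a' b' c d : O} (ha : ZeroOrMem G a)
    (hb : ZeroOrMem G b) (ha' : ZeroOrMem G a') (hb' : ZeroOrMem G b') (hc : ZeroOrMem G c)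
    (hd : ZeroOrMem G d) (hc0 : c ≠ 0) (hd0 : d ≠ 0) (h : ZeroOrMem G (a * d - c * b))
    (h' : ZeroOrMem G (a' * d - c * b')) (haa' : φ a = φ a') (hbb' : φ b = φ b') :
    a * b' = b * a' := by
  have hzero : ∀ {x x' : O}, ZeroOrMem G x → ZeroOrMem G x' → φ x = φ x' → (x = 0 ↔ x' = 0) :=
    fun hx hx' e => by rw [← L.map_eq_zero_iff hx, e, L.map_eq_zero_iff hx']
  by_cases ha0 : a = 0
  · rw [ha0, (hzero ha ha' haa').1 ha0, zero_mul, mul_zero]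
  by_cases hb0 : b = 0
  · rw [hb0, (hzero hb hb' hbb').1 hb0, zero_mul, mul_zero]
  obtain ⟨a', ga', rfl⟩ := ha'.exists_of_ne (mt (hzero ha ha' haa').2 ha0)
  obtain ⟨b', gb', rfl⟩ := hb'.exists_of_ne (mt (hzero hb hb' hbb').2 hb0)
  obtain ⟨a, ga, rfl⟩ := ha.exists_of_ne ha0
  obtain ⟨b, gb, rfl⟩ := hb.exists_of_ne hb0
  obtain ⟨c, gc, rfl⟩ := hc.exists_of_ne hc0
  obtain ⟨d, gd, rfl⟩ := hd.exists_of_ne hd0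
  have ea : imageUnit φ a = imageUnit φ a' := Units.ext haa'
  have eb : imageUnit φ b = imageUnit φ b' := Units.ext hbb'
  have hcross := L.fundamental_inj ((isFundamental_cross_iff ga gc gb gd).2 h)
    ((isFundamental_cross_iff ga' gc gb' gd).2 h') (by simp only [map_mul, map_inv, ea, eb])
  rw [mul_left_inj, mul_inv_eq_iff_eq_mul, mul_right_comm, eq_mul_inv_iff_mul_eq, mul_assoc,
    mul_assoc, mul_right_inj] at hcross
  rw [← Units.val_mul, ← Units.val_mul, hcross, mul_comm]

theorem mul_eq_mul_of_common_column (L : IsLifting G φ) {T : Set Y} {w y : Y}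
    {A B : Matrix X Y O} (hA : MinorsOn G A (insert w T)) (hB : MinorsOn G B (insert w T))
    (hAB : ∀ x, ∀ y ∈ T, A x y = B x y) (hφ : ∀ x, φ (A x w) = φ (B x w)) (hy : y ∈ T) {p q : X}
    (hp : A p y ≠ 0) (hq : A q y ≠ 0) : A p w * B q w = A q w * B p w := by
  have hwm : w ∈ insert w T := Set.mem_insert _ _
  have hym : y ∈ insert w T := Or.inr hy
  have hcrossB := hB.two p q hwm hym
  rw [← hAB _ _ hy, ← hAB _ _ hy] at hcrossB
  exact L.mul_eq_mul_of_cross (hA.apply _ hwm) (hA.apply _ hwm) (hB.apply _ hwm)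
    (hB.apply _ hwm) (hA.apply _ hym) (hA.apply _ hym) hp hq (hA.two _ _ hwm hym) hcrossB
    (hφ _) (hφ _)

/-- Pivoting on an interior entry of an induced path shortens the path and, when the row of that
entry vanishes in column `w`, does not change the column `w`. -/
theorem mul_eq_mul_of_joined [Finite X] (L : IsLifting G φ) {T : Set Y} {w : Y} (hw : w ∉ T)
    (k : ℕ) (A B : Matrix X Y O) (hA : MinorsOn G A (insert w T))
    (hB : MinorsOn G B (insert w T)) (hAB : ∀ x, ∀ y ∈ T, A x y = B x y)
    (hφ : ∀ x, φ (A x w) = φ (B x w)) {p q : X} (hpq : Joined A T k p q) :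
    A p w * B q w = A q w * B p w := by
  have hwm : w ∈ insert w T := Set.mem_insert _ _
  induction k using Nat.strong_induction_on generalizing A B p q with
  | _ k ih =>
  obtain ⟨l, hlk, x, y, hi, rfl, rfl⟩ := hpq.exists_isInducedWalk
  match l, hi with
  | 0, _ => rfl
  | 1, hi =>
    obtain ⟨hy, h0, h1⟩ := hi.1 0 one_pos
    exact L.mul_eq_mul_of_common_column hA hB hAB hφ hy h0 h1
  | l + 2, hi =>
    by_cases hA0 : A (x 1) w = 0
    · have hB0 : B (x 1) w = 0 := by
        rwa [← L.map_eq_zero_iff (hB.apply _ hwm), ← hφ, L.map_eq_zero_iff (hA.apply _ hwm)]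
      obtain ⟨hy, hne, -⟩ := hi.1 1 (by omega)
      have hwy : w ≠ y 1 := fun h => hw (h ▸ hy)
      have hunit : ∀ x, ∀ y ∈ T, A x y ≠ 0 → IsUnit (A x y) :=
        fun x y hy => (hA.apply x (Or.inr hy)).isUnit
      have hu := hunit _ _ hy hne
      have hpivA : ∀ i, i ≠ x 1 → pivot A (x 1) (y 1) i w = A i w :=
        fun i hi => pivot_apply_of_mul_eq_zero hi hwy (by rw [hA0, mul_zero])
      have hpivB : ∀ i, i ≠ x 1 → pivot B (x 1) (y 1) i w = B i w :=
        fun i hi => pivot_apply_of_mul_eq_zero hi hwy (by rw [hB0, mul_zero])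
      have hx0 := hi.row_ne_one (i := 0) (by omega) (by omega)
      have hx2 := hi.row_ne_one (i := l + 2) le_rfl (by omega)
      rw [← hpivA _ hx0, ← hpivA _ hx2, ← hpivB _ hx0, ← hpivB _ hx2]
      refine ih (l + 1) (by omega) _ _ (hA.pivot L.neg_one_mem _ (Or.inr hy) hu)
        (hB.pivot L.neg_one_mem _ (Or.inr hy) (by rwa [← hAB _ _ hy])) ?_ ?_ (hi.joined_pivot hunit)
      · intro i j hj
        simp only [pivot, hAB _ _ hj, hAB _ _ hy]
      · intro i
        by_cases hix : i = x 1
        · rw [hix, pivot_row _ _ hwy, pivot_row _ _ hwy, hA0, hB0, mul_zero, mul_zero]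
        · rw [hpivA _ hix, hpivB _ hix, hφ]
    · have hfirst := ih 1 (by omega) A B hA hB hAB hφ (hi.1.joined (i := 0) (j := 1) (by omega)
        (by omega))
      have hrest := ih (l + 1) (by omega) A B hA hB hAB hφ (hi.1.joined (i := 1) (by omega) le_rfl)
      refine ((hA.apply (x 1) hwm).isUnit hA0).mul_left_cancel ?_
      linear_combination A (x 0) w * hrest + A (x (l + 2)) w * hfirst

end IsLifting

/-- The image of `A` under `φ` has all minors zero or units, and the minors of `A` that do not use
both of the columns `u` and `v` are zero or in `G`. -/
structure IsNearLift (G : Subgroup Oˣ) (φ : O →+* R) (A : Matrix X Y O) (u v : Y) : Prop where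
  left : MinorsOn G A {u}ᶜ
  right : MinorsOn G A {v}ᶜ
  image : MinorsIn ⊤ (A.map φ)

namespace IsNearLift

variable {A : Matrix X Y O} {u v : Y}

theorem symm (h : IsNearLift G φ A u v) : IsNearLift G φ A v u := ⟨h.right, h.left, h.image⟩

theorem apply (h : IsNearLift G φ A u v) (huv : u ≠ v) (x : X) (y : Y) : ZeroOrMem G (A x y) := by
  by_cases hy : y = u
  · exact h.right.apply x (hy ▸ huv)
  · exact h.left.apply x hy

theorem image_two (h : IsNearLift G φ A u v) (p q : X) (y z : Y) :
    ZeroOrMem ⊤ (φ (A p y * A q z - A p z * A q y)) := by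
  simpa only [map_apply, ← map_mul, ← map_sub] using
    (h.image.minorsOn Set.univ).two p q (u := y) (v := z) trivial trivial

theorem pivot [Finite X] (hG : -1 ∈ G) (h : IsNearLift G φ A u v) (x : X) {y : Y}
    (hy : y ∈ ({u, v} : Set Y)ᶜ) (hu : IsUnit (A x y)) : IsNearLift G φ (pivot A x y) u v where
  left := h.left.pivot hG x (fun e => hy (Or.inl e)) hu
  right := h.right.pivot hG x (fun e => hy (Or.inr e)) hu
  image := by
    rw [pivot_map φ _ _ _ hu]
    exact h.image.pivot (Subgroup.mem_top _) _ _ (hu.map φ)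

theorem submatrix {X' Y' : Type*} (f : X' → X) {g : Y' → Y} {u v : Y'}
    (h : IsNearLift G φ A (g u) (g v)) (hu : ∀ y, g y = g u → y = u)
    (hv : ∀ y, g y = g v → y = v) : IsNearLift G φ (A.submatrix f g) u v where
  left k f' g' hg' := h.left k (f ∘ f') (g ∘ g') fun i e => hg' i (hu _ e)
  right k f' g' hg' := h.right k (f ∘ f') (g ∘ g') fun i e => hg' i (hv _ e)
  image := h.image.submatrix f g

theorem scale (h : IsNearLift G φ A u v) (s : X → Oˣ) (t : Y → Oˣ) (hs : ∀ x, s x ∈ G)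
    (ht : ∀ y, t y ∈ G) : IsNearLift G φ (Matrix.of fun x y => (s x : O) * A x y * t y) u v where
  left := h.left.scale s t hs ht
  right := h.right.scale s t hs ht
  image k f g := by
    convert (h.image.minorsOn Set.univ).scale (fun x => imageUnit φ (s x))
      (fun y => imageUnit φ (t y)) (fun _ => trivial) (fun _ => trivial) k f g fun _ => trivial
    ext x y
    simp

end IsNearLift

namespace IsLifting

theorem zeroOrMem_sub_of_isNearLift (L : IsLifting G φ) {a d t : Oˣ} (ha : a ∈ G) (hd : d ∈ G)
    (ht : t ∈ G)
    (h : IsNearLift G φ !![(a : O), 1, 1, 0; 1, 0, 1, (t : O); (d : O), 1, 0, 1] 0 1) :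
    ZeroOrMem G (a - d : O) := by
  have image_three : ∀ u v w : Fin 4, _ := fun u v w =>
    (h.image.minorsOn Set.univ).three 0 1 2 (u := u) (v := v) (w := w) trivial trivial trivial
  have had := h.image_two 0 2 0 1
  have hafund := h.right.two 0 1 (u := 2) (v := 0) (by simp) (by simp)
  have htdfund := h.right.two 1 2 (u := 0) (v := 3) (by simp) (by simp)
  have htfund := h.left.three 0 1 2 (u := 1) (v := 2) (w := 3) (by simp) (by simp) (by simp)
  refine L.zeroOrMem_sub_of_path_three ⟨ha, by simpa using hafund⟩
    ⟨G.mul_mem ht hd, by simpa using htdfund⟩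
    ⟨neg_one_mul t ▸ G.mul_mem L.neg_one_mem ht, by simpa using htfund⟩
    (map_mul_inv (imageUnit φ) a d ▸
      (isFundamental_mul_inv_iff (Subgroup.mem_top _) trivial trivial).2 (by simpa using had))
    ?_ ?_ ?_
  · convert image_three 0 1 2 using 1
    simp only [map_add, map_sub, map_one, Fin.isValue, map_apply, of_apply, cons_val',
      cons_val_zero, cons_val_fin_one, cons_val_one, map_zero, cons_val]
    ring
  · convert image_three 0 1 3 using 1
    simp
  · convert image_three 0 2 3 using 1
    simp

theorem zeroOrMem_sub_of_isNearLift_units (L : IsLifting G φ) {pu pv e c g h qu qv l : Oˣ}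
    (gpu : pu ∈ G) (gpv : pv ∈ G) (ge : e ∈ G) (gc : c ∈ G) (gg : g ∈ G) (gh : h ∈ G)
    (gqu : qu ∈ G) (gqv : qv ∈ G) (gl : l ∈ G)
    (hA : IsNearLift G φ !![(pu : O), pv, e, 0; c, 0, g, h; qu, qv, 0, (l : O)] 0 1) :
    ZeroOrMem G (pu * qv - pv * qu : O) := by
  have mul := fun {a b : Oˣ} => G.mul_mem (x := a) (y := b)
  have inv := fun {a : Oˣ} => G.inv_mem (x := a)
  obtain ⟨s, hs⟩ : ∃ s, s = c⁻¹ * g * e⁻¹ := ⟨_, rfl⟩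
  obtain ⟨t, ht⟩ : ∃ t, t = l⁻¹ * qv * pv⁻¹ := ⟨_, rfl⟩
  have gs : s ∈ G := hs ▸ mul (mul (inv gc) gg) (inv ge)
  have gt : t ∈ G := ht ▸ mul (mul (inv gl) gqv) (inv gpv)
  have hcs : (e * (g⁻¹ : Oˣ) * c * s : O) = 1 := by
    rw [hs]
    exact congrArg Units.val (by group : e * g⁻¹ * c * (c⁻¹ * g * e⁻¹) = 1)
  have hlt : (pv * (qv⁻¹ : Oˣ) * l * t : O) = 1 := by
    rw [ht]
    exact congrArg Units.val (by group : pv * qv⁻¹ * l * (l⁻¹ * qv * pv⁻¹) = 1)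
  have hscale := hA.scale ![1, e * g⁻¹, pv * qv⁻¹] ![s, pv⁻¹, e⁻¹, t]
    (by simp [Fin.forall_fin_succ, mul ge (inv gg), mul gpv (inv gqv), G.one_mem])
    (by simp [Fin.forall_fin_succ, gs, inv gpv, inv ge, gt])
  have had := L.zeroOrMem_sub_of_isNearLift (a := pu * s) (d := pv * qv⁻¹ * qu * s)
    (t := e * g⁻¹ * h * t) (mul gpu gs) (mul (mul (mul gpv (inv gqv)) gqu) gs)
    (mul (mul (mul ge (inv gg)) gh) gt) (by
      convert hscale using 1
      ext i j
      fin_cases i <;> fin_cases j <;> simp [hcs, hlt])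
  have hunscale : (pu * qv - pv * qu : O) =
      (s⁻¹ * qv : Oˣ) * ((pu * s : Oˣ) - (pv * qv⁻¹ * qu * s : Oˣ)) := by
    push_cast
    linear_combination (pv * qu - pu * qv : O) * s.mul_inv +
      (pv * qu * s * (s⁻¹ : Oˣ) : O) * qv.mul_inv
  rw [hunscale]
  exact (ZeroOrMem.mul_iff (mul (inv gs) gqv)).2 had

theorem zeroOrMem_of_path_two (L : IsLifting G φ) {u v : Y} {A : Matrix X Y O}
    (h : IsNearLift G φ A u v) (huv : u ≠ v) {x : ℕ → X} {y : ℕ → Y}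
    (hi : IsInducedWalk A {u, v}ᶜ 2 x y) (hxu : A (x 1) u ≠ 0) (hxv : A (x 1) v = 0) :
    ZeroOrMem G (A (x 0) u * A (x 2) v - A (x 0) v * A (x 2) u) := by
  have hentry := h.apply huv
  by_cases hzero : A (x 0) u * A (x 2) v = 0 ∨ A (x 0) v * A (x 2) u = 0
  · exact .sub_of_eq_zero_or L.neg_one_mem ((hentry _ _).mul (hentry _ _))
      ((hentry _ _).mul (hentry _ _)) hzero
  obtain ⟨hl, hr⟩ := not_or.1 hzero
  obtain ⟨hy0, e0, g0⟩ := hi.1 0 (by omega)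
  obtain ⟨hy1, h0, l0⟩ := hi.1 1 (by omega)
  have z0 : A (x 0) (y 1) = 0 := hi.eq_zero (by omega) (by omega) (by omega) (by omega)
  have z2 : A (x 2) (y 0) = 0 := hi.eq_zero (by omega) (by omega) (by omega) (by omega)
  simp only [Set.mem_compl_iff, Set.mem_insert_iff, Set.mem_singleton_iff, not_or] at hy0 hy1
  have hsub : IsNearLift G φ (A.submatrix ![x 0, x 1, x 2] ![u, v, y 0, y 1]) 0 1 :=
    h.submatrix (u := (0 : Fin 4)) (v := 1) (g := ![u, v, y 0, y 1]) ![x 0, x 1, x 2]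
      (by simp [Fin.forall_fin_succ, huv.symm, hy0.1, hy1.1])
      (by simp [Fin.forall_fin_succ, huv, hy0.2, hy1.2])
  obtain ⟨pu, gpu, epu⟩ := (hentry (x 0) u).exists_of_ne (left_ne_zero_of_mul hl)
  obtain ⟨qv, gqv, eqv⟩ := (hentry (x 2) v).exists_of_ne (right_ne_zero_of_mul hl)
  obtain ⟨pv, gpv, epv⟩ := (hentry (x 0) v).exists_of_ne (left_ne_zero_of_mul hr)
  obtain ⟨qu, gqu, equ⟩ := (hentry (x 2) u).exists_of_ne (right_ne_zero_of_mul hr)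
  obtain ⟨c, gc, ec⟩ := (hentry (x 1) u).exists_of_ne hxu
  obtain ⟨e, ge, ee⟩ := (hentry (x 0) (y 0)).exists_of_ne e0
  obtain ⟨g, gg, eg⟩ := (hentry (x 1) (y 0)).exists_of_ne g0
  obtain ⟨h', gh, eh⟩ := (hentry (x 1) (y 1)).exists_of_ne h0
  obtain ⟨l, gl, el⟩ := (hentry (x 2) (y 1)).exists_of_ne l0
  rw [← epu, ← eqv, ← epv, ← equ]
  refine L.zeroOrMem_sub_of_isNearLift_units gpu gpv ge gc gg gh gqu gqv gl ?_
  convert hsub using 1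
  ext i j
  fin_cases i <;> fin_cases j <;>
    simp [z0, z2, hxv, epu, eqv, epv, equ, ec, ee, eg, eh, el]

theorem zeroOrMem_of_path_two_of_or (L : IsLifting G φ) {u v : Y} {A : Matrix X Y O}
    (h : IsNearLift G φ A u v) (huv : u ≠ v) {x : ℕ → X} {y : ℕ → Y}
    (hi : IsInducedWalk A {u, v}ᶜ 2 x y) (hor : A (x 1) u ≠ 0 ∨ A (x 1) v ≠ 0)
    (hand : ¬(A (x 1) u ≠ 0 ∧ A (x 1) v ≠ 0)) :
    ZeroOrMem G (A (x 0) u * A (x 2) v - A (x 0) v * A (x 2) u) := by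
  rcases hor with hu | hv
  · exact L.zeroOrMem_of_path_two h huv hi hu (by tauto)
  · rw [ZeroOrMem.sub_comm_iff L.neg_one_mem]
    exact L.zeroOrMem_of_path_two h.symm huv.symm (Set.pair_comm u v ▸ hi) hv (by tauto)

theorem zeroOrMem_sub_of_middle (L : IsLifting G φ) {pu pv cu cv qu qv : O}
    (hpu : ZeroOrMem G pu) (hpv : ZeroOrMem G pv) (hcu : ZeroOrMem G cu) (hcv : ZeroOrMem G cv)
    (hqu : ZeroOrMem G qu) (hqv : ZeroOrMem G qv) (hcu0 : cu ≠ 0) (hcv0 : cv ≠ 0)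
    (hpc : ZeroOrMem G (pu * cv - pv * cu)) (hcq : ZeroOrMem G (cu * qv - cv * qu))
    (hpq : ZeroOrMem ⊤ (φ (pu * qv - pv * qu))) : ZeroOrMem G (pu * qv - pv * qu) := by
  by_cases hzero : pu * qv = 0 ∨ pv * qu = 0
  · exact .sub_of_eq_zero_or L.neg_one_mem (hpu.mul hqv) (hpv.mul hqu) hzero
  obtain ⟨hl, hr⟩ := not_or.1 hzero
  obtain ⟨pu, gpu, rfl⟩ := hpu.exists_of_ne (left_ne_zero_of_mul hl)
  obtain ⟨qv, gqv, rfl⟩ := hqv.exists_of_ne (right_ne_zero_of_mul hl)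
  obtain ⟨pv, gpv, rfl⟩ := hpv.exists_of_ne (left_ne_zero_of_mul hr)
  obtain ⟨qu, gqu, rfl⟩ := hqu.exists_of_ne (right_ne_zero_of_mul hr)
  obtain ⟨cu, gcu, rfl⟩ := hcu.exists_of_ne hcu0
  obtain ⟨cv, gcv, rfl⟩ := hcv.exists_of_ne hcv0
  rw [← isFundamental_cross_iff gpu gpv gcu gcv] at hpc
  rw [← isFundamental_cross_iff gcu gcv gqu gqv] at hcq
  rw [← isFundamental_cross_iff gpu gpv gqu gqv]
  have hmul : pv * cu * pu⁻¹ * cv⁻¹ * (cv * qu * cu⁻¹ * qv⁻¹) = pv * qu * pu⁻¹ * qv⁻¹ := by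
    rw [show pv * cu * pu⁻¹ * cv⁻¹ * (cv * qu * cu⁻¹ * qv⁻¹) =
      pv * qu * pu⁻¹ * qv⁻¹ * (cu * cu⁻¹) * (cv * cv⁻¹) by ac_rfl, mul_inv_cancel, mul_inv_cancel,
      mul_one, mul_one]
  rw [← hmul]
  refine L.isFundamental_mul hpc hcq ?_
  rw [hmul]
  simp only [map_mul, map_inv]
  rw [isFundamental_cross_iff (G := (⊤ : Subgroup Rˣ)) trivial trivial trivial trivial]
  simpa using hpq

theorem zeroOrMem_of_common_column (L : IsLifting G φ) {u v y : Y} (huv : u ≠ v)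
    {A : Matrix X Y O} (h : IsNearLift G φ A u v) (hy : y ∈ ({u, v} : Set Y)ᶜ) {p q : X}
    (hp : A p y ≠ 0) (hq : A q y ≠ 0) : ZeroOrMem G (A p u * A q v - A p v * A q u) := by
  have hentry := h.apply huv
  simp only [Set.mem_compl_iff, Set.mem_insert_iff, Set.mem_singleton_iff, not_or] at hy
  have hcross := L.zeroOrMem_sub_of_middle (hentry p u) (hentry q u) (hentry p y) (hentry q y)
    (hentry p v) (hentry q v) hp hq
  simp only [mul_comm (A q u)] at hcross
  refine hcross (h.right.two _ _ huv hy.2) ?_ ?_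
  · simpa only [mul_comm (A q y)] using h.left.two p q hy.1 huv.symm
  · simpa only [mul_comm (A p v)] using h.image_two p q u v

theorem zeroOrMem_of_joined [Finite X] (L : IsLifting G φ) {u v : Y} (huv : u ≠ v) (k : ℕ)
    {A : Matrix X Y O} (h : IsNearLift G φ A u v) {p q : X} (hpq : Joined A {u, v}ᶜ k p q) :
    ZeroOrMem G (A p u * A q v - A p v * A q u) := by
  induction k using Nat.strong_induction_on generalizing A p q with
  | _ k ih =>
  obtain ⟨l, hlk, x, y, hi, rfl, rfl⟩ := hpq.exists_isInducedWalk
  have hentry := h.apply huv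
  match l, hi with
  | 0, _ => rw [mul_comm, sub_self]; exact .zero
  | 1, hi =>
    obtain ⟨hy, h0, h1⟩ := hi.1 0 one_pos
    exact L.zeroOrMem_of_common_column huv h hy h0 h1
  | l + 2, hi =>
    obtain ⟨hy, hne, -⟩ := hi.1 1 (by omega)
    by_cases hmid : A (x 1) u ≠ 0 ∧ A (x 1) v ≠ 0
    · exact L.zeroOrMem_sub_of_middle (hentry _ _) (hentry _ _) (hentry _ _) (hentry _ _)
        (hentry _ _) (hentry _ _) hmid.1 hmid.2
        (ih 1 (by omega) h (hi.1.joined (i := 0) (j := 1) (by omega) (by omega)))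
        (ih (l + 1) (by omega) h (hi.1.joined (i := 1) (by omega) le_rfl)) (h.image_two _ _ _ _)
    by_cases hpath : l = 0 ∧ (A (x 1) u ≠ 0 ∨ A (x 1) v ≠ 0)
    · obtain ⟨rfl, hne'⟩ := hpath
      exact L.zeroOrMem_of_path_two_of_or h huv hi hne' hmid
    have hfirst : ∀ w ∈ ({u, v} : Set Y), A (x 0) (y 1) * A (x 1) w = 0 := fun w _ => by
      rw [hi.eq_zero (by omega) (by omega) (by omega) (by omega), zero_mul]
    have hlast : ∀ w ∈ ({u, v} : Set Y), A (x (l + 2)) (y 1) * A (x 1) w = 0 := by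
      rintro w hw
      rcases Nat.eq_zero_or_pos l with rfl | hl
      · rcases hw with rfl | rfl <;> simp_all
      · rw [hi.eq_zero le_rfl (by omega) (by omega) (by omega), zero_mul]
    have := ih (l + 1) (by omega) (h.pivot L.neg_one_mem (x 1) hy ((hentry _ _).isUnit hne))
      (hi.joined_pivot fun x y _ => (hentry x y).isUnit)
    rwa [pivot_cross_of_mul_eq_zero (hi.row_ne_one (by omega) (by omega))
      (hi.row_ne_one le_rfl (by omega)) hy hfirst hlast] at this

end IsLifting

end TwoColumns

section Connected

variable {X Y R : Type*} [CommRing R] {A : Matrix X Y R} {T : Set Y}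

/-- The bipartite graph of the nonzero entries of `A` in the columns `T` is connected: it has no
union of components other than itself and the empty one. -/
def IsConnectedOn (A : Matrix X Y R) (T : Set Y) : Prop :=
  ∀ (S : Set X) (B : Set Y), B ⊆ T → (S.Nonempty ∨ B.Nonempty) →
    (∀ x, ∀ y ∈ T, A x y ≠ 0 → (x ∈ S ↔ y ∈ B)) → S = Set.univ ∧ B = T

theorem IsConnectedOn.congr {S : Type*} [CommRing S] {B : Matrix X Y S} (h : IsConnectedOn A T)
    (hAB : ∀ x, ∀ y ∈ T, A x y ≠ 0 → B x y ≠ 0) : IsConnectedOn B T :=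
  fun S C hC hne hcl => h S C hC hne fun x y hy hxy => hcl x y hy (hAB x y hy hxy)

theorem IsConnectedOn.joined (h : IsConnectedOn A T) (y₀ : Y) (p q : X) :
    ∃ k, Joined A T k p q := by
  have hall : {x | ∃ k, Joined A T k x q} = Set.univ := by
    refine (h {x | ∃ k, Joined A T k x q}
      {y | y ∈ T ∧ ∃ x, (∃ k, Joined A T k x q) ∧ A x y ≠ 0} (fun y hy => hy.1)
      (Or.inl ⟨q, 0, .refl q y₀⟩) fun x y hy hxy => ⟨fun hx => ⟨hy, x, hx, hxy⟩, ?_⟩).1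
    rintro ⟨-, x', ⟨k, hk⟩, hx'⟩
    exact ⟨k + 1, hk.cons hy hxy hx'⟩
  exact Set.eq_univ_iff_forall.1 hall p

theorem IsConnectedOn.pivot (h : IsConnectedOn A T) {x₀ : X} {y₀ : Y} (hy₀ : y₀ ∈ T)
    (hu : IsUnit (A x₀ y₀)) : IsConnectedOn (pivot A x₀ y₀) T := by
  cases subsingleton_or_nontrivial R
  · intro S B hB hne _
    exact h S B hB hne fun x y _ hxy => absurd (Subsingleton.elim _ _) hxy
  intro S B hB hne hcl
  refine h S B hB hne ?_
  have h0 : PartialField.pivot A x₀ y₀ x₀ y₀ ≠ 0 := by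
    rw [pivot_self]
    exact hu.ringInverse.ne_zero
  rw [← pivot_pivot A x₀ y₀ hu]
  generalize PartialField.pivot A x₀ y₀ = A' at hcl h0
  have hpivot := hcl x₀ y₀ hy₀ h0
  intro x y hy hxy
  by_cases hx : x = x₀ <;> by_cases hyy : y = y₀
  · rwa [hx, hyy]
  · rw [hx, pivot_row _ _ hyy] at hxy
    exact hx ▸ hcl x₀ y hy (right_ne_zero_of_mul hxy)
  · rw [hyy, pivot_col _ _ hx, neg_ne_zero] at hxy
    exact hyy ▸ hcl x y₀ hy₀ (left_ne_zero_of_mul hxy)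
  · rw [pivot_of_ne _ hx hyy] at hxy
    by_cases hzero : A' x y = 0
    · rw [hzero, zero_sub, neg_ne_zero] at hxy
      rw [hcl x y₀ hy₀ (left_ne_zero_of_mul (left_ne_zero_of_mul hxy)), ← hpivot,
        hcl x₀ y hy (right_ne_zero_of_mul hxy)]
    · exact hcl x y hy hzero

theorem zeroOrMem_det_of_mem_pair {G : Subgroup Rˣ} (hG : -1 ∈ G) {u v : Y}
    (hA : ∀ x y, ZeroOrMem G (A x y))
    (htwo : ∀ p q, ZeroOrMem G (A p u * A q v - A p v * A q u)) {k : ℕ} (f : Fin k → X)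
    (g : Fin k → Y) (hg : ∀ i, g i ∈ ({u, v} : Set Y)) : ZeroOrMem G (A.submatrix f g).det := by
  by_cases hinj : Function.Injective g
  swap
  · rw [det_submatrix_eq_zero_of_not_injective_right _ _ hinj]; exact .zero
  match k, f, g with
  | 0, f, g => rw [det_fin_zero]; exact .one
  | 1, f, g => rw [det_fin_one]; exact hA _ _
  | 2, f, g =>
    have hne : g 0 ≠ g 1 := hinj.ne (by decide)
    rw [det_fin_two]
    simp only [submatrix_apply]
    rcases hg 0 with h0 | h0 <;> rcases hg 1 with h1 | h1 <;> rw [h0, h1] at hne ⊢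
    · exact absurd rfl hne
    · exact htwo _ _
    · rw [ZeroOrMem.sub_comm_iff hG]; exact htwo _ _
    · exact absurd rfl hne
  | k + 3, f, g =>
    have hcard := Set.ncard_le_ncard (Set.range_subset_iff.2 hg) (Set.toFinite _)
    have hpair := Set.ncard_insert_le u {v}
    rw [Set.ncard_singleton] at hpair
    rw [← Set.image_univ, Set.ncard_image_of_injective _ hinj, Set.ncard_univ,
      Nat.card_fin] at hcard
    omega

end Connected

theorem IsLifting.minorsIn_of_isNearLift {O R X Y : Type*} [CommRing O] [CommRing R]
    {G : Subgroup Oˣ} {φ : O →+* R} [Finite X] (L : IsLifting G φ) {u v : Y} (huv : u ≠ v)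
    {A : Matrix X Y O} (h : IsNearLift G φ A u v) (hc : IsConnectedOn A {u, v}ᶜ) :
    MinorsIn G A := by
  intro k
  induction k generalizing A with
  | zero => intro f g; rw [det_fin_zero]; exact .one
  | succ k ih =>
  intro f g
  by_cases hf : Function.Injective f
  swap
  · rw [det_submatrix_eq_zero_of_not_injective_left _ _ hf]; exact .zero
  by_cases hg : Function.Injective g
  swap
  · rw [det_submatrix_eq_zero_of_not_injective_right _ _ hg]; exact .zero
  by_cases hpair : ∀ j, g j ∈ ({u, v} : Set Y)
  · refine zeroOrMem_det_of_mem_pair L.neg_one_mem (h.apply huv) (fun p q => ?_) f g hpair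
    obtain ⟨l, hl⟩ := hc.joined u p q
    exact L.zeroOrMem_of_joined huv l h hl
  push Not at hpair
  obtain ⟨j, hj⟩ := hpair
  by_cases hcol : ∀ i, A (f i) (g j) = 0
  · rw [det_eq_zero_of_column_eq_zero j hcol]; exact .zero
  push Not at hcol
  obtain ⟨i, hi⟩ := hcol
  have hunit := (h.apply huv (f i) (g j)).isUnit hi
  rw [det_eq_mul_det_pivot (A.submatrix f g) i j hunit, mul_assoc]
  refine .neg_one_pow_mul L.neg_one_mem _ ((h.apply huv _ _).mul ?_)
  convert ih (h.pivot L.neg_one_mem _ hj hunit) (hc.pivot hj hunit) (f ∘ i.succAbove)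
    (g ∘ j.succAbove) using 2
  ext r c
  rw [submatrix_apply, submatrix_apply, Function.comp_apply, Function.comp_apply,
    pivot_of_ne _ (Fin.succAbove_ne i r) (Fin.succAbove_ne j c),
    pivot_of_ne _ (hf.ne (Fin.succAbove_ne i r)) (hg.ne (Fin.succAbove_ne j c))]
  rfl

section Gluing

variable {R X Y : Type*} [CommRing R] {G : Subgroup Rˣ} {A : Matrix X Y R}

theorem MinorsIn.of_isEmpty [IsEmpty X] : MinorsIn G A := by
  intro k f g
  cases k with
  | zero => rw [det_isEmpty]; exact .one
  | succ k => exact isEmptyElim (f 0)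

theorem MinorsIn.of_column (hG : -1 ∈ G) (x : X) (y : Y) (h0 : ∀ i, i ≠ x → A i y = 0)
    (h1 : ZeroOrMem G (A x y)) (h : MinorsOn G A {y}ᶜ) : MinorsIn G A := by
  intro k f g
  by_cases hf : Function.Injective f
  swap
  · rw [det_submatrix_eq_zero_of_not_injective_left _ _ hf]; exact .zero
  by_cases hg : Function.Injective g
  swap
  · rw [det_submatrix_eq_zero_of_not_injective_right _ _ hg]; exact .zero
  by_cases hj : ∃ j, g j = y
  swap
  · exact h k f g fun j hj' => hj ⟨j, hj'⟩
  obtain ⟨j, rfl⟩ := hj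
  by_cases hi : ∃ i, f i = x
  swap
  · rw [det_eq_zero_of_column_eq_zero j fun i => h0 _ fun h => hi ⟨i, h⟩]
    exact .zero
  obtain ⟨i, rfl⟩ := hi
  cases k with
  | zero => exact i.elim0
  | succ k =>
    exact zeroOrMem_det_of_column hG _ i j (fun i' hi' => h0 _ (hf.ne hi')) h1
      (h k (f ∘ i.succAbove) (g ∘ j.succAbove) fun c => hg.ne (Fin.succAbove_ne _ _))

theorem MinorsIn.of_blocks (hG : -1 ∈ G) (S : Set X) (B : Set Y)
    (h0 : ∀ x y, A x y ≠ 0 → (x ∈ S ↔ y ∈ B))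
    (h1 : MinorsIn G (A.submatrix (Subtype.val : S → X) (Subtype.val : B → Y)))
    (h2 : MinorsIn G (A.submatrix (Subtype.val : (Sᶜ : Set X) → X)
      (Subtype.val : (Bᶜ : Set Y) → Y))) : MinorsIn G A := by
  classical
  intro k f g
  by_cases hσ : ∃ σ : Equiv.Perm (Fin k), ∀ i, f i ∈ S ↔ g (σ i) ∈ B
  · obtain ⟨σ, hσ⟩ := hσ
    rw [← ZeroOrMem.sign_mul_iff hG (Equiv.Perm.sign σ), ← det_permute' σ,
      twoBlockTriangular_det _ fun i => f i ∈ S]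
    · exact (h1.det (m := {i // f i ∈ S}) (fun i => ⟨f i.1, i.2⟩)
          (fun i => ⟨g (σ i.1), (hσ _).1 i.2⟩)).mul
        (h2.det (m := {i // ¬ f i ∈ S}) (fun i => ⟨f i.1, i.2⟩)
          (fun i => ⟨g (σ i.1), fun h => i.2 ((hσ _).2 h)⟩))
    · intro i hi j hj
      by_contra hne
      exact hi ((h0 _ _ hne).2 ((hσ j).1 hj))
  · push Not at hσ
    rw [det_apply', Finset.sum_eq_zero fun σ _ => ?_]
    · exact .zero
    · obtain ⟨i, hi⟩ := hσ σ⁻¹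
      rw [Finset.prod_eq_zero (Finset.mem_univ (σ⁻¹ i)), mul_zero]
      rw [submatrix_apply, show σ (σ⁻¹ i) = i from σ.apply_symm_apply i]
      by_contra hne
      have := h0 _ _ hne
      tauto

end Gluing

section ConnectedSet

variable {V : Type*} {adj : V → V → Prop}

/-- The set `S` induces a connected subgraph of the graph with adjacency relation `adj`, or is
empty. -/
def IsConnectedSet (adj : V → V → Prop) (S : Set V) : Prop :=
  ∀ C ⊆ S, C.Nonempty → (∀ a ∈ C, ∀ b ∈ S, adj a b → b ∈ C) → C = S

theorem IsConnectedSet.singleton (c : V) : IsConnectedSet adj {c} :=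
  fun _ hC hne _ => (Set.subset_singleton_iff_eq.1 hC).resolve_left hne.ne_empty

theorem IsConnectedSet.union_of_forall_exists_adj [Std.Symm adj] {K L : Set V}
    (hK : IsConnectedSet adj K) (hL : ∀ b ∈ L, ∃ a ∈ K, adj a b) :
    IsConnectedSet adj (K ∪ L) := by
  intro C hC hne hcl
  have hCK : (C ∩ K).Nonempty := by
    obtain ⟨c, hc⟩ := hne
    rcases hC hc with hcK | hcL
    · exact ⟨c, hc, hcK⟩
    · obtain ⟨a, ha, hac⟩ := hL c hcL
      exact ⟨a, hcl c hc a (Or.inl ha) (symm_of adj hac), ha⟩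
  have hKC : K ⊆ C := Set.inter_eq_right.1 <| hK _ Set.inter_subset_right hCK
    fun x hx y hy hxy => ⟨hcl x hx.1 y (Or.inl hy) hxy, hy⟩
  refine hC.antisymm (Set.union_subset hKC fun b hb => ?_)
  obtain ⟨a, ha, hab⟩ := hL b hb
  exact hcl a (hKC ha) b (Or.inr hb) hab

theorem IsConnectedSet.insert_of_adj [Std.Symm adj] {K : Set V} (hK : IsConnectedSet adj K)
    {a b : V} (ha : a ∈ K) (hab : adj a b) : IsConnectedSet adj (insert b K) := by
  rw [← Set.union_singleton]
  exact hK.union_of_forall_exists_adj fun _ hc => hc ▸ ⟨a, ha, hab⟩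

theorem IsConnectedSet.preimage {W : Type*} {S : Set V} (h : IsConnectedSet adj S) (e : W ≃ V) :
    IsConnectedSet (fun a b => adj (e a) (e b)) (e ⁻¹' S) := by
  intro C hC hne hcl
  rw [e.eq_preimage_iff_image_eq]
  refine h _ (Set.image_subset_iff.2 hC) (hne.image e) ?_
  rintro _ ⟨a, ha, rfl⟩ b hb hab
  exact ⟨e.symm b, hcl a ha _ (by simpa using hb) (by simpa using hab), e.apply_symm_apply b⟩

theorem IsConnectedSet.exists_adj_of_ne_univ (hc : IsConnectedSet adj Set.univ) {S : Set V}
    (hne : S.Nonempty) (hS : S ≠ Set.univ) : ∃ a ∈ S, ∃ b ∉ S, adj a b := by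
  by_contra! hno
  exact hS <| hc S (Set.subset_univ _) hne fun a ha b _ hab => by_contra fun hb => hno a ha b hb hab

theorem injective_update_of_notMem_range {ι : Type*} [DecidableEq ι] {l : ι → V}
    (hl : Function.Injective l) {b : V} (hb : b ∉ Set.range l) (i : ι) :
    Function.Injective (Function.update l i b) := by
  intro j k hjk
  rw [Function.update_apply, Function.update_apply] at hjk
  split_ifs at hjk with hj hk hk
  · exact hj.trans hk.symm
  · exact absurd ⟨k, hjk.symm⟩ hb
  · exact absurd ⟨j, hjk⟩ hb
  · exact hl hjk

/-- Grow `K` while keeping pendant vertices `l` outside: a new vertex either joins `K`, or replaces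
the pendant vertex to which it is adjacent while that one joins `K`. -/
theorem IsConnectedSet.exists_range_eq_compl [Finite V] {ι : Type*} [Std.Symm adj]
    (hc : IsConnectedSet adj Set.univ) {K : Set V} (hK : IsConnectedSet adj K) (hne : K.Nonempty)
    {l : ι → V} (hl : Function.Injective l) (hlK : ∀ i, l i ∉ K)
    (hadj : ∀ i, ∃ a ∈ K, adj a (l i)) :
    ∃ (K' : Set V) (m : ι → V), IsConnectedSet adj K' ∧ Function.Injective m ∧
      Set.range m = K'ᶜ ∧ ∀ i, ∃ a ∈ K', adj a (m i) := by
  classical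
  induction hn : Kᶜ.ncard using Nat.strong_induction_on generalizing K l with
  | _ n ih =>
  subst hn
  by_cases hall : K ∪ Set.range l = Set.univ
  · refine ⟨K, l, hK, hl, subset_antisymm (Set.range_subset_iff.2 hlK) ?_, hadj⟩
    exact fun b hb => (hall.ge (Set.mem_univ b)).resolve_left hb
  obtain ⟨a, ha, b, hb, hab⟩ :=
    hc.exists_adj_of_ne_univ (hne.mono Set.subset_union_left) hall
  obtain ⟨hbK, hbl⟩ := not_or.1 hb
  have hlt {c : V} (hcK : c ∉ K) : (insert c K)ᶜ.ncard < Kᶜ.ncard :=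
    Set.ncard_lt_ncard (compl_lt_compl_iff_lt.2 (Set.ssubset_insert hcK)) (Set.toFinite _)
  have hadj' (c : V) (i : ι) : ∃ a ∈ insert c K, adj a (l i) :=
    (hadj i).imp fun a ha => ⟨Or.inr ha.1, ha.2⟩
  rcases ha with ha | ⟨i, rfl⟩
  · refine ih _ (hlt hbK) (hK.insert_of_adj ha hab) (Set.insert_nonempty _ _) hl (fun i => ?_)
      (hadj' b) rfl
    exact not_or.2 ⟨fun h => hbl ⟨i, h⟩, hlK i⟩
  · obtain ⟨c, hcK, hci⟩ := hadj i
    refine ih _ (hlt (hlK i)) (hK.insert_of_adj hcK hci) (Set.insert_nonempty _ _)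
      (l := Function.update l i b) ?_ (fun j => ?_) (fun j => ?_) rfl
    · exact injective_update_of_notMem_range hl hbl i
    · rcases eq_or_ne j i with rfl | hj
      · rw [Function.update_self]
        exact not_or.2 ⟨fun h => hbl ⟨j, h.symm⟩, hbK⟩
      · rw [Function.update_of_ne hj]
        exact not_or.2 ⟨hl.ne hj, hlK j⟩
    · rcases eq_or_ne j i with rfl | hj
      · rw [Function.update_self]
        exact ⟨l j, Or.inl rfl, hab⟩
      · rw [Function.update_of_ne hj]
        exact hadj' _ j

theorem IsConnectedSet.exists_injective_compl_image [Finite V] {ι : Type*} [Std.Symm adj]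
    (hc : IsConnectedSet adj Set.univ) {c : V} {l : ι → V} (hl : Function.Injective l)
    (hlc : ∀ i, l i ≠ c) (hadj : ∀ i, adj c (l i)) :
    ∃ m : ι → V, Function.Injective m ∧ ∀ J : Set ι, IsConnectedSet adj (m '' J)ᶜ := by
  obtain ⟨K, m, hK, hm, hrange, hmK⟩ := hc.exists_range_eq_compl (.singleton c)
    (Set.singleton_nonempty c) hl hlc fun i => ⟨c, rfl, hadj i⟩
  refine ⟨m, hm, fun J => ?_⟩
  have hcompl : (m '' J)ᶜ = K ∪ m '' Jᶜ := by
    rw [← Set.image_univ] at hrange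
    rw [Set.image_compl_eq_range_sdiff_image hm, ← Set.image_univ, hrange]
    have : m '' J ⊆ Kᶜ := hrange ▸ Set.image_mono (Set.subset_univ J)
    ext x
    have := @this x
    simp only [Set.mem_compl_iff, Set.mem_union, Set.mem_sdiff] at this ⊢
    tauto
  rw [hcompl]
  refine hK.union_of_forall_exists_adj ?_
  rintro _ ⟨i, -, rfl⟩
  exact hmK i

end ConnectedSet

section MatrixGraph

variable {X Y R : Type*} [CommRing R] {A : Matrix X Y R}

/-- Adjacency in the bipartite graph of the nonzero entries of `A`, on the disjoint union of the
rows and the columns. -/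
def matrixAdj (A : Matrix X Y R) : X ⊕ Y → X ⊕ Y → Prop
  | Sum.inl x, Sum.inr y => A x y ≠ 0
  | Sum.inr y, Sum.inl x => A x y ≠ 0
  | _, _ => False

instance matrixAdj_symm : Std.Symm (matrixAdj A) where
  symm := by rintro (x | y) (x' | y') h <;> exact h

theorem matrixAdj_transpose : matrixAdj Aᵀ = fun a b => matrixAdj A a.swap b.swap := by
  funext a b
  rcases a with x | y <;> rcases b with x' | y' <;> rfl

theorem IsConnectedOn.isConnectedSet (h : IsConnectedOn A Set.univ) :
    IsConnectedSet (matrixAdj A) Set.univ := by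
  intro C _ hne hcl
  obtain ⟨hrow, hcol⟩ := h (Sum.inl ⁻¹' C) (Sum.inr ⁻¹' C) (Set.subset_univ _)
    (by
      obtain ⟨x | y, hc⟩ := hne
      exacts [Or.inl ⟨x, hc⟩, Or.inr ⟨y, hc⟩])
    (fun x y _ hxy => ⟨fun hx => hcl _ hx (Sum.inr y) trivial hxy,
      fun hy => hcl _ hy (Sum.inl x) trivial hxy⟩)
  refine Set.eq_univ_of_forall (Sum.rec (fun x => ?_) fun y => ?_)
  · exact Set.eq_univ_iff_forall.1 hrow x
  · exact Set.eq_univ_iff_forall.1 hcol y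

theorem IsConnectedSet.isConnectedOn {u v : Y}
    (h : IsConnectedSet (matrixAdj A) {Sum.inr u, Sum.inr v}ᶜ) : IsConnectedOn A {u, v}ᶜ := by
  intro S B hB hne hcl
  have hSB := h (Sum.inl '' S ∪ Sum.inr '' B) (by
      rintro _ (⟨x, _, rfl⟩ | ⟨y, hy, rfl⟩)
      · simp
      · simpa using hB hy)
    (by
      rcases hne with ⟨x, hx⟩ | ⟨y, hy⟩
      exacts [⟨_, Or.inl ⟨x, hx, rfl⟩⟩, ⟨_, Or.inr ⟨y, hy, rfl⟩⟩])
    (by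
      rintro _ (⟨x, hx, rfl⟩ | ⟨y, hy, rfl⟩) (x' | y') hb hab
      · exact hab.elim
      · exact Or.inr ⟨y', (hcl x y' (by simpa using hb) hab).1 hx, rfl⟩
      · exact Or.inl ⟨x', (hcl x' y (hB hy) hab).2 hy, rfl⟩
      · exact hab.elim)
  rw [Set.ext_iff] at hSB
  constructor
  · exact Set.eq_univ_of_forall fun x => by simpa using hSB (Sum.inl x)
  · ext y
    simpa using hSB (Sum.inr y)

theorem IsConnectedSet.isConnectedOn_transpose {u v : X}
    (h : IsConnectedSet (matrixAdj A) {Sum.inl u, Sum.inl v}ᶜ) : IsConnectedOn Aᵀ {u, v}ᶜ := by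
  refine IsConnectedSet.isConnectedOn ?_
  have hpre : Equiv.sumComm Y X ⁻¹' {Sum.inl u, Sum.inl v}ᶜ = {Sum.inr u, Sum.inr v}ᶜ :=
    Set.ext (Sum.rec (fun y => by simp) fun x => by simp)
  rw [matrixAdj_transpose, ← hpre]
  exact h.preimage _

end MatrixGraph

section Growth

variable {X Y R : Type*} [CommRing R] {A : Matrix X Y R} {T : Set Y} {w : Y}

/-- The rows that have a nonzero entry in one of the columns `T`. -/
def touchedRows (A : Matrix X Y R) (T : Set Y) : Set X := {x | ∃ y ∈ T, A x y ≠ 0}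

/-- Any two rows with a nonzero entry in the columns `T` are joined by a walk within `T`. Unlike
`IsConnectedOn`, this admits rows that vanish on `T`. -/
def RowsJoined (A : Matrix X Y R) (T : Set Y) : Prop :=
  ∀ p ∈ touchedRows A T, ∀ q ∈ touchedRows A T, ∃ k, Joined A T k p q

theorem RowsJoined.empty : RowsJoined A ∅ := fun _ ⟨_, hy, _⟩ => hy.elim

theorem RowsJoined.insert_column (h : RowsJoined A T)
    (hw : T = ∅ ∨ ∃ x ∈ touchedRows A T, A x w ≠ 0) : RowsJoined A (insert w T) := by
  have hsub : T ⊆ insert w T := Set.subset_insert _ _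
  have hwm : w ∈ insert w T := Set.mem_insert _ _
  have hmeet {p : X} (hp : p ∈ touchedRows A T) : ∃ x ∈ touchedRows A T, A x w ≠ 0 := by
    obtain ⟨y, hy, -⟩ := hp
    exact hw.resolve_left (Set.nonempty_iff_ne_empty.1 ⟨y, hy⟩)
  rintro p ⟨y, rfl | hy, hpy⟩ q ⟨z, rfl | hz, hqz⟩
  · exact ⟨_, (Joined.refl q z).cons hwm hpy hqz⟩
  · obtain ⟨x, hx, hxw⟩ := hmeet ⟨z, hz, hqz⟩
    obtain ⟨k, hk⟩ := h x hx q ⟨z, hz, hqz⟩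
    exact ⟨_, (hk.mono hsub).cons hwm hpy hxw⟩
  · obtain ⟨x, hx, hxw⟩ := hmeet ⟨y, hy, hpy⟩
    obtain ⟨k, hk⟩ := h p ⟨y, hy, hpy⟩ x hx
    exact ⟨_, (hk.mono hsub).trans ((Joined.refl q z).cons hwm hxw hqz)⟩
  · obtain ⟨k, hk⟩ := h p ⟨y, hy, hpy⟩ q ⟨z, hz, hqz⟩
    exact ⟨k, hk.mono hsub⟩

theorem IsConnectedOn.exists_mem_of_ssubset (h : IsConnectedOn A T) {S : Set Y} (hS : S ⊂ T) :
    ∃ w ∈ T, w ∉ S ∧ (S = ∅ ∨ ∃ x ∈ touchedRows A S, A x w ≠ 0) := by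
  by_contra! hno
  obtain ⟨w, hw, hwS⟩ := Set.exists_of_ssubset hS
  refine hS.ne (h (touchedRows A S) S hS.subset (Or.inr (hno w hw hwS).1) fun x y hy hxy =>
    ⟨fun hx => ?_, fun hyS => ⟨y, hyS, hxy⟩⟩).2
  by_contra hyS
  exact hxy ((hno y hy hyS).2 x hx)

theorem IsConnectedOn.induction_on {P : Set Y → Prop} (h : IsConnectedOn A T) (hT : T.Finite)
    (empty : P ∅) (insert : ∀ S ⊆ T, ∀ w ∈ T, w ∉ S →
      (S = ∅ ∨ ∃ x ∈ touchedRows A S, A x w ≠ 0) → P S → P (insert w S)) : P T := by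
  obtain ⟨S, hS⟩ := (hT.finite_subsets.subset fun S (hS : S ⊆ T ∧ P S) => hS.1).exists_maximal
    ⟨∅, Set.empty_subset T, empty⟩
  obtain ⟨hST, hPS⟩ := hS.prop
  rcases hST.eq_or_ssubset with rfl | hlt
  · exact hPS
  obtain ⟨w, hw, hwS, hmeet⟩ := h.exists_mem_of_ssubset hlt
  have hle := hS.le_of_ge (y := Insert.insert w S)
    ⟨Set.insert_subset hw hST, insert S hST w hw hwS hmeet hPS⟩ (Set.subset_insert w S)
  exact absurd (hle (Set.mem_insert w S)) hwS

end Growth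

section Scaling

variable {O R X Y : Type*} [CommRing O] [CommRing R] {G : Subgroup Oˣ} {φ : O →+* R}

/-- On the columns `T`, the matrix `A` arises from `B` by scaling the rows by `s` and the columns
by `t`, with factors in the group `K`. -/
structure IsScalingOn (K : Subgroup Oˣ) (T : Set Y) (A B : Matrix X Y O) (s : X → Oˣ)
    (t : Y → Oˣ) : Prop where
  row_mem : ∀ x, s x ∈ K
  col_mem : ∀ y, t y ∈ K
  eq : ∀ x, ∀ y ∈ T, A x y = s x * B x y * t y

/-- Rows that vanish on `T` may still be rescaled freely, so only the rows of `touchedRows A T`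
constrain the factor `τ` of the new column. -/
theorem IsScalingOn.exists_insert {K : Subgroup Oˣ} {T : Set Y} {A B : Matrix X Y O} {s : X → Oˣ}
    {t : Y → Oˣ} (h : IsScalingOn K T A B s t) {w : Y} (hw : w ∉ T)
    (hzero : ∀ x, ∀ y ∈ T, A x y = 0 → B x y = 0)
    (hρ : ∀ x, ∃ ρ ∈ K, A x w = ρ * B x w) {τ : Oˣ} (hτ : τ ∈ K)
    (hτw : ∀ x ∈ touchedRows A T, A x w = s x * B x w * τ) :
    ∃ s' t', IsScalingOn K (insert w T) A B s' t' := by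
  classical
  choose ρ hρ hρw using hρ
  refine ⟨fun x => if x ∈ touchedRows A T then s x else ρ x * τ⁻¹, Function.update t w τ,
    fun x => ?_, fun y => ?_, fun x y hy => ?_⟩
  · split_ifs
    exacts [h.row_mem x, K.mul_mem (hρ x) (K.inv_mem hτ)]
  · rcases eq_or_ne y w with rfl | hy
    · rwa [Function.update_self]
    · rw [Function.update_of_ne hy]
      exact h.col_mem y
  rcases hy with rfl | hy
  · rw [Function.update_self]
    split_ifs with hx
    · exact hτw x hx
    · rw [hρw, mul_right_comm, ← Units.val_mul, inv_mul_cancel_right]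
  · rw [Function.update_of_ne (ne_of_mem_of_not_mem hy hw)]
    split_ifs with hx
    · exact h.eq x y hy
    · have hxy : A x y = 0 := by_contra fun h0 => hx ⟨y, hy, h0⟩
      rw [hxy, hzero x y hy hxy, mul_zero, zero_mul]

theorem map_eq_one_of_mem_ker {g : Oˣ} (hg : g ∈ G ⊓ (imageUnit φ).ker) : φ g = 1 :=
  congrArg Units.val hg.2

namespace IsLifting

theorem exists_mem_ker_mul_eq (L : IsLifting G φ) {a b : O} (ha : ZeroOrMem G a)
    (hb : ZeroOrMem G b) (h : φ a = φ b) : ∃ ρ ∈ G ⊓ (imageUnit φ).ker, a = ρ * b := by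
  rcases hb with rfl | ⟨b, hb, rfl⟩
  · exact ⟨1, one_mem _, by rw [mul_zero, (L.map_eq_zero_iff ha).1 (h.trans (map_zero φ))]⟩
  rcases ha with rfl | ⟨a, ha, rfl⟩
  · refine ⟨1, one_mem _, ?_⟩
    rw [(L.map_eq_zero_iff (.of_mem hb)).1 (h.symm.trans (map_zero φ)), mul_zero]
  · have himage : imageUnit φ a = imageUnit φ b := Units.ext h
    refine ⟨a * b⁻¹, ⟨G.mul_mem ha (G.inv_mem hb), ?_⟩, ?_⟩
    · change imageUnit φ (a * b⁻¹) = 1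
      rw [map_mul, map_inv, himage, mul_inv_cancel]
    · rw [← Units.val_mul, inv_mul_cancel_right]

theorem exists_column_factor [Finite X] (L : IsLifting G φ) {T : Set Y} {w : Y} (hw : w ∉ T)
    {A B : Matrix X Y O} (hA : MinorsOn G A (insert w T)) (hB : MinorsOn G B (insert w T))
    (hφ : ∀ x, φ (A x w) = φ (B x w)) (hj : RowsJoined A T) {s : X → Oˣ} {t : Y → Oˣ}
    (hst : IsScalingOn (G ⊓ (imageUnit φ).ker) T A B s t) :
    ∃ τ ∈ G ⊓ (imageUnit φ).ker, ∀ x ∈ touchedRows A T, A x w = s x * B x w * τ := by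
  have hwm : w ∈ insert w T := Set.mem_insert w T
  by_cases hx₀ : ∃ x₀ ∈ touchedRows A T, A x₀ w ≠ 0
  swap
  · push Not at hx₀
    refine ⟨1, one_mem _, fun x hx => ?_⟩
    have hBw : B x w = 0 := by
      rw [← L.map_eq_zero_iff (hB.apply x hwm), ← hφ x, hx₀ x hx, map_zero]
    rw [hx₀ x hx, hBw, mul_zero, zero_mul]
  obtain ⟨x₀, hx₀, hx₀w⟩ := hx₀
  obtain ⟨ρ, hρ, hρw⟩ := L.exists_mem_ker_mul_eq (hA.apply x₀ hwm) (hB.apply x₀ hwm) (hφ x₀)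
  obtain ⟨b, hb⟩ := (hB.apply x₀ hwm).isUnit fun h => hx₀w (by rw [hρw, h, mul_zero])
  refine ⟨(s x₀)⁻¹ * ρ, mul_mem (inv_mem (hst.row_mem x₀)) hρ, fun x hx => ?_⟩
  obtain ⟨k, hk⟩ := hj x hx x₀ hx₀
  have hcross := L.mul_eq_mul_of_joined hw k A (Matrix.of fun x y => (s x : O) * B x y * t y) hA
    (hB.scale s t (fun x => (hst.row_mem x).1) fun y => (hst.col_mem y).1) hst.eq (fun x => by
      rw [of_apply, map_mul, map_mul, map_eq_one_of_mem_ker (hst.row_mem x),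
        map_eq_one_of_mem_ker (hst.col_mem w), one_mul, mul_one, hφ x]) hk
  rw [of_apply, of_apply, hρw, ← hb] at hcross
  refine ((s x₀ * b * t w).mul_left_inj).1 ?_
  push_cast
  linear_combination hcross -
    (ρ * s x * B x w * b * t w : O) * (s x₀).inv_mul

theorem exists_isScalingOn [Finite X] (L : IsLifting G φ) {T : Set Y} (hT : T.Finite)
    {A B : Matrix X Y O} (hA : MinorsOn G A T) (hB : MinorsOn G B T)
    (hφ : ∀ x, ∀ y ∈ T, φ (A x y) = φ (B x y)) (hc : IsConnectedOn A T) :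
    ∃ s t, IsScalingOn (G ⊓ (imageUnit φ).ker) T A B s t := by
  have hzero : ∀ x, ∀ y ∈ T, A x y = 0 → B x y = 0 := fun x y hy h => by
    rw [← L.map_eq_zero_iff (hB.apply x hy), ← hφ x y hy, h, map_zero]
  refine (hc.induction_on
    (P := fun S => RowsJoined A S ∧ ∃ s t, IsScalingOn (G ⊓ (imageUnit φ).ker) S A B s t) hT
    ⟨.empty, 1, 1, ⟨fun _ => one_mem _, fun _ => one_mem _, fun _ _ hy => hy.elim⟩⟩ ?_).2
  rintro S hST w hwT hwS hmeet ⟨hj, s, t, hst⟩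
  have hsub : insert w S ⊆ T := Set.insert_subset hwT hST
  obtain ⟨τ, hτ, hτw⟩ := L.exists_column_factor hwS (hA.mono hsub) (hB.mono hsub)
    (fun x => hφ x w hwT) hj hst
  exact ⟨hj.insert_column hmeet, hst.exists_insert hwS (fun x y hy => hzero x y (hST hy))
    (fun x => L.exists_mem_ker_mul_eq (hA.apply x hwT) (hB.apply x hwT) (hφ x w hwT)) hτ hτw⟩

end IsLifting

end Scaling

section Liftable

variable {O R X Y : Type*} [CommRing O] [CommRing R] {G : Subgroup Oˣ} {φ : O →+* R}
  {D : Matrix X Y R}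

/-- The matrix `D` is the image under `φ` of a matrix all of whose minors are zero or in `G`. -/
def Liftable (G : Subgroup Oˣ) (φ : O →+* R) (D : Matrix X Y R) : Prop :=
  ∃ A : Matrix X Y O, MinorsIn G A ∧ A.map φ = D

namespace Liftable

theorem transpose (h : Liftable G φ D) : Liftable G φ Dᵀ := by
  obtain ⟨A, hA, rfl⟩ := h
  exact ⟨Aᵀ, hA.transpose, rfl⟩

theorem submatrix (h : Liftable G φ D) {X' Y' : Type*} (f : X' → X) (g : Y' → Y) :
    Liftable G φ (D.submatrix f g) := by
  obtain ⟨A, hA, rfl⟩ := h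
  exact ⟨A.submatrix f g, hA.submatrix f g, rfl⟩

theorem of_submatrix {X' Y' : Type*} {f : X' → X} {g : Y' → Y} (hf : Function.Surjective f)
    (hg : Function.Surjective g) (h : Liftable G φ (D.submatrix f g)) : Liftable G φ D := by
  convert h.submatrix (Function.surjInv hf) (Function.surjInv hg)
  rw [submatrix_submatrix, (Function.rightInverse_surjInv hf).comp_eq_id,
    (Function.rightInverse_surjInv hg).comp_eq_id, submatrix_id_id]

theorem exists_minorsOn {T : Set Y} (h : Liftable G φ (D.submatrix id (Subtype.val : T → Y))) :
    ∃ A : Matrix X Y O, MinorsOn G A T ∧ ∀ x, ∀ y ∈ T, φ (A x y) = D x y := by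
  classical
  obtain ⟨A, hA, hAD⟩ := h
  refine ⟨Matrix.of fun x y => if hy : y ∈ T then A x ⟨y, hy⟩ else 0, ?_, fun x y hy => ?_⟩
  · rw [minorsOn_iff]
    convert hA using 1
    ext x y
    simp
  · rw [of_apply, dif_pos hy]
    exact congrFun (congrFun hAD x) ⟨y, hy⟩

end Liftable

namespace IsLifting

theorem exists_zeroOrMem (L : IsLifting G φ) {r : R} (hr : ZeroOrMem (⊤ : Subgroup Rˣ) r) :
    ∃ x : O, ZeroOrMem G x ∧ φ x = r := by
  rcases hr with rfl | ⟨r, -, rfl⟩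
  · exact ⟨0, .zero, map_zero φ⟩
  · obtain ⟨g, hg, rfl⟩ := L.surj r
    exact ⟨g, .of_mem hg, rfl⟩

theorem liftable_of_pivot [Finite X] (L : IsLifting G φ) {x : X} {y : Y} (hu : IsUnit (D x y))
    (h : Liftable G φ (pivot D x y)) : Liftable G φ D := by
  obtain ⟨ψ⟩ := L.ternary
  have := ψ.domain_nontrivial
  obtain ⟨A, hA, hAD⟩ := h
  have hunit : IsUnit (A x y) := by
    refine (hA.apply x y).isUnit fun h0 => hu.ringInverse.ne_zero ?_
    rw [← pivot_self, ← hAD, map_apply, h0, map_zero]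
  exact ⟨pivot A x y, hA.pivot L.neg_one_mem x y hunit, by
    rw [pivot_map φ _ _ _ hunit, hAD, pivot_pivot _ _ _ hu]⟩

theorem liftable_of_column (L : IsLifting G φ) (hD : MinorsIn (⊤ : Subgroup Rˣ) D) (x : X) (y : Y)
    (h0 : ∀ i, i ≠ x → D i y = 0)
    (h : Liftable G φ (D.submatrix id (Subtype.val : ({y}ᶜ : Set Y) → Y))) : Liftable G φ D := by
  classical
  obtain ⟨A, hA, hAD⟩ := h.exists_minorsOn
  obtain ⟨a, ha, hax⟩ := L.exists_zeroOrMem (hD.apply x y)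
  refine ⟨A.updateCol y (Pi.single x a), .of_column L.neg_one_mem x y ?_ ?_ ?_, ?_⟩
  · intro i hi
    rw [updateCol_self, Pi.single_eq_of_ne hi]
  · rwa [updateCol_self, Pi.single_eq_same]
  · exact hA.congr fun i j hj => (updateCol_ne hj).symm
  · ext i j
    rw [map_apply]
    by_cases hj : j = y
    · subst hj
      rw [updateCol_self]
      by_cases hi : i = x
      · rw [hi, Pi.single_eq_same, hax]
      · rw [Pi.single_eq_of_ne hi, map_zero, h0 i hi]
    · rw [updateCol_ne hj, hAD i j hj]

theorem liftable_of_blocks (L : IsLifting G φ) (S : Set X) (B : Set Y)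
    (h0 : ∀ x y, D x y ≠ 0 → (x ∈ S ↔ y ∈ B))
    (h1 : Liftable G φ (D.submatrix (Subtype.val : S → X) (Subtype.val : B → Y)))
    (h2 : Liftable G φ (D.submatrix (Subtype.val : (Sᶜ : Set X) → X)
      (Subtype.val : (Bᶜ : Set Y) → Y))) : Liftable G φ D := by
  classical
  obtain ⟨A₁, hA₁, hD₁⟩ := h1
  obtain ⟨A₂, hA₂, hD₂⟩ := h2
  let e := Equiv.Set.sumCompl S
  let e' := Equiv.Set.sumCompl B
  let A := (fromBlocks A₁ 0 0 A₂).submatrix e.symm e'.symm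
  have hA (i j) : A (e i) (e' j) = fromBlocks A₁ 0 0 A₂ i j :=
    congrArg₂ (fromBlocks A₁ 0 0 A₂) (e.symm_apply_apply i) (e'.symm_apply_apply j)
  refine ⟨A, .of_blocks L.neg_one_mem S B ?_ ?_ ?_, ?_⟩
  · rw [e.surjective.forall]
    intro i
    rw [e'.surjective.forall]
    intro j h
    rw [hA] at h
    rcases i with i | i <;> rcases j with j | j
    · exact iff_of_true i.2 j.2
    · exact absurd rfl h
    · exact absurd rfl h
    · exact iff_of_false i.2 j.2
  · convert hA₁
    exact Matrix.ext fun i j => hA (Sum.inl i) (Sum.inl j)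
  · convert hA₂
    exact Matrix.ext fun i j => hA (Sum.inr i) (Sum.inr j)
  · refine Matrix.ext (e.surjective.forall.2 fun i => e'.surjective.forall.2 fun j => ?_)
    rw [map_apply, hA]
    rcases i with i | i <;> rcases j with j | j
    · exact congrFun (congrFun hD₁ i) j
    · refine (map_zero φ).trans (by_contra fun h => j.2 ((h0 i j (Ne.symm h)).1 i.2))
    · refine (map_zero φ).trans (by_contra fun h => i.2 ((h0 i j (Ne.symm h)).2 j.2))
    · exact congrFun (congrFun hD₂ i) j

theorem liftable_of_two_columns [Finite X] [Finite Y] (L : IsLifting G φ)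
    (hD : MinorsIn (⊤ : Subgroup Rˣ) D) {u v : Y} (huv : u ≠ v) (hc : IsConnectedOn D {u, v}ᶜ)
    (hu : Liftable G φ (D.submatrix id (Subtype.val : ({u}ᶜ : Set Y) → Y)))
    (hv : Liftable G φ (D.submatrix id (Subtype.val : ({v}ᶜ : Set Y) → Y))) : Liftable G φ D := by
  classical
  obtain ⟨A₁, hA₁, hD₁⟩ := hu.exists_minorsOn
  obtain ⟨A₂, hA₂, hD₂⟩ := hv.exists_minorsOn
  have hTu : ({u, v}ᶜ : Set Y) ⊆ {u}ᶜ := Set.compl_subset_compl.2 (by simp)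
  have hTv : ({u, v}ᶜ : Set Y) ⊆ {v}ᶜ := Set.compl_subset_compl.2 (by simp)
  obtain ⟨s, t, hst⟩ := L.exists_isScalingOn (Set.toFinite _) (hA₁.mono hTu) (hA₂.mono hTv)
    (fun x y hy => by rw [hD₁ x y (hTu hy), hD₂ x y (hTv hy)])
    (hc.congr fun x y hy h h0 => h (by rw [← hD₁ x y (hTu hy), h0, map_zero]))
  let A := A₁.updateCol u fun x => s x * A₂ x u * t u
  have hAu (x) : A x u = s x * A₂ x u * t u := updateCol_self
  have hA (x) {y} (hy : y ≠ u) : A x y = A₁ x y := updateCol_ne hy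
  have hleft : MinorsOn G A {u}ᶜ := hA₁.congr fun x y hy => (hA x hy).symm
  have hright : MinorsOn G A {v}ᶜ :=
    (hA₂.scale s t (fun x => (hst.row_mem x).1) fun y => (hst.col_mem y).1).congr fun x y hy => by
      by_cases hyu : y = u
      · rw [hyu, hAu, of_apply]
      · rw [hA x hyu, of_apply, hst.eq x y (by simpa [hyu] using hy)]
  have hAD : A.map φ = D := by
    ext x y
    rw [map_apply]
    by_cases hyu : y = u
    · rw [hyu, hAu, map_mul, map_mul, map_eq_one_of_mem_ker (hst.row_mem x),
        map_eq_one_of_mem_ker (hst.col_mem u), one_mul, mul_one, hD₂ x u huv]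
    · rw [hA x hyu, hD₁ x y hyu]
  refine ⟨A, L.minorsIn_of_isNearLift huv ⟨hleft, hright, hAD ▸ hD⟩ ?_, hAD⟩
  exact hc.congr fun x y _ h h0 => h (by rw [← hAD, map_apply, h0, map_zero])

theorem exists_lift_two_by_two (L : IsLifting G φ) {a b c d : Rˣ}
    (h : ZeroOrMem (⊤ : Subgroup Rˣ) (a * d - b * c : R)) :
    ∃ a' ∈ G, ∃ b' ∈ G, ∃ c' ∈ G, ∃ d' ∈ G, imageUnit φ a' = a ∧ imageUnit φ b' = b ∧
      imageUnit φ c' = c ∧ imageUnit φ d' = d ∧ ZeroOrMem G (a' * d' - b' * c' : O) := by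
  rw [← isFundamental_cross_iff (G := ⊤) trivial trivial trivial trivial] at h
  obtain ⟨f, hf, hfr⟩ := L.lift _ h
  obtain ⟨a', ha, rfl⟩ := L.surj a
  obtain ⟨b', hb, rfl⟩ := L.surj b
  obtain ⟨d', hd, rfl⟩ := L.surj d
  have hc : b'⁻¹ * (f * d' * a') ∈ G :=
    G.mul_mem (G.inv_mem hb) (G.mul_mem (G.mul_mem hf.1 hd) ha)
  refine ⟨a', ha, b', hb, _, hc, d', hd, rfl, rfl, ?_, rfl, ?_⟩
  · rw [map_mul, map_mul, map_mul, map_inv, hfr, inv_mul_cancel_right, inv_mul_cancel_right,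
      inv_mul_cancel_left]
  · rw [← isFundamental_cross_iff ha hb hc hd, mul_inv_cancel_left, mul_inv_cancel_right,
      mul_inv_cancel_right]
    exact hf

theorem liftable_two_by_two (L : IsLifting G φ) {D : Matrix (Fin 2) (Fin 2) R}
    (hD : MinorsIn (⊤ : Subgroup Rˣ) D) (h0 : ∀ i j, D i j ≠ 0) : Liftable G φ D := by
  choose d hd using fun i j => (hD.apply i j).isUnit (h0 i j)
  have hdet : ZeroOrMem (⊤ : Subgroup Rˣ) (d 0 0 * d 1 1 - d 0 1 * d 1 0 : R) := by
    simpa only [hd] using (hD.minorsOn Set.univ).two 0 1 (u := 0) (v := 1) trivial trivial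
  obtain ⟨a, ha, b, hb, c, hc, e, he, hda, hdb, hdc, hde, h⟩ := L.exists_lift_two_by_two hdet
  have hswap : ZeroOrMem G (c * b - e * a : O) := by
    rw [ZeroOrMem.sub_comm_iff L.neg_one_mem, mul_comm (e : O), mul_comm (c : O)]
    exact h
  refine ⟨!![(a : O), b; c, e], fun k f g => zeroOrMem_det_of_mem_pair (u := 0) (v := 1)
    L.neg_one_mem ?_ ?_ f g fun i => ?_, ?_⟩
  · simpa only [Fin.forall_fin_two] using ⟨⟨.of_mem ha, .of_mem hb⟩, .of_mem hc, .of_mem he⟩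
  · simp only [Fin.forall_fin_two]
    refine ⟨⟨?_, h⟩, hswap, ?_⟩
    · convert ZeroOrMem.zero (G := G) using 1
      exact sub_eq_zero.2 (mul_comm _ _)
    · convert ZeroOrMem.zero (G := G) using 1
      exact sub_eq_zero.2 (mul_comm _ _)
  · generalize g i = j
    fin_cases j <;> simp
  · refine Matrix.ext ?_
    simp only [Fin.forall_fin_two, ← hd, ← hda, ← hdb, ← hdc, ← hde]
    exact ⟨⟨rfl, rfl⟩, rfl, rfl⟩

end IsLifting

end Liftable

section LiftTheorem

variable {O R X Y : Type*} [CommRing O] [CommRing R] {G : Subgroup Oˣ} {φ : O →+* R}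
  {D : Matrix X Y R}

/-- All matrices obtained from `D` by deleting a row or a column can be lifted. -/
structure DeletionsLiftable (G : Subgroup Oˣ) (φ : O →+* R) (D : Matrix X Y R) : Prop where
  column : ∀ y, Liftable G φ (D.submatrix id (Subtype.val : ({y}ᶜ : Set Y) → Y))
  row : ∀ x, Liftable G φ (D.submatrix (Subtype.val : ({x}ᶜ : Set X) → X) id)

namespace DeletionsLiftable

theorem transpose (h : DeletionsLiftable G φ D) : DeletionsLiftable G φ Dᵀ :=
  ⟨fun x => (h.row x).transpose, fun y => (h.column y).transpose⟩

theorem submatrix (h : DeletionsLiftable G φ D) {S : Set X} {B : Set Y}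
    (hSB : S ≠ Set.univ ∨ B ≠ Set.univ) :
    Liftable G φ (D.submatrix (Subtype.val : S → X) (Subtype.val : B → Y)) := by
  simp only [Set.ne_univ_iff_exists_notMem] at hSB
  rcases hSB with ⟨x, hx⟩ | ⟨y, hy⟩
  · have hsub : S ⊆ {x}ᶜ := Set.subset_compl_singleton_iff.2 hx
    exact (h.row x).submatrix (Set.inclusion hsub) Subtype.val
  · have hsub : B ⊆ {y}ᶜ := Set.subset_compl_singleton_iff.2 hy
    exact (h.column y).submatrix Subtype.val (Set.inclusion hsub)

end DeletionsLiftable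

theorem IsConnectedOn.transpose (h : IsConnectedOn D Set.univ) : IsConnectedOn Dᵀ Set.univ :=
  fun S B _ hne hcl => (h B S (Set.subset_univ _) hne.symm
    fun x y _ hxy => (hcl y x trivial hxy).symm).symm

theorem exists_eq_pair_of_mem_of_ncard_eq_two {V : Type*} {s : Set V} (h : s.ncard = 2) {a : V}
    (ha : a ∈ s) : ∃ b, b ≠ a ∧ s = {a, b} := by
  obtain ⟨b, c, hbc, rfl⟩ := Set.ncard_eq_two.1 h
  rcases ha with rfl | rfl
  · exact ⟨c, hbc.symm, rfl⟩
  · exact ⟨b, hbc, Set.pair_comm _ _⟩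

theorem two_lt_ncard_support_pivot [Finite Y] (hD : MinorsIn (⊤ : Subgroup Rˣ) D) {x x₀ : X}
    {y₀ y₁ y₂ : Y} (hx₀ : x₀ ≠ x) (hy₀ : y₀ ≠ y₁) (hy₂ : y₂ ≠ y₁) (hy₂₀ : y₂ ≠ y₀)
    (h₁ : D x y₁ ≠ 0) (h₂ : D x y₂ ≠ 0) (h₀ : D x y₀ = 0) (h₀₁ : D x₀ y₁ ≠ 0)
    (h₀₂ : D x₀ y₂ = 0) (h₀₀ : D x₀ y₀ ≠ 0) :
    2 < (Function.support (pivot D x y₁ x₀)).ncard := by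
  have : Nontrivial R := ⟨_, _, h₁⟩
  have hunit {i : X} {j : Y} : D i j ≠ 0 → IsUnit (D i j) := (hD.apply i j).isUnit
  refine (Set.two_lt_ncard_iff).2 ⟨y₁, y₂, y₀, ?_, ?_, ?_, hy₂.symm, hy₀.symm, hy₂₀⟩
  · rw [Function.mem_support, pivot_col _ _ hx₀]
    exact ((hunit h₀₁).mul (hunit h₁).ringInverse).neg.ne_zero
  · rw [Function.mem_support, pivot_of_ne _ hx₀ hy₂, h₀₂, zero_sub]
    exact (((hunit h₀₁).mul (hunit h₁).ringInverse).mul (hunit h₂)).neg.ne_zero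
  · rwa [Function.mem_support, pivot_of_ne _ hx₀ hy₀, h₀, mul_zero, sub_zero]

namespace IsLifting

/-- Of three vertices any two of which may be removed without disconnecting the graph of `D`, two
are columns or two are rows. -/
theorem liftable_of_two_lt_ncard_row [Finite X] [Finite Y] (L : IsLifting G φ)
    (hD : MinorsIn (⊤ : Subgroup Rˣ) D) (hc : IsConnectedOn D Set.univ)
    (hdel : DeletionsLiftable G φ D) {x : X} (hx : 2 < (Function.support (D x)).ncard) :
    Liftable G φ D := by
  obtain ⟨m, hm, hconn⟩ := hc.isConnectedSet.exists_injective_compl_image (c := Sum.inl x)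
    (l := fun y : Function.support (D x) => Sum.inr y.1)
    (Sum.inr_injective.comp Subtype.val_injective) (fun _ => Sum.inr_ne_inl) fun y => y.2
  have := Fintype.ofFinite (Function.support (D x))
  rw [← Nat.card_coe_set_eq, Nat.card_eq_fintype_card, ← Fintype.card_bool] at hx
  obtain ⟨i, j, hij, hside⟩ := Fintype.exists_ne_map_eq_of_card_lt (fun i => (m i).isLeft) hx
  have hij' := hm.ne hij
  have hpair := hconn {i, j}
  rw [Set.image_pair] at hpair
  generalize m i = p at hij' hside hpair
  generalize m j = q at hij' hside hpair
  rcases p with u | u <;> rcases q with v | v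
  · exact (L.liftable_of_two_columns hD.transpose (ne_of_apply_ne Sum.inl hij')
      hpair.isConnectedOn_transpose (hdel.transpose.column u)
      (hdel.transpose.column v)).transpose
  · exact absurd hside (by simp)
  · exact absurd hside (by simp)
  · exact L.liftable_of_two_columns hD (ne_of_apply_ne Sum.inr hij') hpair.isConnectedOn
      (hdel.column u) (hdel.column v)

theorem liftable_of_pair_univ (L : IsLifting G φ) (hD : MinorsIn (⊤ : Subgroup Rˣ) D) {p q : X}
    {u v : Y} (hX : ({p, q} : Set X) = Set.univ) (hY : ({u, v} : Set Y) = Set.univ)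
    (h0 : ∀ x y, D x y ≠ 0) : Liftable G φ D := by
  have hf : Function.Surjective ![p, q] := Set.range_eq_univ.1 (by simpa [Set.pair_comm q] using hX)
  have hg : Function.Surjective ![u, v] := Set.range_eq_univ.1 (by simpa [Set.pair_comm v] using hY)
  exact .of_submatrix hf hg (L.liftable_two_by_two (hD.submatrix _ _) fun _ _ => h0 _ _)

/-- A connected graph all of whose vertices have degree two is a cycle. If it has more than four
vertices, then pivoting creates a vertex of degree three. -/
theorem liftable_of_ncard_eq_two [Nonempty X] [Finite X] [Finite Y] (L : IsLifting G φ)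
    (hdel : ∀ D : Matrix X Y R, MinorsIn (⊤ : Subgroup Rˣ) D → DeletionsLiftable G φ D)
    (hD : MinorsIn (⊤ : Subgroup Rˣ) D) (hc : IsConnectedOn D Set.univ)
    (hrow : ∀ x, (Function.support (D x)).ncard = 2)
    (hcol : ∀ y, (Function.support (Dᵀ y)).ncard = 2) : Liftable G φ D := by
  obtain ⟨x⟩ := ‹Nonempty X›
  obtain ⟨y₁, y₂, hy₁₂, hx⟩ := Set.ncard_eq_two.1 (hrow x)
  have h₁ : y₁ ∈ Function.support (D x) := by simp [hx]
  have h₂ : y₂ ∈ Function.support (D x) := by simp [hx]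
  obtain ⟨x₀, hx₀, hy₁⟩ := exists_eq_pair_of_mem_of_ncard_eq_two (hcol y₁) (a := x) h₁
  have h₀₁ : x₀ ∈ Function.support (Dᵀ y₁) := by simp [hy₁]
  obtain ⟨y₀, hy₀, hx₀y⟩ := exists_eq_pair_of_mem_of_ncard_eq_two (hrow x₀) (a := y₁) h₀₁
  have h₀₀ : y₀ ∈ Function.support (D x₀) := by simp [hx₀y]
  by_cases h : y₂ = y₀
  · subst h
    have hy₂ : {x, x₀} = Function.support (Dᵀ y₂) :=
      Set.eq_of_subset_of_ncard_le (Set.pair_subset h₂ h₀₀)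
        (by rw [hcol, Set.ncard_pair hx₀.symm])
    have hrow' : ∀ p ∈ ({x, x₀} : Set X), Function.support (D p) = {y₁, y₂} := by
      rintro p (rfl | rfl)
      exacts [hx, hx₀y]
    have hcol' : ∀ q ∈ ({y₁, y₂} : Set Y), Function.support (Dᵀ q) = {x, x₀} := by
      rintro q (rfl | rfl)
      exacts [hy₁, hy₂.symm]
    obtain ⟨hX, hY⟩ := hc {x, x₀} {y₁, y₂} (Set.subset_univ _) (Or.inl (Set.insert_nonempty _ _))
      fun p q _ hpq => ⟨fun hp => hrow' p hp ▸ hpq, fun hq => hcol' q hq ▸ hpq⟩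
    refine L.liftable_of_pair_univ hD hX hY fun p q => ?_
    change q ∈ Function.support (D p)
    rw [hrow' p (hX ▸ trivial), hY]
    trivial
  · have h₀ : D x y₀ = 0 := by
      have : y₀ ∉ Function.support (D x) := by simp [hx, hy₀, Ne.symm h]
      rwa [Function.notMem_support] at this
    have h₀₂ : D x₀ y₂ = 0 := by
      have : y₂ ∉ Function.support (D x₀) := by simp [hx₀y, hy₁₂.symm, h]
      rwa [Function.notMem_support] at this
    have hunit := (hD.apply x y₁).isUnit h₁
    have hpivot := hD.pivot (G := ⊤) trivial x y₁ hunit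
    exact L.liftable_of_pivot hunit (L.liftable_of_two_lt_ncard_row hpivot (hc.pivot trivial hunit)
      (hdel _ hpivot) (two_lt_ncard_support_pivot hD hx₀ hy₀ hy₁₂.symm h h₁ h₂ h₀ h₀₁ h₀₂ h₀₀))

theorem liftable_of_deletionsLiftable [Finite X] [Finite Y] (L : IsLifting G φ)
    (hdel : ∀ D : Matrix X Y R, MinorsIn (⊤ : Subgroup Rˣ) D → DeletionsLiftable G φ D)
    (hD : MinorsIn (⊤ : Subgroup Rˣ) D) : Liftable G φ D := by
  rcases isEmpty_or_nonempty X with _ | _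
  · exact ⟨Matrix.of isEmptyElim, .of_isEmpty, Subsingleton.elim _ _⟩
  rcases isEmpty_or_nonempty Y with _ | _
  · exact .transpose (D := Dᵀ) ⟨Matrix.of isEmptyElim, .of_isEmpty, Subsingleton.elim _ _⟩
  by_cases hc : IsConnectedOn D Set.univ
  swap
  · simp only [IsConnectedOn, not_forall] at hc
    obtain ⟨S, B, -, hne, hcl, hSB⟩ := hc
    refine L.liftable_of_blocks S B (fun x y => hcl x y trivial) ((hdel D hD).submatrix ?_)
      ((hdel D hD).submatrix ?_)
    · tauto
    · simpa only [ne_eq, Set.compl_univ_iff, ← Set.nonempty_iff_ne_empty] using hne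
  by_cases hrow : ∃ x, (Function.support (D x)).ncard ≠ 2
  · obtain ⟨x, hx⟩ := hrow
    rcases hx.lt_or_gt with hx | hx
    · obtain ⟨y, hy⟩ := (Set.ncard_le_one_iff_subset_singleton (Set.toFinite _)).1
        (Nat.le_of_lt_succ hx)
      exact (L.liftable_of_column hD.transpose y x
        (fun j hj => by_contra fun h => hj (hy h)) ((hdel D hD).row x).transpose).transpose
    · exact L.liftable_of_two_lt_ncard_row hD hc (hdel D hD) hx
  by_cases hcol : ∃ y, (Function.support (Dᵀ y)).ncard ≠ 2
  · obtain ⟨y, hy⟩ := hcol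
    rcases hy.lt_or_gt with hy | hy
    · obtain ⟨x, hx⟩ := (Set.ncard_le_one_iff_subset_singleton (Set.toFinite _)).1
        (Nat.le_of_lt_succ hy)
      exact L.liftable_of_column hD x y (fun i hi => by_contra fun h => hi (hx h))
        ((hdel D hD).column y)
    · exact (L.liftable_of_two_lt_ncard_row hD.transpose hc.transpose (hdel D hD).transpose
        hy).transpose
  push Not at hrow hcol
  exact L.liftable_of_ncard_eq_two hdel hD hc hrow hcol

theorem liftable_of_card_eq (L : IsLifting G φ) (n : ℕ) :
    ∀ {X Y : Type*} [Finite X] [Finite Y], Nat.card X + Nat.card Y = n → ∀ {D : Matrix X Y R},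
      MinorsIn (⊤ : Subgroup Rˣ) D → Liftable G φ D := by
  induction n using Nat.strong_induction_on with
  | _ n ih =>
  intro X Y _ _ hn D hD
  refine L.liftable_of_deletionsLiftable (fun D hD => ⟨fun y => ?_, fun x => ?_⟩) hD
  · have : Nat.card ({y}ᶜ : Set Y) < Nat.card Y := Finite.card_subtype_lt (x := y) (by simp)
    exact ih _ (by lia) rfl (hD.submatrix _ _)
  · have : Nat.card ({x}ᶜ : Set X) < Nat.card X := Finite.card_subtype_lt (x := x) (by simp)
    exact ih _ (by lia) rfl (hD.submatrix _ _)

/-- The lift theorem of Pendavingh and Van Zwam. Only finitely many columns are distinct. -/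
theorem liftable [Finite R] [Finite X] (L : IsLifting G φ) (hD : MinorsIn (⊤ : Subgroup Rˣ) D) :
    Liftable G φ D := by
  have hcolumn : D = (D.submatrix id (Set.rangeSplitting Dᵀ)).submatrix id
      (Set.rangeFactorization Dᵀ) :=
    Matrix.ext fun x y => (congrFun (Set.apply_rangeSplitting Dᵀ (Set.rangeFactorization Dᵀ y))
      x).symm
  rw [hcolumn]
  have : Finite (Set.range Dᵀ) := inferInstanceAs (Finite (Set.range fun y x => D x y))
  exact (L.liftable_of_card_eq _ rfl (hD.submatrix _ _)).submatrix _ _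

theorem ringRepresentable [Finite R] (L : IsLifting G φ) {α : Type*} {M : Matroid α}
    (h : RingRepresentable (⊤ : Subgroup Rˣ) M) : RingRepresentable G M := by
  obtain ⟨r, D, hD, hM⟩ := h
  obtain ⟨A, hA, rfl⟩ := L.liftable hD
  exact ⟨r, A, hA, (represents_map_iff φ fun f => L.map_eq_zero_iff (hA r id f)).1 hM⟩

end IsLifting

end LiftTheorem

section NearRegularRing

open Polynomial

/-- The ring `ℤ[α, 1/α, 1/(1-α)]`, over which near-regular matroids are represented. -/
abbrev NearRegularRing : Type := Localization.Away (X * (1 - X) : ℤ[X])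

namespace NearRegularRing

theorem isUnit_algebraMap : IsUnit (algebraMap ℤ[X] NearRegularRing X) ∧
    IsUnit (algebraMap ℤ[X] NearRegularRing (1 - X)) := by
  rw [← IsUnit.mul_iff, ← map_mul]
  exact IsLocalization.Away.algebraMap_isUnit _

/-- The indeterminate `α`, as a unit. -/
noncomputable def alpha : NearRegularRingˣ := isUnit_algebraMap.1.unit

/-- The unit `1 - α`. -/
noncomputable def beta : NearRegularRingˣ := isUnit_algebraMap.2.unit

theorem alpha_add_beta : (alpha : NearRegularRing) + beta = 1 := by
  rw [alpha, beta, IsUnit.unit_spec, IsUnit.unit_spec, ← map_add, add_sub_cancel, map_one]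

/-- The group generated by `α`, `1 - α` and `-1`: the nonzero elements of the near-regular partial
field. -/
noncomputable def group : Subgroup NearRegularRingˣ := Subgroup.closure {alpha, beta, -1}

theorem alpha_mem : alpha ∈ group := Subgroup.subset_closure (by simp)

theorem beta_mem : beta ∈ group := Subgroup.subset_closure (by simp)

theorem neg_one_mem : -1 ∈ group := Subgroup.subset_closure (by simp)

theorem neg_mem {g : NearRegularRingˣ} (h : g ∈ group) : -g ∈ group := by
  simpa using group.mul_mem neg_one_mem h

/-- The element `s α^m (1 - α)^n` of the group. -/
noncomputable def monomial (s : ℤˣ) (m n : ℤ) : NearRegularRingˣ :=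
  imageUnit (Int.castRingHom _) s * alpha ^ m * beta ^ n

theorem monomial_mul (s t : ℤˣ) (m n k l : ℤ) :
    monomial s m n * monomial t k l = monomial (s * t) (m + k) (n + l) := by
  simp only [monomial, map_mul, _root_.zpow_add]
  ac_rfl

theorem monomial_inv (s : ℤˣ) (m n : ℤ) : (monomial s m n)⁻¹ = monomial s⁻¹ (-m) (-n) := by
  simp only [monomial, mul_inv, map_inv, _root_.zpow_neg]

theorem exists_eq_monomial {g : NearRegularRingˣ} (h : g ∈ group) :
    ∃ s m n, g = monomial s m n := by
  induction h using Subgroup.closure_induction with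
  | mem x hx =>
    rcases hx with rfl | rfl | rfl
    · exact ⟨1, 1, 0, by simp [monomial]⟩
    · exact ⟨1, 0, 1, by simp [monomial]⟩
    · exact ⟨-1, 0, 0, Units.ext (by simp [monomial])⟩
  | one => exact ⟨1, 0, 0, by simp [monomial]⟩
  | mul x y _ _ hx hy =>
    obtain ⟨s, m, n, rfl⟩ := hx
    obtain ⟨t, k, l, rfl⟩ := hy
    exact ⟨_, _, _, monomial_mul s t m n k l⟩
  | inv x _ hx =>
    obtain ⟨s, m, n, rfl⟩ := hx
    exact ⟨_, _, _, monomial_inv s m n⟩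

section Eval

variable {R : Type*} [CommRing R] (a : R) (ha : IsUnit a) (hb : IsUnit (1 - a))

/-- The ring homomorphism that maps the indeterminate `α` to `a`. -/
noncomputable def eval : NearRegularRing →+* R :=
  IsLocalization.Away.lift (X * (1 - X) : ℤ[X]) (g := eval₂RingHom (Int.castRingHom R) a)
    (by simpa using ⟨ha, hb⟩)

theorem eval_algebraMap (p : ℤ[X]) :
    eval a ha hb (algebraMap _ _ p) = eval₂RingHom (Int.castRingHom R) a p :=
  IsLocalization.Away.lift_eq _ _ _

theorem eval_alpha : eval a ha hb alpha = a := by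
  rw [alpha, IsUnit.unit_spec, eval_algebraMap]
  simp

theorem eval_beta : eval a ha hb beta = 1 - a := by
  rw [eq_sub_of_add_eq' alpha_add_beta, map_sub, map_one, eval_alpha]

end Eval

section EvalField

variable {K : Type*} [Field K] {c : K}

theorem eval_monomial (hc : c ≠ 0) (hc' : 1 - c ≠ 0) (s : ℤˣ) (m n : ℤ) :
    eval c hc.isUnit hc'.isUnit (monomial s m n) = ((s : ℤ) : K) * c ^ m * (1 - c) ^ n := by
  have heval : ∀ g : NearRegularRingˣ, eval c hc.isUnit hc'.isUnit g =
      (imageUnit (eval c hc.isUnit hc'.isUnit) g : Kˣ) := fun _ => rfl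
  rw [heval, monomial, map_mul, map_mul, map_zpow, map_zpow]
  simp [eval_alpha, eval_beta]

theorem add_eq_one_of_monomial (hc : c ≠ 0) (hc' : 1 - c ≠ 0) {s t : ℤˣ} {m n k l : ℤ}
    (h : (monomial t k l : NearRegularRing) = 1 - monomial s m n) :
    ((s : ℤ) : K) * c ^ m * (1 - c) ^ n + ((t : ℤ) : K) * c ^ k * (1 - c) ^ l = 1 := by
  rw [← eval_monomial hc hc' s, ← eval_monomial hc hc' t, h, ← map_add, add_sub_cancel, map_one]

end EvalField

end NearRegularRing

end NearRegularRing

section PowersOfTwo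

theorem eq_of_two_zpow_add_eq {m n k : ℤ} (h : (2 : ℚ) ^ m + 2 ^ n = 2 ^ k) :
    m = n ∧ k = n + 1 := by
  wlog hmn : m ≤ n generalizing m n
  · obtain ⟨rfl, hk⟩ := this (by rwa [add_comm]) (by omega)
    exact ⟨rfl, hk⟩
  have hnk : n + 1 ≤ k := by
    have : (2 : ℚ) ^ n < 2 ^ k := by rw [← h]; exact lt_add_of_pos_left _ (by positivity)
    exact (zpow_lt_zpow_iff_right₀ one_lt_two).1 this
  have htwo : (2 : ℚ) ^ n + 2 ^ n = 2 ^ (n + 1) := by rw [zpow_add_one₀ two_ne_zero]; ring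
  have hle : (2 : ℚ) ^ m ≤ 2 ^ n := zpow_le_zpow_right₀ one_le_two hmn
  have hle' : (2 : ℚ) ^ (n + 1) ≤ 2 ^ k := zpow_le_zpow_right₀ one_le_two hnk
  have hinj := zpow_right_injective₀ (two_pos (α := ℚ)) (by norm_num)
  exact ⟨hinj (by dsimp only; linarith), hinj (by dsimp only; linarith)⟩

theorem exponent_of_signed_two_zpow_add_eq_one {n k : ℤ} {s t : ℤˣ}
    (h : ((s : ℤ) : ℚ) * 2 ^ n + ((t : ℤ) : ℚ) * 2 ^ k = 1) :
    (n = 0 ∧ s = -1) ∨ (n = 1 ∧ s = 1) ∨ (n = -1 ∧ s = 1) := by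
  rcases Int.units_eq_one_or s with rfl | rfl <;> rcases Int.units_eq_one_or t with rfl | rfl <;>
    push_cast at h
  · obtain ⟨rfl, hn⟩ := eq_of_two_zpow_add_eq (m := n) (n := k) (k := 0) (by linear_combination h)
    exact Or.inr (Or.inr ⟨by omega, rfl⟩)
  · obtain ⟨rfl, hn⟩ := eq_of_two_zpow_add_eq (m := k) (n := 0) (k := n) (by linear_combination -h)
    exact Or.inr (Or.inl ⟨by omega, rfl⟩)
  · obtain ⟨rfl, -⟩ := eq_of_two_zpow_add_eq (m := n) (n := 0) (k := k) (by linear_combination -h)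
    exact Or.inl ⟨rfl, rfl⟩
  · have hn : (0 : ℚ) < 2 ^ n := by positivity
    have hk : (0 : ℚ) < 2 ^ k := by positivity
    linarith

theorem cast_units_mul_neg_one_zpow (s : ℤˣ) (m : ℤ) :
    ((s : ℤ) : ℚ) * (-1) ^ m = (((s * (-1) ^ m : ℤˣ) : ℤ) : ℚ) := by
  rcases Int.even_or_odd m with h | h <;> simp [h.neg_one_zpow]

end PowersOfTwo

section Associates

variable {R : Type*} [CommRing R]

/-- The six associates of an element `p` of a ring, in terms of `p` and `q = 1 - p`. They are the
elements that must be fundamental as soon as `p` is. -/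
def associates (p q : Rˣ) : List Rˣ := [p, q, p⁻¹, q⁻¹, -(p * q⁻¹), -(q * p⁻¹)]

namespace NearRegularRing

/-- Evaluation at `-1`, `2` and `1/2` turns `f + g = 1` into equations between powers of two. -/
theorem exponents_of_monomial_eq_one_sub {s t : ℤˣ} {m n k l : ℤ}
    (h : (monomial t k l : NearRegularRing) = 1 - monomial s m n) :
    (m, n, s) ∈ ({(0, 0, -1), (1, 0, 1), (0, 1, 1), (-1, 0, 1), (0, -1, 1), (1, -1, -1),
      (-1, 1, -1)} : Set (ℤ × ℤ × ℤˣ)) := by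
  have h₁ := add_eq_one_of_monomial (c := (-1 : ℚ)) (by norm_num) (by norm_num) h
  have h₂ := add_eq_one_of_monomial (c := (2 : ℚ)) (by norm_num) (by norm_num) h
  have h₃ := add_eq_one_of_monomial (c := (2⁻¹ : ℚ)) (by norm_num) (by norm_num) h
  rw [show (1 - -1 : ℚ) = 2 by norm_num, cast_units_mul_neg_one_zpow,
    cast_units_mul_neg_one_zpow] at h₁
  rw [show (1 - 2 : ℚ) = -1 by norm_num, mul_right_comm, mul_right_comm _ (2 ^ k),
    cast_units_mul_neg_one_zpow, cast_units_mul_neg_one_zpow] at h₂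
  rw [show (1 - 2⁻¹ : ℚ) = 2⁻¹ by norm_num, mul_assoc, mul_assoc, ← zpow_add₀ (by norm_num),
    ← zpow_add₀ (by norm_num), _root_.inv_zpow', _root_.inv_zpow'] at h₃
  rcases exponent_of_signed_two_zpow_add_eq_one h₁ with ⟨rfl, h₁⟩ | ⟨rfl, h₁⟩ | ⟨rfl, h₁⟩ <;>
    rcases exponent_of_signed_two_zpow_add_eq_one h₂ with ⟨rfl, h₂⟩ | ⟨rfl, h₂⟩ | ⟨rfl, h₂⟩ <;>
    rcases exponent_of_signed_two_zpow_add_eq_one h₃ with ⟨h₀, rfl⟩ | ⟨h₀, rfl⟩ | ⟨h₀, rfl⟩ <;>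
    first | omega | simp

theorem mem_associates {f : NearRegularRingˣ} (hf : IsFundamental group f) (h1 : f ≠ 1) :
    f = -1 ∨ f ∈ associates alpha beta := by
  obtain ⟨g, hg, hgf⟩ := hf.2.exists_of_ne (sub_ne_zero.2 fun h => h1 (Units.ext h.symm))
  obtain ⟨s, m, n, rfl⟩ := exists_eq_monomial hf.1
  obtain ⟨t, k, l, rfl⟩ := exists_eq_monomial hg
  have hcases := exponents_of_monomial_eq_one_sub hgf
  simp only [Set.mem_insert_iff, Set.mem_singleton_iff, Prod.mk.injEq] at hcases
  have hneg : imageUnit (Int.castRingHom NearRegularRing) (-1) = -1 := Units.ext (by simp)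
  rcases hcases with h | h | h | h | h | h | h <;> obtain ⟨rfl, rfl, rfl⟩ := h <;>
    simp [monomial, associates, hneg, mul_comm]

end NearRegularRing

end Associates

section ExceptionalUnits

variable {R : Type*} [CommRing R] {K : Type*} [Field K]

/-- The set of units `x` of `R` for which `1 - x` is a unit. -/
def exceptionalUnits (R : Type*) [CommRing R] : Set R := {x | IsUnit x ∧ IsUnit (1 - x)}

/-- Every unit of `R` is, up to sign, a product of two exceptional units. -/
def UnitsGenerated (R : Type*) [CommRing R] : Prop :=
  ∀ u : Rˣ, ∃ s ∈ exceptionalUnits R, ∃ t ∈ exceptionalUnits R,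
    (u : R) = s * t ∨ (u : R) = -(s * t)

theorem exceptionalUnits_prod (R S : Type*) [CommRing R] [CommRing S] :
    exceptionalUnits (R × S) = exceptionalUnits R ×ˢ exceptionalUnits S := by
  ext ⟨x, y⟩
  simp only [exceptionalUnits, Set.mem_ofPred_eq, Set.mem_prod, Prod.isUnit_iff, Prod.fst_sub,
    Prod.snd_sub, Prod.fst_one, Prod.snd_one]
  tauto

theorem mem_exceptionalUnits {x : K} : x ∈ exceptionalUnits K ↔ x ≠ 0 ∧ x ≠ 1 := by
  rw [exceptionalUnits, Set.mem_ofPred_eq, isUnit_iff_ne_zero, isUnit_iff_ne_zero, sub_ne_zero,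
    ne_comm (a := (1 : K))]

theorem ncard_exceptionalUnits (K : Type*) [Field K] [Finite K] :
    (exceptionalUnits K).ncard = Nat.card K - 2 := by
  have hcompl : exceptionalUnits K = ({0, 1} : Set K)ᶜ := by
    ext x
    simp [mem_exceptionalUnits]
  rw [hcompl, Set.ncard_compl, Set.ncard_pair zero_ne_one]

theorem exceptionalUnits_nonempty (h : 3 ≤ ENat.card K) : (exceptionalUnits K).Nonempty := by
  obtain ⟨x, hx⟩ := ENat.exists_ne_ne_of_three_le h 0 1
  exact ⟨x, mem_exceptionalUnits.2 hx⟩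

theorem exists_exceptionalUnits_mul_eq (h : 4 ≤ ENat.card K) {v : K} (hv : v ≠ 0) :
    ∃ s ∈ exceptionalUnits K, ∃ t ∈ exceptionalUnits K, s * t = v := by
  have hfour : 4 ≤ Cardinal.mk K := by simpa [ENat.card] using h
  obtain ⟨s, hs⟩ := Cardinal.exists_notMem_of_length_lt [0, 1, v]
    (lt_of_lt_of_le (by norm_num) hfour)
  simp only [List.mem_cons, List.not_mem_nil, or_false, not_or] at hs
  obtain ⟨hs0, hs1, hsv⟩ := hs
  refine ⟨s, mem_exceptionalUnits.2 ⟨hs0, hs1⟩, v / s, mem_exceptionalUnits.2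
    ⟨div_ne_zero hv hs0, ?_⟩, mul_div_cancel₀ v hs0⟩
  rw [Ne, div_eq_one_iff_eq hs0]
  exact Ne.symm hsv

theorem UnitsGenerated.prod (hR : UnitsGenerated R) (h : 4 ≤ ENat.card K) :
    UnitsGenerated (R × K) := by
  intro u
  obtain ⟨⟨u₁, hu₁⟩, hu₂⟩ := Prod.isUnit_iff.1 u.isUnit
  obtain ⟨s, hs, t, ht, hst⟩ := hR u₁
  rw [exceptionalUnits_prod]
  rcases hst with hst | hst
  · obtain ⟨x, hx, y, hy, hxy⟩ := exists_exceptionalUnits_mul_eq h hu₂.ne_zero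
    exact ⟨(s, x), ⟨hs, hx⟩, (t, y), ⟨ht, hy⟩, Or.inl (Prod.ext (hu₁ ▸ hst) hxy.symm)⟩
  · obtain ⟨x, hx, y, hy, hxy⟩ := exists_exceptionalUnits_mul_eq h (neg_ne_zero.2 hu₂.ne_zero)
    exact ⟨(s, x), ⟨hs, hx⟩, (t, y), ⟨ht, hy⟩, Or.inr (Prod.ext (hu₁ ▸ hst)
      (neg_eq_iff_eq_neg.1 hxy.symm))⟩

theorem neg_one_mem_exceptionalUnits (h : (2 : K) ≠ 0) : -1 ∈ exceptionalUnits K :=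
  mem_exceptionalUnits.2 ⟨neg_ne_zero.2 one_ne_zero, fun e => h (by linear_combination -e)⟩

theorem UnitsGenerated.of_hom_zmod_three (ψ : K →+* ZMod 3) : UnitsGenerated K := by
  have hψ2 : ψ 2 = 2 := map_ofNat ψ 2
  have hneg : -1 ∈ exceptionalUnits K := neg_one_mem_exceptionalUnits fun h => by
    rw [h, map_zero] at hψ2
    exact absurd hψ2 (by decide)
  refine fun u => ⟨-1, hneg, -1, hneg, ?_⟩
  rw [neg_one_mul, neg_neg]
  rcases eq_one_or_neg_one_of_isUnit ψ u.isUnit with h | h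
  · exact Or.inl (ψ.injective (by rw [h, map_one]))
  · exact Or.inr (ψ.injective (by rw [h, map_neg, map_one]))

end ExceptionalUnits

section AssociatesCard

variable {R : Type*} [CommRing R] {p q : Rˣ}

theorem associates_nodup (h : (p : R) + q = 1) (h2 : ¬ IsUnit (2 : R)) (hpq : (p : R) * q ≠ 1) :
    (associates p q).Nodup := by
  have two_mul_ne : ∀ (x : R) (u : Rˣ), 2 * x ≠ u := fun x u hx =>
    h2 (isUnit_of_mul_isUnit_left (hx ▸ u.isUnit))
  have hne : (p : R) ≠ q := fun e => two_mul_ne p 1 (by push_cast; linear_combination h + e)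
  have hp : (p : R) + 1 ≠ 0 := fun e => two_mul_ne 1 q (by linear_combination e - h)
  have hq : (q : R) + 1 ≠ 0 := fun e => two_mul_ne 1 p (by linear_combination e - h)
  clear two_mul_ne
  have hpinv := p.mul_inv
  have hqinv := q.mul_inv
  simp only [associates, List.nodup_cons, List.mem_cons, List.not_mem_nil, Units.ext_iff, not_or,
    Units.val_mul, Units.val_neg, or_false, not_false_eq_true, List.nodup_nil, and_true]
  generalize (p : R) = p, ((p⁻¹ : Rˣ) : R) = p', (q : R) = q, ((q⁻¹ : Rˣ) : R) = q' at *
  refine ⟨⟨?_, ?_, ?_, ?_, ?_⟩, ⟨?_, ?_, ?_, ?_⟩, ⟨?_, ?_, ?_⟩, ⟨?_, ?_⟩, ?_⟩ <;> intro e <;> grind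

theorem exists_mem_associates_eq_one_sub (h : (p : R) + q = 1) {u : Rˣ}
    (hu : u ∈ associates p q) : ∃ v ∈ associates p q, (v : R) = 1 - u := by
  have hp := p.mul_inv
  have hq := q.mul_inv
  simp only [associates, List.mem_cons, List.not_mem_nil, or_false] at hu
  rcases hu with rfl | rfl | rfl | rfl | rfl | rfl
  · exact ⟨q, by simp [associates], by linear_combination h⟩
  · exact ⟨p, by simp [associates], by linear_combination h⟩
  · exact ⟨-(q * p⁻¹), by simp [associates], by
      push_cast; linear_combination hp - (p⁻¹ : Rˣ) * h⟩
  · exact ⟨-(p * q⁻¹), by simp [associates], by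
      push_cast; linear_combination hq - (q⁻¹ : Rˣ) * h⟩
  · exact ⟨q⁻¹, by simp [associates], by push_cast; linear_combination hq - (q⁻¹ : Rˣ) * h⟩
  · exact ⟨p⁻¹, by simp [associates], by push_cast; linear_combination hp - (p⁻¹ : Rˣ) * h⟩

theorem exists_mem_associates_eq [Finite R] (h : (p : R) + q = 1) (h2 : ¬ IsUnit (2 : R))
    (hpq : (p : R) * q ≠ 1) (hcard : (exceptionalUnits R).ncard ≤ 6) {x : R}
    (hx : x ∈ exceptionalUnits R) : ∃ u ∈ associates p q, (u : R) = x := by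
  classical
  have hsub : Units.val '' {u | u ∈ associates p q} ⊆ exceptionalUnits R := by
    rintro _ ⟨u, hu, rfl⟩
    obtain ⟨v, -, hv⟩ := exists_mem_associates_eq_one_sub h hu
    exact ⟨u.isUnit, hv ▸ v.isUnit⟩
  have hsix : (Units.val '' {u | u ∈ associates p q}).ncard = 6 := by
    rw [Set.ncard_image_of_injective _ Units.val_injective, ← List.coe_toFinset,
      Set.ncard_coe_finset, List.toFinset_card_of_nodup (associates_nodup h h2 hpq)]
    rfl
  rwa [← Set.eq_of_subset_of_ncard_le hsub (by omega) (Set.toFinite _)] at hx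

theorem map_imageUnit_associates {S : Type*} [CommRing S] (φ : R →+* S) (p q : Rˣ) :
    (associates p q).map (imageUnit φ) = associates (imageUnit φ p) (imageUnit φ q) := by
  have hneg : ∀ g, imageUnit φ (-g) = -imageUnit φ g := fun g => Units.ext (map_neg φ (g : R))
  simp only [associates, List.map_cons, List.map_nil, hneg, map_inv, map_mul]

end AssociatesCard

section LiftingToNearRegular

namespace NearRegularRing

theorem mem_group_of_mem_associates {g : NearRegularRingˣ} (hg : g ∈ associates alpha beta) :
    g ∈ group := by
  simp only [associates, List.mem_cons, List.not_mem_nil, or_false] at hg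
  rcases hg with rfl | rfl | rfl | rfl | rfl | rfl
  exacts [alpha_mem, beta_mem, inv_mem alpha_mem, inv_mem beta_mem,
    neg_mem (mul_mem alpha_mem (inv_mem beta_mem)), neg_mem (mul_mem beta_mem (inv_mem alpha_mem))]

theorem isFundamental_of_mem_associates {g : NearRegularRingˣ}
    (hg : g ∈ associates alpha beta) : IsFundamental group g := by
  obtain ⟨h, hh, hgh⟩ := exists_mem_associates_eq_one_sub alpha_add_beta hg
  exact ⟨mem_group_of_mem_associates hg, hgh ▸ .of_mem (mem_group_of_mem_associates hh)⟩

variable {R : Type*} [CommRing R]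

theorem mem_associates_of_not_isUnit_two (φ : NearRegularRing →+* R) (h2 : ¬ IsUnit (2 : R))
    {f : NearRegularRingˣ} (hf : IsFundamental group f) (h1 : f ≠ 1) :
    f ∈ associates alpha beta := by
  refine (mem_associates hf h1).resolve_left ?_
  rintro rfl
  obtain ⟨g, -, hg⟩ := hf.2.exists_of_ne (sub_ne_zero.2 fun h => h1 (Units.ext h.symm))
  have hg2 : (imageUnit φ g : R) = 2 := by
    change φ g = 2
    rw [hg, Units.val_neg, Units.val_one, sub_neg_eq_add, one_add_one_eq_two, map_ofNat]
  exact h2 (hg2 ▸ (imageUnit φ g).isUnit)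

variable {a : R} (ha : IsUnit a) (hb : IsUnit (1 - a))

theorem map_imageUnit_eval_associates :
    (associates alpha beta).map (imageUnit (eval a ha hb)) = associates ha.unit hb.unit := by
  rw [map_imageUnit_associates]
  congr 1
  · exact Units.ext (eval_alpha a ha hb)
  · exact Units.ext (eval_beta a ha hb)

theorem exists_mem_associates_eval_eq [Finite R] (h2 : ¬ IsUnit (2 : R)) (hab : a * (1 - a) ≠ 1)
    (hcard : (exceptionalUnits R).ncard ≤ 6) {x : R} (hx : x ∈ exceptionalUnits R) :
    ∃ g ∈ associates alpha beta, eval a ha hb g = x := by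
  obtain ⟨u, hu, rfl⟩ := exists_mem_associates_eq (p := ha.unit) (q := hb.unit)
    (by simp) h2 hab hcard hx
  rw [← map_imageUnit_eval_associates, List.mem_map] at hu
  obtain ⟨g, hg, rfl⟩ := hu
  exact ⟨g, hg, rfl⟩

theorem imageUnit_eval_injOn_isFundamental [Nontrivial R] (h2 : ¬ IsUnit (2 : R))
    (hab : a * (1 - a) ≠ 1) {f f' : NearRegularRingˣ} (hf : IsFundamental group f)
    (hf' : IsFundamental group f')
    (hff' : imageUnit (eval a ha hb) f = imageUnit (eval a ha hb) f') : f = f' := by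
  by_cases h1 : f = 1
  · rw [h1, map_one] at hff'
    rw [h1, hf'.eq_one_of_imageUnit_eq_one hff'.symm]
  by_cases h1' : f' = 1
  · rw [h1', map_one] at hff'
    exact absurd (hf.eq_one_of_imageUnit_eq_one hff') h1
  have hnodup : ((associates alpha beta).map (imageUnit (eval a ha hb))).Nodup := by
    rw [map_imageUnit_eval_associates]
    exact associates_nodup (by simp) h2 hab
  exact List.inj_on_of_nodup_map hnodup (mem_associates_of_not_isUnit_two (eval a ha hb) h2 hf h1)
    (mem_associates_of_not_isUnit_two (eval a ha hb) h2 hf' h1') hff'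

theorem exists_isFundamental_eval_eq [Finite R] (h2 : ¬ IsUnit (2 : R)) (hab : a * (1 - a) ≠ 1)
    (hcard : (exceptionalUnits R).ncard ≤ 6) {r : Rˣ} (hr : IsFundamental ⊤ r) :
    ∃ f, IsFundamental group f ∧ imageUnit (eval a ha hb) f = r := by
  by_cases h1 : r = 1
  · exact ⟨1, .one, by rw [h1, map_one]⟩
  have hr1 : (1 : R) - r ≠ 0 := sub_ne_zero.2 fun h => h1 (Units.ext h.symm)
  obtain ⟨g, hg, hgr⟩ :=
    exists_mem_associates_eval_eq ha hb h2 hab hcard ⟨r.isUnit, hr.2.isUnit hr1⟩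
  exact ⟨g, isFundamental_of_mem_associates hg, Units.ext hgr⟩

theorem exists_mem_group_eval_eq [Finite R] (h2 : ¬ IsUnit (2 : R)) (hab : a * (1 - a) ≠ 1)
    (hcard : (exceptionalUnits R).ncard ≤ 6) (hunit : UnitsGenerated R) (r : Rˣ) :
    ∃ g ∈ group, imageUnit (eval a ha hb) g = r := by
  obtain ⟨s, hs, t, ht, hst⟩ := hunit r
  obtain ⟨g, hg, rfl⟩ := exists_mem_associates_eval_eq ha hb h2 hab hcard hs
  obtain ⟨g', hg', rfl⟩ := exists_mem_associates_eval_eq ha hb h2 hab hcard ht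
  have hgg' := mul_mem (mem_group_of_mem_associates hg) (mem_group_of_mem_associates hg')
  rcases hst with hst | hst
  · exact ⟨g * g', hgg', Units.ext (by simp [hst])⟩
  · exact ⟨-(g * g'), neg_mem hgg', Units.ext (by simp [hst])⟩

theorem isLifting_eval [Finite R] (ψ : R →+* ZMod 3) (h2 : ¬ IsUnit (2 : R))
    (hab : a * (1 - a) ≠ 1) (hcard : (exceptionalUnits R).ncard ≤ 6) (hunit : UnitsGenerated R) :
    IsLifting group (eval a ha hb) where
  neg_one_mem := neg_one_mem
  surj := exists_mem_group_eval_eq ha hb h2 hab hcard hunit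
  lift _ := exists_isFundamental_eval_eq ha hb h2 hab hcard
  fundamental_inj _ hf _ hf' := by
    have := ψ.domain_nontrivial
    exact imageUnit_eval_injOn_isFundamental ha hb h2 hab hf hf'
  ternary := ⟨ψ⟩
  not_isUnit_two := h2

end NearRegularRing

end LiftingToNearRegular

section Ternary

open NearRegularRing

theorem enatCard_galoisField (p : ℕ) [Fact p.Prime] {n : ℕ} (hn : n ≠ 0) :
    ENat.card (GaloisField p n) = (p ^ n : ℕ) := by
  rw [ENat.card_eq_coe_natCard, GaloisField.card p n hn]

theorem two_ne_zero_of_charP (R : Type*) [NonAssocRing R] (p : ℕ) [CharP R p] (hp : 2 < p) :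
    (2 : R) ≠ 0 := fun h =>
  hp.not_ge (Nat.le_of_dvd two_pos ((CharP.cast_eq_zero_iff R p 2).1 (mod_cast h)))

theorem mul_one_sub_ne_one_of_card_eq_eight {K : Type*} [Field K] (h : Nat.card K = 8) (x : K) :
    x * (1 - x) ≠ 1 := by
  have : Finite K := Nat.finite_of_card_ne_zero (by omega)
  have : Fintype K := Fintype.ofFinite K
  intro hx
  have hx3 : x ^ 3 = -1 := by linear_combination -(x + 1) * hx
  have hx8 : x ^ 8 = x := by rw [← h, Nat.card_eq_fintype_card, FiniteField.pow_card]
  have hx2 : x = x ^ 2 := calc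
    x = (x ^ 3) ^ 2 * x ^ 2 := by rw [← pow_mul, ← pow_add, hx8]
    _ = x ^ 2 := by rw [hx3, neg_one_sq, one_mul]
  exact one_ne_zero (α := K) (by linear_combination hx2 - hx)

theorem unitsGenerated_galoisField_three : UnitsGenerated (GaloisField 3 1) :=
  UnitsGenerated.of_hom_zmod_three (GaloisField.equivZmodP 3)

theorem exists_isLifting_three_eight :
    ∃ φ : NearRegularRing →+* GaloisField 3 1 × GaloisField 2 3, IsLifting group φ := by
  obtain ⟨w, hw⟩ := exceptionalUnits_nonempty (K := GaloisField 2 3)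
    (by rw [enatCard_galoisField 2 three_ne_zero]; norm_num)
  have ha : ((-1, w) : GaloisField 3 1 × GaloisField 2 3) ∈ exceptionalUnits _ := by
    rw [exceptionalUnits_prod]
    exact ⟨neg_one_mem_exceptionalUnits (two_ne_zero_of_charP _ 3 (by norm_num)), hw⟩
  refine ⟨eval _ ha.1 ha.2, isLifting_eval ha.1 ha.2
    (RingHom.comp (GaloisField.equivZmodP 3) (RingHom.fst _ _)) ?_ ?_ ?_ ?_⟩
  · exact fun h => (Prod.isUnit_iff.1 h).2.ne_zero CharTwo.two_eq_zero
  · exact fun h => mul_one_sub_ne_one_of_card_eq_eight (GaloisField.card 2 3 three_ne_zero) w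
      (congrArg Prod.snd h)
  · rw [exceptionalUnits_prod, Set.ncard_prod, ncard_exceptionalUnits, ncard_exceptionalUnits,
      GaloisField.card 3 1 one_ne_zero, GaloisField.card 2 3 three_ne_zero]
    norm_num
  · exact unitsGenerated_galoisField_three.prod
      (by rw [enatCard_galoisField 2 three_ne_zero]; norm_num)

theorem exists_isLifting_three_four_five :
    ∃ φ : NearRegularRing →+* (GaloisField 3 1 × GaloisField 2 2) × GaloisField 5 1,
      IsLifting group φ := by
  have hcard₄ : 4 ≤ ENat.card (GaloisField 2 2) := by
    rw [enatCard_galoisField 2 two_ne_zero]; norm_num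
  have hcard₅ : 4 ≤ ENat.card (GaloisField 5 1) := by
    rw [enatCard_galoisField 5 one_ne_zero]; norm_num
  obtain ⟨w, hw⟩ := exceptionalUnits_nonempty (le_trans (by norm_num) hcard₄)
  have ha : (((-1, w), -1) : (GaloisField 3 1 × GaloisField 2 2) × GaloisField 5 1) ∈
      exceptionalUnits _ := by
    rw [exceptionalUnits_prod, exceptionalUnits_prod]
    exact ⟨⟨neg_one_mem_exceptionalUnits (two_ne_zero_of_charP _ 3 (by norm_num)), hw⟩,
      neg_one_mem_exceptionalUnits (two_ne_zero_of_charP _ 5 (by norm_num))⟩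
  refine ⟨eval _ ha.1 ha.2, isLifting_eval ha.1 ha.2 (RingHom.comp (GaloisField.equivZmodP 3)
    ((RingHom.fst _ _).comp (RingHom.fst _ _))) ?_ ?_ ?_ ?_⟩
  · exact fun h => (Prod.isUnit_iff.1 (Prod.isUnit_iff.1 h).1).2.ne_zero CharTwo.two_eq_zero
  · intro h
    have h₅ : (-1 : GaloisField 5 1) * (1 - -1) = 1 := congrArg Prod.snd h
    have h₃ : ((3 : ℕ) : GaloisField 5 1) = 0 := by push_cast; linear_combination -h₅
    exact absurd ((CharP.cast_eq_zero_iff (GaloisField 5 1) 5 3).1 h₃) (by decide)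
  · rw [exceptionalUnits_prod, exceptionalUnits_prod, Set.ncard_prod, Set.ncard_prod,
      ncard_exceptionalUnits, ncard_exceptionalUnits, ncard_exceptionalUnits,
      GaloisField.card 3 1 one_ne_zero, GaloisField.card 2 2 two_ne_zero,
      GaloisField.card 5 1 one_ne_zero]
    norm_num
  · exact (unitsGenerated_galoisField_three.prod hcard₄).prod hcard₅

end Ternary

section Embeddings

theorem isRingEmbedding_id (F : Type*) [Field F] :
    IsRingEmbedding (⊤ : Subgroup Fˣ) (MonoidWithZeroHom.id F) where
  mem_padd _ _ _ := Part.mem_some_iff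
  zeroOrMem_iff x := by
    rw [zeroOrMem_top_iff, isUnit_iff_ne_zero]
    exact iff_of_true (em _) ⟨x, rfl⟩

/-- The inclusion of `ℙ(R, S)` in `R`. -/
def FromRing.val (R : Type*) [CommRing R] [Nontrivial R] (S : Set Rˣ) : FromRing R S →*₀ R where
  toFun := Subtype.val
  map_zero' := rfl
  map_one' := rfl
  map_mul' _ _ := rfl

theorem isRingEmbedding_val (R : Type*) [CommRing R] [Nontrivial R] (S : Set Rˣ) :
    IsRingEmbedding (Subgroup.closure (S ∪ {-1})) (FromRing.val R S) where
  mem_padd _ _ _ := FromRing.mem_add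
  zeroOrMem_iff x := ⟨fun h => ⟨⟨x, h⟩, rfl⟩, by rintro ⟨p, rfl⟩; exact p.2⟩

/-- The product of two embeddings of partial fields in rings. -/
def DirectProduct.map {P Q R S : Type*} [PartialField P] [PartialField Q] [CommRing R] [CommRing S]
    (e : P →*₀ R) (f : Q →*₀ S) : DirectProduct P Q →*₀ R × S where
  toFun x := (e x.1.1, f x.1.2)
  map_zero' := Prod.ext (map_zero e) (map_zero f)
  map_one' := Prod.ext (map_one e) (map_one f)
  map_mul' x y := Prod.ext (map_mul e x.1.1 y.1.1) (map_mul f x.1.2 y.1.2)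

variable {P Q R S : Type*} [PartialField P] [PartialField Q] [CommRing R] [CommRing S]
  {e : P →*₀ R} {f : Q →*₀ S}

theorem IsRingEmbedding.isUnit_iff_exists (he : IsRingEmbedding (⊤ : Subgroup Rˣ) e) {x : R} :
    IsUnit x ↔ ∃ p ≠ 0, e p = x := by
  have := he.nontrivial
  constructor
  · intro hx
    obtain ⟨p, rfl⟩ := (he.zeroOrMem_iff x).1 (zeroOrMem_top_iff.2 (Or.inr hx))
    exact ⟨p, fun hp => hx.ne_zero (he.eq_zero_iff.2 hp), rfl⟩
  · rintro ⟨p, hp, rfl⟩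
    exact isUnit_map_of_ne_zero e hp

theorem IsRingEmbedding.directProduct (he : IsRingEmbedding (⊤ : Subgroup Rˣ) e)
    (hf : IsRingEmbedding (⊤ : Subgroup Sˣ) f) :
    IsRingEmbedding (⊤ : Subgroup (R × S)ˣ) (DirectProduct.map e f) where
  mem_padd p q r := by
    rw [Prod.ext_iff]
    exact DirectProduct.mem_add.trans (and_congr (he.mem_padd _ _ _) (hf.mem_padd _ _ _))
  zeroOrMem_iff x := by
    rw [zeroOrMem_top_iff, Prod.isUnit_iff, he.isUnit_iff_exists, hf.isUnit_iff_exists]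
    constructor
    · rintro (rfl | ⟨⟨p, hp, hpx⟩, q, hq, hqx⟩)
      · exact ⟨0, map_zero _⟩
      · exact ⟨⟨(p, q), iff_of_true hp hq⟩, Prod.ext hpx hqx⟩
    · rintro ⟨⟨⟨p, q⟩, hpq⟩, rfl⟩
      by_cases hp : p = 0
      · have hq : q = 0 := not_not.1 (mt hpq.2 (not_not.2 hp))
        exact Or.inl (Prod.ext (he.eq_zero_iff.2 hp) (hf.eq_zero_iff.2 hq))
      · exact Or.inr ⟨⟨p, hp, rfl⟩, q, hpq.1 hp, rfl⟩

end Embeddings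

section RingRepresentable

variable {α R S : Type*} [CommRing R] [CommRing S] {M : Matroid α}

theorem RingRepresentable.map [Nontrivial S] {G : Subgroup Rˣ} {H : Subgroup Sˣ}
    (h : RingRepresentable G M) (φ : R →+* S) (hφ : ∀ g ∈ G, imageUnit φ g ∈ H) :
    RingRepresentable H M := by
  obtain ⟨r, A, hA, hM⟩ := h
  refine ⟨r, A.map φ, hA.map φ hφ, (represents_map_iff φ fun f => ?_).2 hM⟩
  rcases hA r id f with h | ⟨g, -, h⟩
  · rw [h, map_zero]
    exact iff_of_true rfl rfl
  · have := φ.domain_nontrivial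
    rw [← h]
    exact iff_of_false (imageUnit φ g).ne_zero g.ne_zero

theorem RingRepresentable.of_injective {G : Subgroup Rˣ} {H : Subgroup Sˣ}
    (h : RingRepresentable H M) (φ : R →+* S) (hinj : Function.Injective φ)
    (hφ : ∀ h ∈ H, ∃ g ∈ G, imageUnit φ g = h) : RingRepresentable G M := by
  obtain ⟨r, A, hA, hM⟩ := h
  have lift : ∀ x, ZeroOrMem H x → ∃ y, ZeroOrMem G y ∧ φ y = x := by
    rintro x (rfl | ⟨h, hh, rfl⟩)
    · exact ⟨0, .zero, map_zero φ⟩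
    · obtain ⟨g, hg, rfl⟩ := hφ h hh
      exact ⟨g, .of_mem hg, rfl⟩
  choose A' _ hA' using fun i j => lift _ (hA.apply i j)
  obtain rfl : (Matrix.of A').map φ = A := by ext i j; exact hA' i j
  refine ⟨r, Matrix.of A', fun k f g => ?_,
    (represents_map_iff φ fun _ => map_eq_zero_iff φ hinj).1 hM⟩
  obtain ⟨y, hy, hdet⟩ := lift _ (hA k f g)
  rw [submatrix_map, ← RingHom.mapMatrix_apply, ← RingHom.map_det] at hdet
  rwa [← hinj hdet]

end RingRepresentable

section ProductMatrix

variable {X Y X' Y' R S : Type*}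

/-- The matrix over `R × S` with components `A` and `B`. -/
def prodMatrix (A : Matrix X Y R) (B : Matrix X Y S) : Matrix X Y (R × S) :=
  Matrix.of fun i j => (A i j, B i j)

theorem submatrix_prodMatrix (A : Matrix X Y R) (B : Matrix X Y S) (f : X' → X) (g : Y' → Y) :
    (prodMatrix A B).submatrix f g = prodMatrix (A.submatrix f g) (B.submatrix f g) := rfl

theorem prodMatrix_one [DecidableEq X] [Zero R] [One R] [Zero S] [One S] :
    prodMatrix (1 : Matrix X X R) (1 : Matrix X X S) = 1 := by
  refine Matrix.ext fun i j => ?_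
  simp only [prodMatrix, of_apply, one_apply]
  split_ifs <;> rfl

theorem det_prodMatrix [Fintype X] [DecidableEq X] [CommRing R] [CommRing S] (A : Matrix X X R)
    (B : Matrix X X S) : (prodMatrix A B).det = (A.det, B.det) :=
  Prod.ext ((RingHom.fst R S).map_det _) ((RingHom.snd R S).map_det _)

end ProductMatrix

section ProductRepresentation

variable {α R S : Type*} [CommRing R] [CommRing S] {M : Matroid α} {r : ℕ}

theorem Represents.det_submatrix_ne_zero_iff {A : Matrix (Fin r) M.E R} (hA : Represents M A)
    (f : Fin r ↪ M.E) :
    (A.submatrix id f).det ≠ 0 ↔ M.IsBase (Set.range fun i => (f i : α)) := by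
  refine ⟨fun h => (hA _).2 ⟨f, rfl, h⟩, fun h => ?_⟩
  obtain ⟨f', hf', hdet⟩ := (hA _).1 h
  have hrange : Set.range f' = Set.range f := by
    apply Subtype.val_injective.image_injective
    rw [← Set.range_comp, ← Set.range_comp]
    exact hf'
  let σ : Equiv.Perm (Fin r) := (Equiv.ofInjective f' f'.injective).trans
    ((Equiv.setCongr hrange).trans (Equiv.ofInjective f f.injective).symm)
  have hσ : ⇑f' = f ∘ σ := by
    ext i
    simp [σ, Equiv.apply_ofInjective_symm]
  intro h0
  rw [hσ, show A.submatrix id (f ∘ σ) = (A.submatrix id f).submatrix id σ from rfl, det_permute',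
    h0, mul_zero] at hdet
  exact hdet rfl

theorem Represents.rank_eq {A : Matrix (Fin r) M.E R} (hA : Represents M A) {s : ℕ}
    {B : Matrix (Fin s) M.E S} (hB : Represents M B) : r = s := by
  obtain ⟨X, hX⟩ := M.exists_isBase
  have hcard : ∀ {k : ℕ} (f : Fin k ↪ M.E), (Set.range fun i => (f i : α)) = X → k = X.ncard := by
    rintro k f rfl
    exact (Nat.card_fin k).symm.trans
      (Set.ncard_range_of_injective (Subtype.val_injective.comp f.injective)).symm
  obtain ⟨f, hf, -⟩ := (hA X).1 hX
  obtain ⟨g, hg, -⟩ := (hB X).1 hX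
  rw [hcard f hf, hcard g hg]

theorem Represents.exists_submatrix_eq_one {K : Type*} [Field K] {A : Matrix (Fin r) M.E K}
    (hA : Represents M A) {f₀ : Fin r ↪ M.E} (h₀ : M.IsBase (Set.range fun i => (f₀ i : α))) :
    ∃ D : Matrix (Fin r) M.E K, D.submatrix id f₀ = 1 ∧ Represents M D := by
  have hdet := ((hA.det_submatrix_ne_zero_iff f₀).2 h₀).isUnit
  have hsub : ∀ f : Fin r → M.E, ((A.submatrix id f₀)⁻¹ * A).submatrix id f =
      (A.submatrix id f₀)⁻¹ * A.submatrix id f := fun f => rfl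
  refine ⟨(A.submatrix id f₀)⁻¹ * A, ?_, fun B => (hA B).trans (exists_congr fun f =>
    and_congr_right fun _ => ?_)⟩
  · rw [hsub, nonsing_inv_mul _ hdet]
  · rw [hsub, det_mul, det_nonsing_inv, mul_ne_zero_iff, and_iff_right hdet.ringInverse.ne_zero]

theorem Represents.prodMatrix {A : Matrix (Fin r) M.E R} {B : Matrix (Fin r) M.E S}
    (hA : Represents M A) (hB : Represents M B) : Represents M (prodMatrix A B) := by
  have hdet : ∀ f : Fin r ↪ M.E, ((PartialField.prodMatrix A B).submatrix id f).det ≠ 0 ↔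
      (A.submatrix id f).det ≠ 0 := by
    intro f
    have hAB := (hA.det_submatrix_ne_zero_iff f).trans (hB.det_submatrix_ne_zero_iff f).symm
    rw [submatrix_prodMatrix, det_prodMatrix, ne_eq, Prod.mk_eq_zero, ← not_iff_not.1 hAB,
      and_self]
  exact fun X => (hA X).trans (exists_congr fun f => and_congr_right fun _ => (hdet f).symm)

theorem minorsIn_of_submatrix_eq_one {X Y : Type*} [Fintype X] [DecidableEq X]
    {G : Subgroup Rˣ} {N : Matrix X Y R} {f₀ : X → Y} (h₀ : N.submatrix id f₀ = 1)
    (hN : ∀ f : X ↪ Y, ZeroOrMem G (N.submatrix id f).det) : MinorsIn G N := by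
  intro k f g
  by_cases hf : Function.Injective f
  · rw [det_submatrix_eq_det_extend N h₀ hf g]
    by_cases hg : Function.Injective (Function.extend f g f₀)
    · exact hN ⟨_, hg⟩
    · rw [det_submatrix_eq_zero_of_not_injective_right _ _ hg]; exact .zero
  · rw [det_submatrix_eq_zero_of_not_injective_left _ _ hf]; exact .zero

theorem RingRepresentable.prod {K L : Type*} [Field K] [Field L]
    (hK : RingRepresentable (⊤ : Subgroup Kˣ) M) (hL : RingRepresentable (⊤ : Subgroup Lˣ) M) :
    RingRepresentable (⊤ : Subgroup (K × L)ˣ) M := by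
  obtain ⟨r, A, -, hA⟩ := hK
  obtain ⟨s, B, -, hB⟩ := hL
  obtain rfl := hA.rank_eq hB
  obtain ⟨X, hX⟩ := M.exists_isBase
  obtain ⟨f₀, rfl, -⟩ := (hA X).1 hX
  obtain ⟨C, hC₀, hC⟩ := hA.exists_submatrix_eq_one hX
  obtain ⟨D, hD₀, hD⟩ := hB.exists_submatrix_eq_one hX
  refine ⟨r, prodMatrix C D, minorsIn_of_submatrix_eq_one (f₀ := f₀) ?_ fun f => ?_,
    hC.prodMatrix hD⟩
  · rw [submatrix_prodMatrix, hC₀, hD₀, prodMatrix_one]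
  · have hCD := (hC.det_submatrix_ne_zero_iff f).trans (hD.det_submatrix_ne_zero_iff f).symm
    rw [submatrix_prodMatrix, det_prodMatrix, zeroOrMem_top_iff, Prod.isUnit_iff,
      isUnit_iff_ne_zero, isUnit_iff_ne_zero, Prod.mk_eq_zero]
    tauto

end ProductRepresentation

section NearRegular

open NearRegularRing Polynomial

theorem one_sub_ratFunc_X_ne_zero (K : Type*) [Field K] : (1 - RatFunc.X : RatFunc K) ≠ 0 := by
  rw [← RatFunc.algebraMap_X, ← map_one (algebraMap K[X] (RatFunc K)), ← map_sub]
  exact RatFunc.algebraMap_ne_zero (sub_ne_zero.2 (X_ne_C (1 : K)).symm)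

/-- The inclusion of `ℤ[α, 1/α, 1/(1-α)]` in `ℚ(α)`. -/
noncomputable def toRatFunc : NearRegularRing →+* RatFunc ℚ :=
  eval RatFunc.X RatFunc.X_ne_zero.isUnit (one_sub_ratFunc_X_ne_zero ℚ).isUnit

theorem toRatFunc_injective : Function.Injective toRatFunc := by
  have hpoly : toRatFunc.comp (algebraMap ℤ[X] NearRegularRing) =
      (algebraMap ℚ[X] (RatFunc ℚ)).comp (mapRingHom (Int.castRingHom ℚ)) := by
    ext <;> simp [toRatFunc, eval_algebraMap]
  have hinj : Function.Injective (toRatFunc.comp (algebraMap ℤ[X] NearRegularRing)) := by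
    rw [hpoly]
    exact (RatFunc.algebraMap_injective ℚ).comp (map_injective _ (Int.castRingHom ℚ).injective_int)
  rw [injective_iff_map_eq_zero]
  intro x hx
  obtain ⟨⟨p, s⟩, hp⟩ := IsLocalization.surj (Submonoid.powers (X * (1 - X) : ℤ[X])) x
  have hp0 : p = 0 := (map_eq_zero_iff _ hinj).1 (by
    rw [RingHom.comp_apply, ← hp, map_mul, hx, zero_mul])
  rw [hp0, map_zero] at hp
  exact ((IsLocalization.map_units NearRegularRing s).mul_left_eq_zero).1 hp

theorem map_group : group.map (imageUnit toRatFunc) =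
    Subgroup.closure ({u : (RatFunc ℚ)ˣ | (u : RatFunc ℚ) = RatFunc.X ∨
      (u : RatFunc ℚ) = 1 - RatFunc.X} ∪ {-1}) := by
  have ha : (imageUnit toRatFunc alpha : RatFunc ℚ) = RatFunc.X := eval_alpha _ _ _
  have hb : (imageUnit toRatFunc beta : RatFunc ℚ) = 1 - RatFunc.X := eval_beta _ _ _
  have hneg : imageUnit toRatFunc (-1) = -1 := Units.ext (by simp)
  rw [group, MonoidHom.map_closure]
  congr 1
  ext u
  simp only [Set.image_insert_eq, Set.image_singleton, Set.mem_insert_iff, Set.mem_singleton_iff,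
    Set.mem_union, Set.mem_ofPred_eq, or_assoc, hneg]
  rw [← hb, ← ha, ← Units.ext_iff, ← Units.ext_iff]

theorem nearRegular_iff {α : Type*} (M : Matroid α) :
    NearRegular M ↔ RingRepresentable group M := by
  rw [NearRegular, (isRingEmbedding_val _ _).representable_iff, ← map_group]
  exact ⟨fun h => h.of_injective toRatFunc toRatFunc_injective fun _ h => h,
    fun h => h.map toRatFunc fun g hg => ⟨g, hg, rfl⟩⟩

theorem RingRepresentable.field {α : Type*} {M : Matroid α} (h : RingRepresentable group M)
    {F : Type*} [Field F] (hF : 3 ≤ ENat.card F) : RingRepresentable (⊤ : Subgroup Fˣ) M := by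
  obtain ⟨a, ha⟩ := exceptionalUnits_nonempty hF
  exact h.map (eval a ha.1 ha.2) fun _ _ => trivial

end NearRegular

section Matroids

variable {α : Type*}

theorem ringRepresentable_of_forall_field {M : Matroid α}
    (h : ∀ (F : Type*) [Field F], 3 ≤ ENat.card F → Representable F M) {K : Type} [Field K]
    (hK : 3 ≤ ENat.card K) : RingRepresentable (⊤ : Subgroup Kˣ) M := by
  have hlift := ((isRingEmbedding_id _).representable_iff M).1
    (h (ULift K) (hK.trans_eq (ENat.card_congr Equiv.ulift).symm))
  exact hlift.map (ULift.ringEquiv (R := K)).toRingHom fun _ _ => trivial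

theorem representable_three_four_five_iff (M : Matroid α) :
    Representable (DirectProduct (DirectProduct (GaloisField 3 1) (GaloisField 2 2))
      (GaloisField 5 1)) M ↔ RingRepresentable
        (⊤ : Subgroup ((GaloisField 3 1 × GaloisField 2 2) × GaloisField 5 1)ˣ) M :=
  (((isRingEmbedding_id _).directProduct (isRingEmbedding_id _)).directProduct
    (isRingEmbedding_id _)).representable_iff M

theorem representable_three_eight_iff (M : Matroid α) :
    Representable (DirectProduct (GaloisField 3 1) (GaloisField 2 3)) M ↔
      RingRepresentable (⊤ : Subgroup (GaloisField 3 1 × GaloisField 2 3)ˣ) M :=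
  ((isRingEmbedding_id _).directProduct (isRingEmbedding_id _)).representable_iff M

end Matroids

end PartialField

theorem mainTheorem9_general {α : Type*} (M : Matroid α) :
    List.TFAE [
      PartialField.Representable
        (PartialField.DirectProduct
          (PartialField.DirectProduct (GaloisField 3 1) (GaloisField 2 2)) (GaloisField 5 1)) M,
      PartialField.Representable
        (PartialField.DirectProduct (GaloisField 3 1) (GaloisField 2 3)) M,
      PartialField.NearRegular M,
      ∀ (F : Type*) [Field F], 3 ≤ ENat.card F → PartialField.Representable F M] := by
  rw [PartialField.representable_three_four_five_iff, PartialField.representable_three_eight_iff,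
    PartialField.nearRegular_iff]
  obtain ⟨φ, hφ⟩ := PartialField.exists_isLifting_three_four_five
  obtain ⟨ψ, hψ⟩ := PartialField.exists_isLifting_three_eight
  tfae_have 1 → 3 := hφ.ringRepresentable
  tfae_have 2 → 3 := hψ.ringRepresentable
  tfae_have 3 → 1 := fun h => h.map φ fun _ _ => trivial
  tfae_have 3 → 4 := fun h F _ hF =>
    ((PartialField.isRingEmbedding_id F).representable_iff M).2 (h.field hF)
  tfae_have 4 → 2 := fun h =>
    .prod
      (PartialField.ringRepresentable_of_forall_field h
        (by rw [PartialField.enatCard_galoisField 3 one_ne_zero]; norm_num))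
      (PartialField.ringRepresentable_of_forall_field h
        (by rw [PartialField.enatCard_galoisField 2 three_ne_zero]; norm_num))
  tfae_finish

theorem mainTheorem9 {α : Type*} (M : Matroid α) [M.Finite] :
    List.TFAE [
      PartialField.Representable
        (PartialField.DirectProduct
          (PartialField.DirectProduct (GaloisField 3 1) (GaloisField 2 2)) (GaloisField 5 1)) M,
      PartialField.Representable
        (PartialField.DirectProduct (GaloisField 3 1) (GaloisField 2 3)) M,
      PartialField.NearRegular M,
      ∀ (F : Type*) [Field F], 3 ≤ ENat.card F → PartialField.Representable F M] :=
  mainTheorem9_general M
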